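/- **Conventions.** An N-manifold is given by a graded algebra $C(X)$ isomorphic to $\Gamma(S^{\ge 0}V^*)$ for some $\mathbb Z^{<0}$-graded vector bundle $V$ over a smooth manifold; a morphism $X\to Y$ in $\mathsf{NMfd}$ is a morphism of graded algebras $C(Y)\to C(X)$. Write $\mathfrak S(V)$ for the N-manifold with $C(\mathfrak S(V))=\Gamma(S^{\ge0}V^*)$. A morphism of split N-manifolds is *strict* if it is induced by a morphism of graded vector bundles, and it is a *strict embedding* if it is induced by one which is fibrewise injective and covers an embedding of the base manifolds. Let $C(D^l)=\mathbb R[\epsilon_1,\dots,\epsilon_l]$ with anticommuting $\epsilon_j$ of degree $-1$, and let $T[1]^lM$ be the N-manifold representing $\mathrm{Hom}(D^l,M)\colon X\mapsto \hom(D^l\times X,M)$. For $0\le i<l$ let $\sigma_i\colon T[1]^lM\to T[1]^{l-1}M$ be the morphism induced by the map $D^{l-1}\to D^l$ which pulls back $\epsilon_j$ to $\epsilon_j$ for $j\le i$ and to $\epsilon_{j-1}$ for $j>i$, where $\epsilon_0:=0$. A connection $\nabla$ on $TM$ determines, through the iterated identification $T[1]^{l+1}M=T[1](T[1]^lM)$,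 splittings $$T[1]^lM\cong\mathfrak S\Big(\bigoplus_{\emptyset\ne I\subseteq\{1,\dots,l\}}TM_I\Big),\qquad TM_I=TM \text{ in degree } -|I|.$$ For $k\ge1$, the quotient $T[1]^kM/T[k]M$ is realized as $\mathfrak S\big(\bigoplus_I TM_I\big)$, the sum being over the nonempty proper subsets $I\subsetneq\{1,\dots,k\}$, with quotient morphism $q\colon T[1]^kM\to T[1]^kM/T[k]M$ induced by the projection that kills the summand $I=\{1,\dots,k\}$. The product $(T[1]^{k-1}M)^{k}$ is the split N-manifold of the external direct sum of $k$ copies of the graded vector bundle of $T[1]^{k-1}M$, over $M^k$. **Lemma.** Let $M$ be a smooth manifold (finite-dimensional, Hausdorff, second countable), let $\nabla$ be a smooth connection on $TM$, and let $k\ge 1$. The split N-manifolds above, with the morphisms $D^l\times T[1]^lM\to M$ determined by $\nabla$, represent $\mathrm{Hom}(D^l,M)$ for all $l\ge 0$. The morphisms $\sigma_0,\dots,\sigma_{k-1}\colon T[1]^kM\to T[1]^{k-1}M$ descend along $q$ to morphisms $T[1]^kM/T[k]M\to T[1]^{k-1}M$, again denoted $\sigma_i$. With these morphisms, $T[1]^kM/T[k]M$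 is the limit in $\mathsf{NMfd}$ of the family of squares $$\sigma_i\circ\sigma_{j+1}=\sigma_j\circ\sigma_i\colon\; T[1]^kM/T[k]M\to T[1]^{k-2}M,\qquad 0\le i\le j\le k-2,$$ that is, it is universal among N-manifolds $X$ with morphisms $f_0,\dots,f_{k-1}\colon X\to T[1]^{k-1}M$ that satisfy $\sigma_i\circ f_{j+1}=\sigma_j\circ f_i$ for all $0\le i\le j\le k-2$. Moreover, the map $$(\sigma_0,\dots,\sigma_{k-1})\colon T[1]^kM/T[k]M\longrightarrow (T[1]^{k-1}M)^{k}$$ is a strict embedding with respect to the splittings determined by $\nabla$. -/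

import Mathlib

open Bundle Set Filter Topology CategoryTheory
open scoped Manifold ContDiff

universe u

namespace NGraded

noncomputable section

/-! ### Manifolds and graded vector bundles -/

/-- A smooth manifold: finite dimensional, without boundary, Hausdorff, second countable. -/
structure Mfd : Type (u + 1) where
  E : Type u
  [normedAddCommGroup : NormedAddCommGroup E]
  [normedSpace : NormedSpace ℝ E]
  [finiteDimensional : FiniteDimensional ℝ E]
  pt : Type u
  [topology : TopologicalSpace pt]
  [charts : ChartedSpace E pt]
  [smooth : IsManifold 𝓘(ℝ, E) ∞ pt]
  [t2 : T2Space pt]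
  [secondCountable : SecondCountableTopology pt]

attribute [instance] Mfd.normedAddCommGroup Mfd.normedSpace Mfd.finiteDimensional Mfd.topology
  Mfd.charts Mfd.smooth Mfd.t2 Mfd.secondCountable

/-- The algebra `C^∞(M)`. -/
abbrev Mfd.Fun (M : Mfd.{u}) : Type u := C^∞⟮𝓘(ℝ, M.E), M.pt; 𝓘(ℝ, ℝ), ℝ⟯

/-- The tangent bundle of `M`, as a family of fibres. -/
abbrev Mfd.T (M : Mfd.{u}) : M.pt → Type u := fun x => TangentSpace 𝓘(ℝ, M.E) x

/-- The product charts on `M^k`. -/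
abbrev powCharts (M : Mfd.{u}) (k : ℕ) : ChartedSpace (Fin k → M.E) (Fin k → M.pt) :=
  piChartedSpace (fun _ : Fin k => M.E) (fun _ : Fin k => M.pt)

section Pow

attribute [local instance] powCharts

theorem powCharts_mem {M : Mfd.{u}} {k : ℕ} {e : OpenPartialHomeomorph (Fin k → M.pt) (Fin k → M.E)}
    (he : e ∈ atlas (Fin k → M.E) (Fin k → M.pt)) :
    ∃ f : Fin k → OpenPartialHomeomorph M.pt M.E, (∀ i, f i ∈ atlas M.E M.pt) ∧
      e = OpenPartialHomeomorph.pi f := by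
  obtain ⟨f, hf, rfl⟩ := he
  exact ⟨f, fun i => hf i (mem_univ i), rfl⟩

theorem powSmooth (M : Mfd.{u}) (k : ℕ) :
    IsManifold 𝓘(ℝ, Fin k → M.E) ∞ (Fin k → M.pt) := by
  refine isManifold_of_contDiffOn _ _ _ ?_
  intro e e' he he'
  obtain ⟨f, hf, rfl⟩ := powCharts_mem he
  obtain ⟨f', hf', rfl⟩ := powCharts_mem he'
  rw [contDiffOn_pi]
  intro i
  have h := (contDiffGroupoid ∞ 𝓘(ℝ, M.E)).compatible (hf i) (hf' i)
  rw [contDiffGroupoid, mem_groupoid_of_pregroupoid] at h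
  have h2 : ContDiffOn ℝ ∞ ((f i).symm.trans (f' i)) ((f i).symm.trans (f' i)).source := by
    simpa [contDiffPregroupoid] using h.1
  refine (h2.comp (contDiff_apply ℝ M.E i).contDiffOn ?_ : ContDiffOn ℝ ∞ _ _)
  rintro x ⟨⟨hx1, hx2⟩, -⟩
  exact ⟨hx1 i (mem_univ i), hx2 i (mem_univ i)⟩

theorem contMDiff_powProj (M : Mfd.{u}) (k : ℕ) (i : Fin k) :
    ContMDiff 𝓘(ℝ, Fin k → M.E) 𝓘(ℝ, M.E) ∞ (fun y : Fin k → M.pt => y i) := by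
  intro y
  have h2 : ContMDiffAt 𝓘(ℝ, Fin k → M.E) 𝓘(ℝ, Fin k → M.E) ∞
      (chartAt (Fin k → M.E) y) y := contMDiffAt_extChartAt
  have h3 : ContMDiffAt 𝓘(ℝ, M.E) 𝓘(ℝ, M.E) ∞ (chartAt M.E (y i)).symm
      (chartAt M.E (y i) (y i)) :=
    (contMDiffOn_chart_symm (I := 𝓘(ℝ, M.E)) (x := y i)).contMDiffAt
      ((chartAt M.E (y i)).open_target.mem_nhds (mem_chart_target M.E (y i)))
  have h4 : ContMDiffAt 𝓘(ℝ, Fin k → M.E) 𝓘(ℝ, M.E) ∞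
      (fun z : Fin k → M.pt => chartAt M.E (y i) (z i)) y :=
    ((contDiff_apply ℝ M.E i).contMDiff.contMDiffAt).comp y h2
  refine (h3.comp y h4).congr_of_eventuallyEq ?_
  have : ∀ᶠ z : Fin k → M.pt in 𝓝 y, z i ∈ (chartAt M.E (y i)).source :=
    (continuous_apply i).continuousAt.eventually
      ((chartAt M.E (y i)).open_source.mem_nhds (mem_chart_source M.E (y i)))
  filter_upwards [this] with z hz
  exact ((chartAt M.E (y i)).left_inv hz).symm
end Pow

/-- The product manifold `M^k`. -/
def Mfd.pow (M : Mfd.{u}) (k : ℕ) : Mfd.{u} :=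
  letI := powCharts M k
  haveI := powSmooth M k
  { E := Fin k → M.E
    pt := Fin k → M.pt }

/-- The `i`-th projection `M^k → M`. -/
def Mfd.powProj (M : Mfd.{u}) (k : ℕ) (i : Fin k) :
    C^∞⟮𝓘(ℝ, (M.pow k).E), (M.pow k).pt; 𝓘(ℝ, M.E), M.pt⟯ :=
  ⟨fun y => y i, contMDiff_powProj M k i⟩

/-- A `ℤ^{<0}`-graded vector bundle over `M`, presented as a direct sum of vector bundles `V a`,
`a : ι`, where `V a` sits in degree `-deg a < 0`; in each degree there are finitely many summands,
each of finite rank. -/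
structure GrBundle (M : Mfd.{u}) : Type (u + 1) where
  ι : Type
  deg : ι → ℕ
  deg_pos : ∀ a, 0 < deg a
  finite_deg : ∀ n, {a | deg a = n}.Finite
  F : ι → Type u
  [normedAddCommGroup : ∀ a, NormedAddCommGroup (F a)]
  [normedSpace : ∀ a, NormedSpace ℝ (F a)]
  [finiteDimensional : ∀ a, FiniteDimensional ℝ (F a)]
  V : ι → M.pt → Type u
  [addCommGroup : ∀ a y, AddCommGroup (V a y)]
  [module : ∀ a y, Module ℝ (V a y)]
  [fiberTopology : ∀ a y, TopologicalSpace (V a y)]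
  [totalTopology : ∀ a, TopologicalSpace (TotalSpace (F a) (V a))]
  [fiberBundle : ∀ a, FiberBundle (F a) (V a)]
  [vectorBundle : ∀ a, VectorBundle ℝ (F a) (V a)]
  [smooth : ∀ a, ContMDiffVectorBundle ∞ (F a) (V a) 𝓘(ℝ, M.E)]

attribute [instance] GrBundle.normedAddCommGroup GrBundle.normedSpace GrBundle.finiteDimensional
  GrBundle.addCommGroup GrBundle.module GrBundle.fiberTopology GrBundle.totalTopology
  GrBundle.fiberBundle GrBundle.vectorBundle GrBundle.smooth

/-- A smooth section of the dual of a vector bundle `V → M`, that is, a smooth function on the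
total space of `V` which is linear on each fibre. -/
structure DualSection (M : Mfd.{u}) (F : Type u) [NormedAddCommGroup F] [NormedSpace ℝ F]
    (V : M.pt → Type u) [∀ y, AddCommGroup (V y)] [∀ y, Module ℝ (V y)]
    [∀ y, TopologicalSpace (V y)] [TopologicalSpace (TotalSpace F V)] [FiberBundle F V] where
  toFun : ∀ y, V y →ₗ[ℝ] ℝ
  smooth : ContMDiff (𝓘(ℝ, M.E).prod 𝓘(ℝ, F)) 𝓘(ℝ, ℝ) ∞
    (fun v : TotalSpace F V => toFun v.proj v.snd)

/-- Smooth 1-forms on `M`. -/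
abbrev OneForm (M : Mfd.{u}) : Type u := DualSection M M.E M.T

/-! ### Graded symmetric algebras -/

namespace GSym

variable {ι : Type} (deg : ι → ℕ) (U : ι → Type u) [∀ a, AddCommGroup (U a)] [∀ a, Module ℝ (U a)]

open Classical in
/-- The inclusion of `U a` into the tensor algebra of `⨁ a, U a`. -/
def tens (a : ι) : U a →ₗ[ℝ] TensorAlgebra ℝ (DirectSum ι U) :=
  (TensorAlgebra.ι ℝ).comp (DirectSum.lof ℝ ι U a)

/-- The relations of graded commutativity, the elements of `U a` having degree `deg a`. -/
inductive Rel : TensorAlgebra ℝ (DirectSum ι U) → TensorAlgebra ℝ (DirectSum ι U) → Prop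
  | swap (a b : ι) (v : U a) (w : U b) :
      Rel (tens U a v * tens U b w) ((-1 : ℝ) ^ (deg a * deg b) • (tens U b w * tens U a v))

end GSym

/-- The graded symmetric algebra `S^{≥0}(⨁ a, U a)`, the elements of `U a` having degree
`deg a`. -/
abbrev GSym {ι : Type} (deg : ι → ℕ) (U : ι → Type u) [∀ a, AddCommGroup (U a)]
    [∀ a, Module ℝ (U a)] : Type u :=
  RingQuot (GSym.Rel deg U)

namespace GSym

variable {ι : Type} (deg : ι → ℕ) (U : ι → Type u) [∀ a, AddCommGroup (U a)] [∀ a, Module ℝ (U a)]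

/-- The generators of the graded symmetric algebra. -/
def gen (a : ι) : U a →ₗ[ℝ] GSym deg U :=
  (RingQuot.mkAlgHom ℝ (Rel deg U)).toLinearMap.comp (tens U a)

/-- The elements of degree `n`: linear combinations of products of generators of total
degree `n`. -/
def part (n : ℕ) : Submodule ℝ (GSym deg U) :=
  Submodule.span ℝ {z | ∃ L : List (Σ a, U a),
    (L.map fun p => deg p.1).sum = n ∧ (L.map fun p => gen deg U p.1 p.2).prod = z}

theorem algebraMap_mem_part (r : ℝ) : algebraMap ℝ (GSym deg U) r ∈ part deg U 0 := by
  rw [Algebra.algebraMap_eq_smul_one]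
  exact Submodule.smul_mem _ _ (Submodule.subset_span ⟨[], by simp, by simp⟩)

theorem gen_mem_part (a : ι) (v : U a) : gen deg U a v ∈ part deg U (deg a) :=
  Submodule.subset_span ⟨[⟨a, v⟩], by simp, by simp⟩

theorem mul_mem_part {m n : ℕ} {z w : GSym deg U} (hz : z ∈ part deg U m)
    (hw : w ∈ part deg U n) : z * w ∈ part deg U (m + n) := by
  have h := Submodule.mul_mem_mul hz hw
  rw [part, part, Submodule.span_mul_span] at h
  refine Submodule.span_mono ?_ h
  rintro _ ⟨_, ⟨L, hL, rfl⟩, _, ⟨L', hL', rfl⟩, rfl⟩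
  exact ⟨L ++ L', by simp [hL, hL'], by simp⟩

end GSym

/-! ### The function algebra of a split graded manifold -/

namespace GrBundle

variable {M : Mfd.{u}} (V : GrBundle M)

/-- Smooth sections of the dual of the summand `V a`. -/
abbrev DualSec (a : V.ι) : Type u := DualSection M (V.F a) (V.V a)

/-- The fibre of `S^{≥0} V^*` at `y`. -/
abbrev Fib (y : M.pt) : Type u := GSym V.deg (fun a => Module.Dual ℝ (V.V a y))

/-- Sections of `S^{≥0} V^*`, without any smoothness condition, with the pointwise product. -/
abbrev Raw : Type u := ∀ y, V.Fib y

/-- The inclusion `V_a^* → S^{≥0} V^*` on the fibre at `y`. -/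
abbrev gen (a : V.ι) (y : M.pt) : Module.Dual ℝ (V.V a y) →ₗ[ℝ] V.Fib y :=
  GSym.gen V.deg (fun a => Module.Dual ℝ (V.V a y)) a

/-- The degree `n` part of the fibre of `S^{≥0} V^*` at `y`. -/
abbrev part (y : M.pt) (n : ℕ) : Submodule ℝ (V.Fib y) :=
  GSym.part V.deg (fun a => Module.Dual ℝ (V.V a y)) n

/-- A function on `M` as a section of `S^0 V^*`. -/
def fnRaw (f : M.pt → ℝ) : V.Raw := fun y => algebraMap ℝ (V.Fib y) (f y)

/-- A section of `V_a^*` as a section of `S^1 V^*`. -/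
def secRaw (a : V.ι) (s : ∀ y, V.V a y →ₗ[ℝ] ℝ) : V.Raw := fun y => V.gen a y (s y)

/-- The polynomials in smooth functions on `M` and smooth sections of `V^*`. -/
def poly : Subalgebra ℝ V.Raw :=
  Algebra.adjoin ℝ ({z | ∃ f : M.Fun, z = V.fnRaw f} ∪
    {z | ∃ (a : V.ι) (s : V.DualSec a), z = V.secRaw a s.toFun})

/-- The smooth sections of `(S^{≥0} V^*)_n`: they lie in degree `n` at each point, and near each
point they are polynomials in smooth functions and smooth sections of `V^*`. -/
def smoothPart (n : ℕ) : Submodule ℝ V.Raw where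
  carrier := {z | (∀ y, z y ∈ V.part y n) ∧
    ∀ y₀, ∃ p ∈ V.poly, ∀ᶠ y in 𝓝 y₀, z y = p y}
  zero_mem' := ⟨fun _ => Submodule.zero_mem _, fun _ => ⟨0, V.poly.zero_mem, by simp⟩⟩
  add_mem' := by
    rintro z η ⟨h₁, h₂⟩ ⟨h₁', h₂'⟩
    refine ⟨fun y => Submodule.add_mem _ (h₁ y) (h₁' y), fun y₀ => ?_⟩
    obtain ⟨p, hp, hp'⟩ := h₂ y₀
    obtain ⟨q, hq, hq'⟩ := h₂' y₀
    refine ⟨p + q, V.poly.add_mem hp hq, ?_⟩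
    filter_upwards [hp', hq'] with y h h'
    simp [h, h']
  smul_mem' := by
    rintro r z ⟨h₁, h₂⟩
    refine ⟨fun y => Submodule.smul_mem _ _ (h₁ y), fun y₀ => ?_⟩
    obtain ⟨p, hp, hp'⟩ := h₂ y₀
    refine ⟨r • p, V.poly.smul_mem hp r, ?_⟩
    filter_upwards [hp'] with y h
    simp [h]

theorem mul_mem_smoothPart {m n : ℕ} {z η : V.Raw} (hz : z ∈ V.smoothPart m)
    (hη : η ∈ V.smoothPart n) : z * η ∈ V.smoothPart (m + n) := by
  obtain ⟨h₁, h₂⟩ := hz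
  obtain ⟨h₁', h₂'⟩ := hη
  refine ⟨fun y => GSym.mul_mem_part _ _ (h₁ y) (h₁' y), fun y₀ => ?_⟩
  obtain ⟨p, hp, hp'⟩ := h₂ y₀
  obtain ⟨q, hq, hq'⟩ := h₂' y₀
  refine ⟨p * q, V.poly.mul_mem hp hq, ?_⟩
  filter_upwards [hp', hq'] with y h h'
  simp [h, h']

theorem fnRaw_mem (f : M.Fun) : V.fnRaw f ∈ V.smoothPart 0 :=
  ⟨fun _ => GSym.algebraMap_mem_part _ _ _, fun _ =>
    ⟨V.fnRaw f, Algebra.subset_adjoin (Or.inl ⟨f, rfl⟩), Eventually.of_forall fun _ => rfl⟩⟩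

theorem secRaw_mem (a : V.ι) (s : V.DualSec a) : V.secRaw a s.toFun ∈ V.smoothPart (V.deg a) :=
  ⟨fun _ => GSym.gen_mem_part _ _ _ _, fun _ =>
    ⟨_, Algebra.subset_adjoin (Or.inr ⟨a, s, rfl⟩), Eventually.of_forall fun _ => rfl⟩⟩

/-- The algebra `Γ(S^{≥0} V^*) = ⨁ₙ Γ((S^{≥0} V^*)_n)`. -/
def funAlg : Subalgebra ℝ V.Raw :=
  (⨆ n, V.smoothPart n).toSubalgebra
    (Submodule.mem_iSup_of_mem 0 ⟨fun _ => by
        simpa using GSym.algebraMap_mem_part V.deg _ (1 : ℝ),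
      fun _ => ⟨1, V.poly.one_mem, Eventually.of_forall fun _ => rfl⟩⟩)
    (by
      intro x y hx hy
      have h := Submodule.mul_mem_mul hx hy
      rw [Submodule.iSup_mul] at h
      refine (iSup_le fun m => ?_ : _ ≤ ⨆ n, V.smoothPart n) h
      rw [Submodule.mul_iSup]
      refine iSup_le fun n => le_trans ?_ (le_iSup V.smoothPart (m + n))
      rw [Submodule.mul_le]
      exact fun a ha b hb => V.mul_mem_smoothPart ha hb)

theorem smoothPart_le (n : ℕ) {z : V.Raw} (h : z ∈ V.smoothPart n) : z ∈ V.funAlg :=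
  Submodule.mem_iSup_of_mem n h

end GrBundle

/-! ### The category of N-manifolds -/

/-- A (nonnegatively) graded real algebra. -/
structure GrAlg : Type (u + 1) where
  C : Type u
  [ring : Ring C]
  [algebra : Algebra ℝ C]
  deg : ℕ → Submodule ℝ C

attribute [instance] GrAlg.ring GrAlg.algebra

/-- The graded algebra `Γ(S^{≥0} V^*)`. -/
def GrBundle.grAlg {M : Mfd.{u}} (V : GrBundle M) : GrAlg.{u} where
  C := V.funAlg
  deg n := (V.smoothPart n).comap V.funAlg.val.toLinearMap

/-- An N-manifold: a graded algebra `C` (its function algebra) which is isomorphic to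
`Γ(S^{≥0} V^*)` for some graded vector bundle `V` concentrated in strictly negative degrees. -/
structure NMfd : Type (u + 1) extends GrAlg.{u} where
  splits : ∃ (M : Mfd.{u}) (V : GrBundle M) (e : C ≃ₐ[ℝ] V.grAlg.C),
    ∀ n c, c ∈ deg n ↔ e c ∈ V.grAlg.deg n

/-- A morphism of N-manifolds `X → Y` is a morphism of graded algebras `C(Y) → C(X)`. -/
@[ext]
structure NMfd.Hom (X Y : NMfd.{u}) : Type u where
  pull : Y.C →ₐ[ℝ] X.C
  pull_mem : ∀ n c, c ∈ Y.deg n → pull c ∈ X.deg n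

instance : Category NMfd.{u} where
  Hom := NMfd.Hom
  id X := ⟨AlgHom.id ℝ X.C, fun _ _ h => h⟩
  comp f g := ⟨f.pull.comp g.pull, fun n c h => f.pull_mem n _ (g.pull_mem n c h)⟩

/-- The pullback of functions along a morphism of N-manifolds. -/
def NMfd.pullback {X Y : NMfd.{u}} (f : X ⟶ Y) : Y.C →ₐ[ℝ] X.C := NMfd.Hom.pull f

theorem NMfd.pullback_mem {X Y : NMfd.{u}} (f : X ⟶ Y) {n : ℕ} {c : Y.C} (h : c ∈ Y.deg n) :
    NMfd.pullback f c ∈ X.deg n :=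
  NMfd.Hom.pull_mem f n c h

namespace GrBundle

variable {M N : Mfd.{u}} (V : GrBundle M) (W : GrBundle N)

/-- The split N-manifold `𝔖(V)` given by a graded vector bundle. -/
def split : NMfd.{u} where
  toGrAlg := V.grAlg
  splits := ⟨M, V, AlgEquiv.refl, fun _ _ => Iff.rfl⟩

/-- A function on `𝔖(V)` as a section of `S^{≥0} V^*`. -/
def raw (c : V.split.C) : V.Raw := Subtype.val (p := (· ∈ V.funAlg)) c

/-- A smooth function on `M` as a function on `𝔖(V)`. -/
def fn (f : M.Fun) : V.split.C := (⟨V.fnRaw f, V.smoothPart_le _ (V.fnRaw_mem f)⟩ : V.funAlg)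

/-- A smooth section of `V_a^*` as a function on `𝔖(V)`. -/
def sec (a : V.ι) (s : V.DualSec a) : V.split.C :=
  (⟨V.secRaw a s.toFun, V.smoothPart_le _ (V.secRaw_mem a s)⟩ : V.funAlg)

variable {V W}

/-- The morphism `F : 𝔖(V) → 𝔖(W)` is induced by the bundle map `f` over `φ`. Here `f a b` is
the component from `V a` to `W b`; only the components with `deg a = deg b` matter. -/
def IsInducedBy (F : V.split ⟶ W.split) (φ : M.pt → N.pt)
    (f : ∀ a b y, V.V a y →ₗ[ℝ] W.V b (φ y)) : Prop :=
  (∀ g : N.Fun, V.raw (NMfd.pullback F (W.fn g)) = V.fnRaw (fun y => g (φ y))) ∧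
  ∀ (b : W.ι) (s : W.DualSec b), V.raw (NMfd.pullback F (W.sec b s)) =
    ∑ a ∈ (V.finite_deg (W.deg b)).toFinset, V.secRaw a (fun y => (s.toFun (φ y)).comp (f a b y))

/-- `f` over `φ` is a (smooth) morphism of graded vector bundles `V → W`. -/
def IsBundleMap (φ : M.pt → N.pt) (f : ∀ a b y, V.V a y →ₗ[ℝ] W.V b (φ y)) : Prop :=
  ContMDiff 𝓘(ℝ, M.E) 𝓘(ℝ, N.E) ∞ φ ∧
  ∀ a b, V.deg a = W.deg b →
    ContMDiff (𝓘(ℝ, M.E).prod 𝓘(ℝ, V.F a)) (𝓘(ℝ, N.E).prod 𝓘(ℝ, W.F b)) ∞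
      (fun v : TotalSpace (V.F a) (V.V a) =>
        (⟨φ v.proj, f a b v.proj v.snd⟩ : TotalSpace (W.F b) (W.V b)))

/-- The bundle map `f` over `φ` is an embedding: `φ` is an embedding of manifolds and `f` is
injective on each fibre. -/
def IsBundleEmbedding (φ : M.pt → N.pt) (f : ∀ a b y, V.V a y →ₗ[ℝ] W.V b (φ y)) : Prop :=
  Manifold.IsSmoothEmbedding 𝓘(ℝ, M.E) 𝓘(ℝ, N.E) ∞ φ ∧
  ∀ (y : M.pt) (v : ∀ a, V.V a y),
    (∀ b, ∑ a ∈ (V.finite_deg (W.deg b)).toFinset, f a b y (v a) = 0) → v = 0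

/-- `F : 𝔖(V) → 𝔖(W)` is a strict embedding: it comes from an embedding of graded vector
bundles `V → W`. -/
def IsStrictEmbedding (F : V.split ⟶ W.split) : Prop :=
  ∃ (φ : M.pt → N.pt) (f : ∀ a b y, V.V a y →ₗ[ℝ] W.V b (φ y)),
    IsBundleMap φ f ∧ IsBundleEmbedding φ f ∧ IsInducedBy F φ f

end GrBundle

/-! ### Maps from powers of the fat point -/

/-- A morphism `D^l × X → M`, where `C(D^l) = ℝ[ε_1, …, ε_l]` with anticommuting `ε_i` of
degree `-1`. It is a morphism of graded algebras `C^∞(M) → C(D^l) ⊗ C(X)`, written as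
`f ↦ ∑ I, ε_I c_I(f)`, where `I` ranges over the subsets of `{1, …, l}` and
`ε_I = ε_{i_1} ⋯ ε_{i_r}` for `I = {i_1 < ⋯ < i_r}`. Since `f` has degree `0`, the coefficient
`c_I(f)` has degree `|I|`. The sign in `mul` comes from
`ε_A c ε_B d = (-1)^{|A||B|} ε_A ε_B c d` for `c` of degree `|A|`, and from sorting `ε_A ε_B`. -/
@[ext]
structure DPoint (l : ℕ) (M : Mfd.{u}) (X : NMfd.{u}) where
  c : Finset ℕ → M.Fun →ₗ[ℝ] X.C
  supp : ∀ I, ¬ I ⊆ Finset.Icc 1 l → c I = 0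
  mem : ∀ I f, c I f ∈ X.deg I.card
  one : ∀ I, c I 1 = if I = ∅ then 1 else 0
  mul : ∀ I f g, c I (f * g) = ∑ A ∈ I.powerset,
    (-1 : ℝ) ^ ((A ×ˢ (I \ A)).filter fun p => p.1 < p.2).card • (c A f * c (I \ A) g)

/-- Restriction of a morphism `D^l × Y → M` along a morphism `X → Y`. -/
def DPoint.restrict {l : ℕ} {M : Mfd.{u}} {X Y : NMfd.{u}} (p : DPoint l M Y) (F : X ⟶ Y) :
    DPoint l M X where
  c I := (NMfd.pullback F).toLinearMap.comp (p.c I)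
  supp I h := by simp [p.supp I h]
  mem I f := NMfd.pullback_mem F (p.mem I f)
  one I := by
    have := p.one I
    split_ifs at this ⊢ <;> simp [this]
  mul I f g := by simp [p.mul I f g]

/-- `u` exhibits `Y` as representing the presheaf `Hom(D^l, M) : X ↦ hom(D^l × X, M)` on
N-manifolds. -/
def DPoint.Represents {l : ℕ} {M : Mfd.{u}} {Y : NMfd.{u}} (u : DPoint l M Y) : Prop :=
  ∀ (X : NMfd.{u}) (p : DPoint l M X), ∃! F : X ⟶ Y, u.restrict F = p

/-- The degeneracy `s_i` of the nerve of the pair groupoid of `D`, restricted to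
`⋆ × D^{l-1} → ⋆ × D^l`, pulls back `ε_j` to `ε_j` for `j ≤ i` and to `ε_{j-1}` for `i < j`,
where `ε_0 = 0`. -/
def degen (i j : ℕ) : ℕ := if j ≤ i then j else j - 1

/-- The morphism `σ : X → Y` corresponds to `(s_i)^* : Hom(D^l, M) → Hom(D^{l-1}, M)`, when `u`
and `w` exhibit `X` and `Y` as these mapping spaces: the pullback of `w` along `σ` is obtained
from `u` by pulling back along `s_i`. Note that `ε_J` pulls back to `ε_{s_i(J)}` if `s_i` is
injective on `J` and `0 ∉ s_i(J)`, and to `0` otherwise. -/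
def IsDegeneracy {l : ℕ} {M : Mfd.{u}} {X Y : NMfd.{u}} (i : ℕ) (u : DPoint l M X)
    (w : DPoint (l - 1) M Y) (σ : X ⟶ Y) : Prop :=
  ∀ I ⊆ Finset.Icc 1 (l - 1), ∀ f, NMfd.pullback σ (w.c I f) =
    ∑ J ∈ (Finset.Icc 1 l).powerset.filter
      (fun J => J.image (degen i) = I ∧ J.card = I.card), u.c J f

/-! ### Iterated tangent bundles -/

/-- The graded vector bundle `⨁ I, TM_I`, over nonempty `I ∈ S`, with `TM_I = TM` in degree
`-|I|`. -/
def copies (M : Mfd.{u}) (S : Finset (Finset ℕ)) : GrBundle M where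
  ι := {I : Finset ℕ // I ∈ S ∧ I.Nonempty}
  deg I := I.1.card
  deg_pos I := I.2.2.card_pos
  finite_deg n := by
    have : Finite {I : Finset ℕ // I ∈ S ∧ I.Nonempty} :=
      (S.finite_toSet.subset fun I (h : I ∈ S ∧ I.Nonempty) => h.1).to_subtype
    exact Set.toFinite _
  F _ := M.E
  V _ := M.T

/-- The map `⨁ I ∈ S, TM_I → ⨁ I ∈ S', TM_I` which is the identity on the common summands and
zero on the others. -/
def copiesMap (M : Mfd.{u}) (S S' : Finset (Finset ℕ)) (a : (copies M S).ι)
    (b : (copies M S').ι) (x : M.pt) : (copies M S).V a x →ₗ[ℝ] (copies M S').V b x :=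
  if a.1 = b.1 then (LinearMap.id : M.T x →ₗ[ℝ] M.T x) else 0

/-- The graded vector bundle `⨁ I, TM_I` over the nonempty subsets `I` of `{1, …, l}`. -/
abbrev tanBundle (M : Mfd.{u}) (l : ℕ) : GrBundle M := copies M (Finset.Icc 1 l).powerset

/-- The N-manifold `T[1]^l M`, in split form. -/
abbrev tan (M : Mfd.{u}) (l : ℕ) : NMfd.{u} := (tanBundle M l).split

/-- The proper subsets of `{1, …, k}`. -/
abbrev properSubsets (k : ℕ) : Finset (Finset ℕ) :=
  (Finset.Icc 1 k).powerset.erase (Finset.Icc 1 k)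

/-- The graded vector bundle `⨁ I, TM_I` over the nonempty proper subsets `I` of `{1, …, k}`,
that is, the quotient of `tanBundle M k` by its lowest degree part `T[k]M`. -/
abbrev quotBundle (M : Mfd.{u}) (k : ℕ) : GrBundle M := copies M (properSubsets k)

/-- The N-manifold `T[1]^k M / T[k]M`, in split form. -/
abbrev quot (M : Mfd.{u}) (k : ℕ) : NMfd.{u} := (quotBundle M k).split

/-- The external direct sum over `M^k` of `k` copies of `⨁ I ∈ S, TM_I`. -/
def powCopies (M : Mfd.{u}) (k : ℕ) (S : Finset (Finset ℕ)) : GrBundle (M.pow k) where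
  ι := Fin k × (copies M S).ι
  deg a := (copies M S).deg a.2
  deg_pos a := (copies M S).deg_pos a.2
  finite_deg n := (Set.finite_univ.prod ((copies M S).finite_deg n)).subset
    fun a ha => ⟨mem_univ _, ha⟩
  F _ := M.E
  V a := (M.powProj k a.1 : (M.pow k).pt → M.pt) *ᵖ M.T
  addCommGroup a y := inferInstanceAs (AddCommGroup (M.T (M.powProj k a.1 y)))
  module a y := inferInstanceAs (Module ℝ (M.T (M.powProj k a.1 y)))
  smooth a := ContMDiffVectorBundle.pullback M.E M.T 𝓘(ℝ, (M.pow k).E) (M.powProj k a.1)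

/-- The `i`-th projection of `powCopies`, over the `i`-th projection `M^k → M`. -/
def powCopiesMap (M : Mfd.{u}) (k : ℕ) (S : Finset (Finset ℕ)) (i : Fin k)
    (a : (powCopies M k S).ι) (b : (copies M S).ι) (y : (M.pow k).pt) :
    (powCopies M k S).V a y →ₗ[ℝ] (copies M S).V b (M.powProj k i y) :=
  let a' : Fin k × (copies M S).ι := a
  if h : a'.1 = i ∧ a'.2.1 = b.1 then
    (h.1 ▸ LinearMap.id : M.T (M.powProj k a'.1 y) →ₗ[ℝ] M.T (M.powProj k i y))
  else 0

/-- The product `(T[1]^l M)^k` of N-manifolds, given by the product of graded vector bundles. -/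
abbrev tanPow (M : Mfd.{u}) (k l : ℕ) : NMfd.{u} :=
  (powCopies M k (Finset.Icc 1 l).powerset).split

/-! ### The splitting determined by a connection -/

/-- A connection on `TM`. -/
abbrev Connection (M : Mfd.{u}) : Type u := CovariantDerivative 𝓘(ℝ, M.E) M.E M.T

/-- `B` is the covariant derivative `∇α` of the 1-form `α` for the connection on `T^*M` dual to the
given one: `B x v w = (∇_v α)(w)`, where `(∇_v α)(Y) = v(α(Y)) - α(∇_v Y)`. -/
def IsCovDeriv {M : Mfd.{u}} (cov : Connection M) (α : OneForm M)
    (B : ∀ x, M.T x →ₗ[ℝ] M.T x →ₗ[ℝ] ℝ) : Prop :=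
  ∀ Y : ∀ x, M.T x,
    ContMDiff 𝓘(ℝ, M.E) (𝓘(ℝ, M.E).prod 𝓘(ℝ, M.E)) ∞ (fun x => (⟨x, Y x⟩ : TotalSpace M.E M.T)) →
    ∀ (x : M.pt) (v : M.T x),
      B x v (Y x) = mvfderiv 𝓘(ℝ, M.E) (fun z => α.toFun z (Y z)) x v - α.toFun x (cov Y x v)

/-- The section of `S^2` which is `β_a γ_b` if `B = β ⊗ γ`, where `β_a` is the 1-form `β` in the
summand with index `a`. -/
def quadRaw {M : Mfd.{u}} {S : Finset (Finset ℕ)} (a b : (copies M S).ι)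
    (B : ∀ x, M.T x →ₗ[ℝ] M.T x →ₗ[ℝ] ℝ) : (copies M S).Raw := fun x =>
  let e : Module.Basis _ ℝ (M.T x) := Module.finBasis ℝ M.E
  ∑ p, ∑ q, B x (e p) (e q) •
    ((copies M S).gen a x (e.coord p) * (copies M S).gen b x (e.coord q))

/-- `I ⊆ {1, …, l}` as a subset of `{1, …, l + 1}`. -/
def oldIdx {M : Mfd.{u}} {l : ℕ} (I : (tanBundle M l).ι) : (tanBundle M (l + 1)).ι :=
  ⟨I.1, Finset.mem_powerset.2 ((Finset.mem_powerset.1 I.2.1).trans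
    (Finset.Icc_subset_Icc_right (Nat.le_succ l))), I.2.2⟩

/-- The subset `{l + 1}` of `{1, …, l + 1}`. -/
def newIdx (M : Mfd.{u}) (l : ℕ) : (tanBundle M (l + 1)).ι :=
  ⟨{l + 1}, by simp, by simp⟩

/-- The subset `I ∪ {l + 1}` of `{1, …, l + 1}`, for `I ⊆ {1, …, l}`. -/
def insIdx {M : Mfd.{u}} {l : ℕ} (I : (tanBundle M l).ι) : (tanBundle M (l + 1)).ι :=
  ⟨insert (l + 1) I.1, Finset.mem_powerset.2 (Finset.insert_subset (by simp)
    (Finset.mem_powerset.1 (oldIdx I).2.1)), Finset.insert_nonempty _ _⟩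

/-- The morphisms `u l : D^l × T[1]^l M → M` are those determined by the connection `cov` on `TM`,
through the identification of `T[1]^{l+1} M` with `T[1](T[1]^l M)`. For a split N-manifold `𝔖(V)`
and a connection on `V^*`, the universal morphism `D × T[1]𝔖(V) → 𝔖(V)` in the induced splitting
`V ⊕ T[1]M ⊕ V[1]` is `j + ε δ`, where `j` includes the functions on `V`, and `δ` is the derivation
of degree `1` over `j` which sends a function `f` to `df` on the summand `T[1]M`, and a section `s`
of `V^*` to the sum of `s` on the summand `V[1]` and the image of `∇s` under
`Γ(T^*M ⊗ V^*) → Γ(S^2((T[1]M)^* ⊕ V^*))`. Here `V = ⨁ I, TM_I` with the direct sum connection, and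
`V ⊕ T[1]M ⊕ V[1]` is the sum over the `I`, the set `{l+1}`, and the `I ∪ {l+1}`. -/
def IsSplitting {M : Mfd.{u}} (cov : Connection M) (u : ∀ l, DPoint l M (tan M l)) : Prop :=
  (∀ f, (u 0).c ∅ f = (tanBundle M 0).fn f) ∧
  ∀ l, ∃ (j : tan M (l + 1) ⟶ tan M l) (δ : (tan M l).C →ₗ[ℝ] (tan M (l + 1)).C),
    GrBundle.IsInducedBy j id (copiesMap M _ _) ∧
    (∀ n, ∀ a ∈ (tan M l).deg n, ∀ b,
      δ (a * b) = δ a * NMfd.pullback j b + (-1 : ℝ) ^ n • (NMfd.pullback j a * δ b)) ∧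
    (∀ f : M.Fun, (tanBundle M (l + 1)).raw (δ ((tanBundle M l).fn f)) =
      (tanBundle M (l + 1)).secRaw (newIdx M l) (fun x => (mvfderiv 𝓘(ℝ, M.E) f x).toLinearMap)) ∧
    (∀ (I : (tanBundle M l).ι) (α : OneForm M), ∃ B, IsCovDeriv cov α B ∧
      (tanBundle M (l + 1)).raw (δ ((tanBundle M l).sec I α)) =
        (tanBundle M (l + 1)).secRaw (insIdx I) α.toFun + quadRaw (newIdx M l) (oldIdx I) B) ∧
    ∀ I ⊆ Finset.Icc 1 l, ∀ f,
      (u (l + 1)).c I f = NMfd.pullback j ((u l).c I f) ∧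
      (u (l + 1)).c (insert (l + 1) I) f = δ ((u l).c I f)

/-! ### The family of squares -/

/-- The shape of the family of squares: `k` objects, and a pair of arrows for each
`0 ≤ i ≤ j ≤ k - 2`, starting at the objects `j + 1` and `i`. -/
abbrev squareShape (k : ℕ) : Limits.MulticospanShape where
  L := Fin k
  R := {p : ℕ × ℕ // p.1 ≤ p.2 ∧ p.2 + 2 ≤ k}
  fst p := ⟨p.1.2 + 1, by have := p.2; omega⟩
  snd p := ⟨p.1.1, by have := p.2; omega⟩

/-- The family of cospans formed by `τ i : X → Y` (starting at the copy of `X` with index `j + 1`)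
and `τ j : X → Y` (starting at the copy with index `i`), for `0 ≤ i ≤ j ≤ k - 2`. -/
abbrev squares (k : ℕ) {X Y : NMfd.{u}} (τ : ℕ → (X ⟶ Y)) :
    Limits.MulticospanIndex (squareShape k) NMfd.{u} where
  left _ := X
  right _ := Y
  fst p := τ p.1.1
  snd p := τ p.1.2

end

end NGraded

open NGraded

/-! A morphism `X ⟶ tan M l` amounts to a homomorphism on the functions of `M` and, for each
nonempty `I ⊆ {1, …, l}`, a map from 1-forms to `X.C` of degree `|I|` which is linear over functions
(`exists_hom`, `hom_ext`). In these terms the theorem becomes linear algebra over the index sets.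

The universal points are built recursively: a coefficient `c_I` on `T[1]^l M` yields its pullback to
`T[1]^{l+1} M` and its image under the odd derivation `delta` determined by `∇`. They are universal
because the coefficients are triangular: `c_I(f)` is `df` in the summand `I` plus terms in
generators of degree less than `|I|` (`trunc_splitPoint_sub`). A morphism with given coefficients is
therefore found, and is unique, degree by degree. At each degree the required value on `df` is a
derivation in `f`, and derivations factor through 1-forms (`exists_oneForm_of_derivation`), by
Hadamard's lemma.

The derivation `delta` is compatible with the degeneracies (`degHom_delta_of_le`,
`degHom_delta_last`), so `σ_i` is strict in the splittings: a 1-form in the summand `I` pulls back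
to the sum of its copies in those `J` which the degeneracy maps bijectively onto `I`
(`degHom_splitPoint`). The full set `{1, …, k}` is too large to occur, so the `σ_i` descend to the
quotient.

What remains is combinatorial: a function `y` on subsets of `{1, …, k}` with values in an abelian
group is compared with its sums over the fibres of the degeneracies. Each fibre has at most two
elements (`sum_degFib`). The sums determine `y` off the full set (`eq_zero_of_sum_degFib`), and each
compatible family of sums comes from some `y` (`exists_sum_degFib_eq`), as for the matching objects
of a cosimplicial abelian group. The first fact gives uniqueness of morphisms into the limit and
also fibrewise injectivity of the map to the product; the second gives existence. On the base, the
map to the product is the diagonal. -/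

namespace NGraded

noncomputable section

/-! ### Homomorphisms and odd derivations of graded symmetric algebras -/

namespace GSym

variable {ι : Type} {deg : ι → ℕ} {U : ι → Type u} [∀ a, AddCommGroup (U a)] [∀ a, Module ℝ (U a)]
  {A : Type*} [Semiring A] [Algebra ℝ A]

theorem gen_mul_gen (a b : ι) (v : U a) (w : U b) :
    gen deg U a v * gen deg U b w =
      (-1 : ℝ) ^ (deg a * deg b) • (gen deg U b w * gen deg U a v) := by
  have h := RingQuot.mkAlgHom_rel ℝ (Rel.swap (deg := deg) (U := U) a b v w)
  simpa [gen] using h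

/-- The algebra homomorphism out of a graded symmetric algebra determined by its values on the
generators. -/
def lift (h : ∀ a, U a →ₗ[ℝ] A)
    (hc : ∀ a b v w, h a v * h b w = (-1 : ℝ) ^ (deg a * deg b) • (h b w * h a v)) :
    GSym deg U →ₐ[ℝ] A := by
  classical
  exact RingQuot.liftAlgHom ℝ ⟨TensorAlgebra.lift ℝ (DirectSum.toModule ℝ ι A h), by
    rintro _ _ ⟨a, b, v, w⟩
    simp only [tens, LinearMap.comp_apply, map_mul, map_smul, TensorAlgebra.lift_ι_apply]
    convert hc a b v w <;> exact DirectSum.toModule_lof ℝ (φ := h) _ _⟩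

@[simp]
theorem lift_gen (h : ∀ a, U a →ₗ[ℝ] A)
    (hc : ∀ a b v w, h a v * h b w = (-1 : ℝ) ^ (deg a * deg b) • (h b w * h a v)) (a : ι)
    (v : U a) : lift h hc (gen deg U a v) = h a v := by
  classical
  simp only [lift, gen, tens, LinearMap.comp_apply, AlgHom.toLinearMap_apply,
    RingQuot.liftAlgHom_mkAlgHom_apply, TensorAlgebra.lift_ι_apply]
  convert DirectSum.toModule_lof ℝ (φ := h) a v

theorem algHom_ext {f g : GSym deg U →ₐ[ℝ] A}
    (h : ∀ a v, f (gen deg U a v) = g (gen deg U a v)) : f = g := by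
  refine RingQuot.ringQuot_ext' _ _ _ ?_
  refine TensorAlgebra.hom_ext ?_
  classical
  refine DirectSum.linearMap_ext ℝ fun a => LinearMap.ext fun v => ?_
  have := h a v
  simp only [gen, tens, LinearMap.comp_apply, AlgHom.toLinearMap_apply] at this
  simp only [LinearMap.comp_apply, AlgHom.toLinearMap_apply, AlgHom.comp_apply]
  convert this

/-- The universal property gives a homomorphism into the subalgebra generated by the generators.
Followed by the inclusion it fixes the generators, so it is the identity. -/
theorem adjoin_gen : Algebra.adjoin ℝ {z | ∃ a v, z = gen deg U a v} = ⊤ := by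
  set S := Algebra.adjoin ℝ {z | ∃ a v, z = gen deg U a v}
  have hS : ∀ a v, gen deg U a v ∈ S := fun a v => Algebra.subset_adjoin ⟨a, v, rfl⟩
  let f : GSym deg U →ₐ[ℝ] S := lift (fun a => (gen deg U a).codRestrict S.toSubmodule (hS a))
    fun a b v w => Subtype.ext (gen_mul_gen a b v w)
  have hf : S.val.comp f = AlgHom.id ℝ _ := algHom_ext fun a v => by simp [f]; rfl
  rw [eq_top_iff]
  intro z _
  have := (f z).2
  rwa [show (f z : GSym deg U) = z from DFunLike.congr_fun hf z] at this

@[elab_as_elim]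
theorem gen_induction {P : GSym deg U → Prop} (gen : ∀ a v, P (gen deg U a v))
    (algebraMap : ∀ r : ℝ, P (algebraMap ℝ _ r)) (add : ∀ x y, P x → P y → P (x + y))
    (mul : ∀ x y, P x → P y → P (x * y)) (z : GSym deg U) : P z := by
  have hz : z ∈ Algebra.adjoin ℝ {z | ∃ a v, z = GSym.gen deg U a v} := by
    rw [adjoin_gen]; trivial
  induction hz using Algebra.adjoin_induction with
  | mem x hx => obtain ⟨a, v, rfl⟩ := hx; exact gen a v
  | algebraMap r => exact algebraMap r
  | add x y _ _ hx hy => exact add x y hx hy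
  | mul x y _ _ hx hy => exact mul x y hx hy

theorem part_induction {n : ℕ} {P : GSym deg U → Prop}
    (hL : ∀ L : List (Σ a, U a), (L.map fun p => deg p.1).sum = n →
      P (L.map fun p => gen deg U p.1 p.2).prod)
    (h0 : P 0) (ha : ∀ x y, P x → P y → P (x + y)) (hs : ∀ (r : ℝ) x, P x → P (r • x))
    {z : GSym deg U} (hz : z ∈ part deg U n) : P z := by
  induction hz using Submodule.span_induction with
  | mem x hx => obtain ⟨L, hL', rfl⟩ := hx; exact hL L hL'
  | zero => exact h0
  | add x y _ _ hx hy => exact ha x y hx hy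
  | smul r x _ hx => exact hs r x hx

theorem one_mem_part : (1 : GSym deg U) ∈ part deg U 0 := by
  simpa using algebraMap_mem_part deg U 1

theorem map_mem_part {ι' : Type} {deg' : ι' → ℕ} {U' : ι' → Type*} [∀ a, AddCommGroup (U' a)]
    [∀ a, Module ℝ (U' a)] {f : GSym deg U →ₐ[ℝ] GSym deg' U'}
    (hf : ∀ a v, f (gen deg U a v) ∈ part deg' U' (deg a)) {n : ℕ} {z : GSym deg U}
    (hz : z ∈ part deg U n) : f z ∈ part deg' U' n := by
  refine part_induction (P := fun z => f z ∈ part deg' U' n) ?_ (by simp)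
    (fun x y hx hy => by simpa using Submodule.add_mem _ hx hy)
    (fun r x hx => by simpa using Submodule.smul_mem _ r hx) hz
  intro L hL
  subst hL
  clear hz
  induction L with
  | nil => simpa using one_mem_part
  | cons p L ih => simpa using mul_mem_part _ _ (hf p.1 p.2) ih

theorem gen_mul_comm (a : ι) (v : U a) {n : ℕ} {z : GSym deg U} (hz : z ∈ part deg U n) :
    gen deg U a v * z = (-1 : ℝ) ^ (deg a * n) • (z * gen deg U a v) := by
  refine part_induction
    (P := fun z => gen deg U a v * z = (-1 : ℝ) ^ (deg a * n) • (z * gen deg U a v)) ?_ (by simp)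
    (fun x y hx hy => by rw [mul_add, hx, hy, add_mul, smul_add])
    (fun r x hx => by rw [mul_smul_comm, hx, smul_mul_assoc, smul_comm]) hz
  intro L hL
  subst hL
  clear hz
  induction L with
  | nil => simp
  | cons p L ih =>
    simp only [List.map_cons, List.prod_cons, List.sum_cons]
    rw [← mul_assoc, gen_mul_gen, smul_mul_assoc, mul_assoc, ih, mul_smul_comm, smul_smul,
      ← pow_add, ← mul_add, mul_assoc]

theorem part_mul_comm {m n : ℕ} {z w : GSym deg U} (hz : z ∈ part deg U m)
    (hw : w ∈ part deg U n) : z * w = (-1 : ℝ) ^ (m * n) • (w * z) := by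
  refine part_induction (P := fun z => z * w = (-1 : ℝ) ^ (m * n) • (w * z)) ?_ (by simp)
    (fun x y hx hy => by rw [add_mul, hx, hy, mul_add, smul_add])
    (fun r x hx => by rw [smul_mul_assoc, hx, mul_smul_comm, smul_comm]) hz
  intro L hL
  subst hL
  clear hz
  induction L with
  | nil => simp
  | cons p L ih =>
    simp only [List.map_cons, List.prod_cons, List.sum_cons]
    rw [mul_assoc, ih, mul_smul_comm, ← mul_assoc, gen_mul_comm _ _ hw, smul_mul_assoc, smul_smul,
      mul_assoc, ← pow_add, ← add_mul, add_comm]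

/-- The projection of a graded symmetric algebra onto its degree `0` part. -/
def aug : GSym deg U →ₐ[ℝ] ℝ := lift (fun _ => 0) (by simp)

theorem aug_gen (a : ι) (v : U a) : aug (gen deg U a v) = 0 := by simp [aug]

/-- Since all generators have positive degree, the empty word is the only word of degree `0`. -/
theorem eq_algebraMap_aug (hd : ∀ a, 0 < deg a) {z : GSym deg U} (hz : z ∈ part deg U 0) :
    z = algebraMap ℝ _ (aug z) := by
  refine part_induction (P := fun z => z = algebraMap ℝ _ (aug z)) ?_ (by simp)
    (fun x y hx hy => by rw [map_add, map_add, ← hx, ← hy])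
    (fun r x hx => by
      rw [map_smul, smul_eq_mul, map_mul, ← hx, Algebra.smul_def]) hz
  intro L hL
  cases L with
  | nil => simp
  | cons p L => simp at hL; have := hd p.1; omega

/-! ### Odd derivations as corner entries of triangular matrices -/

section OddDerivation

variable {ι' : Type} {deg' : ι' → ℕ} {U' : ι' → Type u} [∀ a, AddCommGroup (U' a)]
  [∀ a, Module ℝ (U' a)] (j : GSym deg U →ₐ[ℝ] GSym deg' U')
  (hj : ∀ a v, j (gen deg U a v) ∈ part deg' U' (deg a))
  (D : ∀ a, U a →ₗ[ℝ] GSym deg' U') (hD : ∀ a v, D a v ∈ part deg' U' (deg a + 1))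

/-- The matrix whose entry at `(0, 1)` is the value of an odd derivation on a generator. -/
def oddDerMatrix (a : ι) : U a →ₗ[ℝ] Matrix (Fin 2) (Fin 2) (GSym deg' U') where
  toFun v := !![(-1 : ℝ) ^ deg a • j (gen deg U a v), D a v; 0, j (gen deg U a v)]
  map_add' v w := by
    ext p q
    fin_cases p <;> fin_cases q <;> simp
  map_smul' r v := by
    ext p q
    fin_cases p <;> fin_cases q <;> simp [smul_comm r]

-- An odd derivation `D` over `j` is the same as a homomorphism `z ↦ [[(-1)^|z| j z, D z], [0, j
-- z]]`: the corner of a product of such matrices is `D z * j w + (-1)^|z| j z * D w`. So the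
-- universal property constructs `D`, once the matrices of generators commute in the graded sense.
include hj hD in
theorem oddDerMatrix_comm (a b : ι) (v : U a) (w : U b) :
    oddDerMatrix j D a v * oddDerMatrix j D b w =
      (-1 : ℝ) ^ (deg a * deg b) • (oddDerMatrix j D b w * oddDerMatrix j D a v) := by
  have h1 : j (gen deg U a v) * j (gen deg U b w) =
      (-1 : ℝ) ^ (deg a * deg b) • (j (gen deg U b w) * j (gen deg U a v)) := by
    rw [← map_mul, gen_mul_gen, map_smul, map_mul]
  have h2 := part_mul_comm (hj a v) (hD b w)
  have h3 := part_mul_comm (hD a v) (hj b w)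
  have sq : ∀ n : ℕ, (-1 : ℝ) ^ (n * 2) = 1 := fun n => by rw [mul_comm, pow_mul]; simp
  ext p q
  fin_cases p <;> fin_cases q
  · simp only [oddDerMatrix, LinearMap.coe_mk, AddHom.coe_mk, Matrix.mul_apply, Fin.sum_univ_two,
      Matrix.smul_apply]
    simp [h1, smul_smul]
    ring_nf
  -- The corner entry: exchanging `j v` and `D w` costs `(-1)^(deg a * (deg b + 1))`, and the
  -- surplus `deg a` cancels against the sign of the diagonal entry.
  · simp only [oddDerMatrix, LinearMap.coe_mk, AddHom.coe_mk, Matrix.mul_apply, Fin.sum_univ_two,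
      Matrix.smul_apply]
    simp only [Fin.zero_eta, Fin.mk_one, Matrix.cons_val', Matrix.cons_val_zero, Matrix.cons_val_one,
      Matrix.of_apply, Matrix.cons_val_fin_one, smul_mul_assoc, h2, h3, smul_add, smul_smul]
    rw [add_comm]
    congr 1
    · rw [add_mul, one_mul, pow_add]
    · rw [← pow_add]
      congr 1
      have : deg a + deg a * (deg b + 1) = deg a * deg b + deg a * 2 := by ring
      rw [this, pow_add, sq, mul_one]
  · simp [oddDerMatrix, Matrix.mul_apply, Fin.sum_univ_two]
  · simp [oddDerMatrix, Matrix.mul_apply, Fin.sum_univ_two, h1]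

/-- The algebra homomorphism whose entry at `(0, 1)` is an odd derivation. -/
def oddDerHom : GSym deg U →ₐ[ℝ] Matrix (Fin 2) (Fin 2) (GSym deg' U') :=
  lift (oddDerMatrix j D) (oddDerMatrix_comm j hj D hD)

/-- The zero below the diagonal makes the entry `(1, 1)` multiplicative, hence equal to `j`. The
entry `(0, 0)` has a sign depending on the degree and is computed only on homogeneous elements. -/
theorem oddDerHom_apply_one (z : GSym deg U) :
    oddDerHom j hj D hD z 1 0 = 0 ∧ oddDerHom j hj D hD z 1 1 = j z := by
  induction z using gen_induction with
  | gen a v => simp [oddDerHom, oddDerMatrix]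
  | algebraMap r => simp [Matrix.algebraMap_matrix_apply]
  | add x y hx hy => simp [hx, hy]
  | mul x y hx hy => simp [hx, hy, Matrix.mul_apply, Fin.sum_univ_two]

theorem oddDerHom_apply_zero_zero {n : ℕ} {z : GSym deg U} (hz : z ∈ part deg U n) :
    oddDerHom j hj D hD z 0 0 = (-1 : ℝ) ^ n • j z := by
  refine part_induction (P := fun z => oddDerHom j hj D hD z 0 0 = (-1 : ℝ) ^ n • j z) ?_ (by simp)
    (fun x y hx hy => by simp [hx, hy])
    (fun r x hx => by simp [hx, smul_comm r]) hz
  intro L hL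
  subst hL
  clear hz
  induction L with
  | nil => simp
  | cons p L ih =>
    simp only [List.map_cons, List.prod_cons, List.sum_cons, map_mul, Matrix.mul_apply,
      Fin.sum_univ_two, (oddDerHom_apply_one j hj D hD _).1, ih, mul_zero, add_zero]
    simp [oddDerHom, oddDerMatrix, smul_smul, pow_add, mul_comm]

/-- The odd derivation over `j` with given values on the generators. -/
def oddDer : GSym deg U →ₗ[ℝ] GSym deg' U' where
  toFun z := oddDerHom j hj D hD z 0 1
  map_add' := by simp
  map_smul' := by simp

theorem oddDer_gen (a : ι) (v : U a) : oddDer j hj D hD (gen deg U a v) = D a v := by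
  simp [oddDer, oddDerHom, oddDerMatrix]

theorem oddDer_algebraMap (r : ℝ) : oddDer j hj D hD (algebraMap ℝ _ r) = 0 := by
  simp [oddDer, Matrix.algebraMap_matrix_apply]

theorem oddDer_mul {n : ℕ} {z : GSym deg U} (hz : z ∈ part deg U n) (w : GSym deg U) :
    oddDer j hj D hD (z * w) =
      oddDer j hj D hD z * j w + (-1 : ℝ) ^ n • (j z * oddDer j hj D hD w) := by
  simp only [oddDer, LinearMap.coe_mk, AddHom.coe_mk, map_mul, Matrix.mul_apply, Fin.sum_univ_two,
    oddDerHom_apply_zero_zero j hj D hD hz, (oddDerHom_apply_one j hj D hD _).2]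
  rw [add_comm, smul_mul_assoc]

theorem oddDer_mem_part {n : ℕ} {z : GSym deg U} (hz : z ∈ part deg U n) :
    oddDer j hj D hD z ∈ part deg' U' (n + 1) := by
  refine part_induction (P := fun z => oddDer j hj D hD z ∈ part deg' U' (n + 1)) ?_ (by simp)
    (fun x y hx hy => by simpa using Submodule.add_mem _ hx hy)
    (fun r x hx => by simpa using Submodule.smul_mem _ r hx) hz
  intro L hL
  subst hL
  clear hz
  induction L with
  | nil =>
    have := oddDer_algebraMap j hj D hD 1
    rw [map_one] at this
    simp [this]
  | cons p L ih =>
    simp only [List.map_cons, List.prod_cons, List.sum_cons]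
    rw [oddDer_mul j hj D hD (gen_mem_part deg U _ _), oddDer_gen]
    refine Submodule.add_mem _ ?_ (Submodule.smul_mem _ _ ?_)
    · have h2 := map_mem_part hj (Submodule.subset_span ⟨L, rfl, rfl⟩ :
        _ ∈ part deg U (L.map fun p => deg p.1).sum)
      have := mul_mem_part _ _ (hD p.1 p.2) h2
      rwa [add_right_comm] at this
    · have := mul_mem_part _ _ (hj p.1 p.2) ih
      rwa [← add_assoc] at this

end OddDerivation

end GSym

/-! ### Smooth functions on manifolds -/

namespace Mfd

variable (M : Mfd.{u})

instance : LocallyCompactSpace M.pt := Manifold.locallyCompact_of_finiteDimensional 𝓘(ℝ, M.E)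

instance : SigmaCompactSpace M.pt := sigmaCompactSpace_of_locallyCompact_secondCountable

variable {M}

/-- The differential of a function at a point. -/
def dif (f : M.pt → ℝ) (x : M.pt) : M.T x →ₗ[ℝ] ℝ := (mvfderiv 𝓘(ℝ, M.E) f x).toLinearMap

theorem Fun.mdiff (f : M.Fun) (x : M.pt) : MDifferentiableAt 𝓘(ℝ, M.E) 𝓘(ℝ, ℝ) f x :=
  f.contMDiff.mdifferentiableAt (by simp)

theorem dif_congr {f g : M.pt → ℝ} {x : M.pt} (h : f =ᶠ[𝓝 x] g) : dif f x = dif g x := by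
  ext v
  simp only [dif, mvfderiv]
  have := h.mfderiv_eq (I := 𝓘(ℝ, M.E)) (I' := 𝓘(ℝ, ℝ))
  change mfderiv 𝓘(ℝ, M.E) 𝓘(ℝ, ℝ) f x v = mfderiv 𝓘(ℝ, M.E) 𝓘(ℝ, ℝ) g x v
  rw [this]
  rfl

theorem dif_add {f g : M.pt → ℝ} {x : M.pt} (hf : MDifferentiableAt 𝓘(ℝ, M.E) 𝓘(ℝ, ℝ) f x)
    (hg : MDifferentiableAt 𝓘(ℝ, M.E) 𝓘(ℝ, ℝ) g x) :
    dif (fun y => f y + g y) x = dif f x + dif g x := by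
  ext v
  simp [dif, mvfderiv_fun_add hf hg]

theorem dif_mul {f g : M.pt → ℝ} {x : M.pt} (hf : MDifferentiableAt 𝓘(ℝ, M.E) 𝓘(ℝ, ℝ) f x)
    (hg : MDifferentiableAt 𝓘(ℝ, M.E) 𝓘(ℝ, ℝ) g x) :
    dif (fun y => f y * g y) x = f x • dif g x + g x • dif f x := by
  ext v
  simp [dif, mvfderiv_fun_mul hf hg]

theorem dif_const (c : ℝ) (x : M.pt) : dif (fun _ : M.pt => c) x = 0 := by
  ext v
  simp [dif, mvfderiv_const]

theorem dif_sum {ι : Type*} (s : Finset ι) {f : ι → M.pt → ℝ} {x : M.pt}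
    (hf : ∀ i ∈ s, MDifferentiableAt 𝓘(ℝ, M.E) 𝓘(ℝ, ℝ) (f i) x) :
    MDifferentiableAt 𝓘(ℝ, M.E) 𝓘(ℝ, ℝ) (fun y => ∑ i ∈ s, f i y) x ∧
    dif (fun y => ∑ i ∈ s, f i y) x = ∑ i ∈ s, dif (f i) x := by
  classical
  induction s using Finset.induction_on with
  | empty => simpa using ⟨mdifferentiableAt_const, dif_const 0 x⟩
  | insert a s ha ih =>
    obtain ⟨h1, h2⟩ := ih fun i hi => hf i (Finset.mem_insert_of_mem hi)
    have h3 := hf a (Finset.mem_insert_self a s)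
    simp only [Finset.sum_insert ha]
    exact ⟨h3.add h1, by rw [dif_add h3 h1, h2]⟩

/-- A bump function at `x` supported in `U`. -/
theorem exists_bump {x : M.pt} {U : Set M.pt} (hU : U ∈ 𝓝 x) :
    ∃ ρ : M.Fun, (∀ᶠ y in 𝓝 x, ρ y = 1) ∧ tsupport ρ ⊆ U := by
  obtain ⟨f, hf, -⟩ := (SmoothBumpFunction.nhds_basis_support (I := 𝓘(ℝ, M.E)) hU).mem_iff.1 hU
  exact ⟨⟨f, f.contMDiff⟩, f.eventuallyEq_one, hf⟩

/-- Cut off by a bump function. Elements of the function algebras are global, so local constructions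
have to be replaced by global ones with the same germ. -/
theorem exists_fun_eq {x : M.pt} {U : Set M.pt} (hU : U ∈ 𝓝 x) {f : M.pt → ℝ}
    (hf : ContMDiffOn 𝓘(ℝ, M.E) 𝓘(ℝ, ℝ) ∞ f U) : ∃ g : M.Fun, ∀ᶠ y in 𝓝 x, g y = f y := by
  obtain ⟨ρ, h1, h2⟩ := exists_bump (interior_mem_nhds.2 hU)
  refine ⟨⟨fun y => ρ y • f y, contMDiff_of_tsupport fun y hy => ?_⟩, ?_⟩
  · have hy' : y ∈ interior U := h2 (closure_mono (Function.support_smul_subset_left _ _) hy)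
    exact (ρ.contMDiff y).smul ((hf y (interior_subset hy')).contMDiffAt
      (mem_interior_iff_mem_nhds.1 hy'))
  · filter_upwards [h1] with y hy
    change ρ y • f y = f y
    rw [hy, one_smul]

/-- Smooth functions and smooth vector fields which near `x₀` are coordinate functions and the
corresponding coordinate vector fields. -/
structure Frame (M : Mfd.{u}) (x₀ : M.pt) where
  g : Fin (Module.finrank ℝ M.E) → M.Fun
  Y : Fin (Module.finrank ℝ M.E) → ∀ x, M.T x
  smooth_Y : ∀ q, ContMDiff 𝓘(ℝ, M.E) (𝓘(ℝ, M.E).prod 𝓘(ℝ, M.E)) ∞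
    (fun x => (⟨x, Y q x⟩ : TotalSpace M.E M.T))
  dual : ∀ᶠ y in 𝓝 x₀, (∀ p q, dif (g p) y (Y q y) = if p = q then 1 else 0) ∧
    ∀ v : M.T y, v = ∑ q, dif (g q) y v • Y q y
  coord : ∀ p, ∀ᶠ y in 𝓝 x₀,
    g p y = (Module.finBasis ℝ M.E).coord p (extChartAt 𝓘(ℝ, M.E) x₀ y)

theorem exists_section_eq {x : M.pt} {U : Set M.pt} (hU : U ∈ 𝓝 x) {Y : ∀ x, M.T x}
    (hY : ContMDiffOn 𝓘(ℝ, M.E) (𝓘(ℝ, M.E).prod 𝓘(ℝ, M.E)) ∞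
      (fun x => (⟨x, Y x⟩ : TotalSpace M.E M.T)) U) :
    ∃ Z : ∀ x, M.T x, ContMDiff 𝓘(ℝ, M.E) (𝓘(ℝ, M.E).prod 𝓘(ℝ, M.E)) ∞
      (fun x => (⟨x, Z x⟩ : TotalSpace M.E M.T)) ∧ ∀ᶠ y in 𝓝 x, Z y = Y y := by
  obtain ⟨ρ, h1, h2⟩ := exists_bump (interior_mem_nhds.2 hU)
  refine ⟨fun y => ρ y • Y y, fun y => ?_, ?_⟩
  · by_cases hy : y ∈ tsupport ρ
    · have hy' : y ∈ interior U := h2 hy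
      exact (ρ.contMDiff y).smul_section ((hY y (interior_subset hy')).contMDiffAt
        (mem_interior_iff_mem_nhds.1 hy'))
    · have h0 : ∀ᶠ z in 𝓝 y, ρ z = 0 := by
        filter_upwards [(isClosed_tsupport ρ).isOpen_compl.mem_nhds hy] with z hz
        exact image_eq_zero_of_notMem_tsupport hz
      refine ContMDiffAt.congr_of_eventuallyEq
        (contMDiff_zeroSection ℝ M.T y : ContMDiffAt 𝓘(ℝ, M.E) (𝓘(ℝ, M.E).prod 𝓘(ℝ, M.E)) ∞ _ y) ?_
      filter_upwards [h0] with z hz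
      simp [hz, zeroSection]
  · filter_upwards [h1] with y hy
    rw [hy, one_smul]

/-- Take the coordinates of the chart at `x₀` and the local frame of the tangent trivialization
there, both cut off. They are dual because the trivialization is the differential of the chart. -/
theorem nonempty_frame (x₀ : M.pt) : Nonempty (Frame M x₀) := by
  let b := Module.finBasis ℝ M.E
  let e := trivializationAt M.E M.T x₀
  have hsrc : (chartAt M.E x₀).source ∈ 𝓝 x₀ := chart_source_mem_nhds _ _
  have hbase : e.baseSet = (chartAt M.E x₀).source := rfl
  have hc : ∀ p, ContMDiffOn 𝓘(ℝ, M.E) 𝓘(ℝ, ℝ) ∞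
      (fun y => b.coord p (extChartAt 𝓘(ℝ, M.E) x₀ y)) (chartAt M.E x₀).source := by
    intro p
    have h1 : ContMDiffOn 𝓘(ℝ, M.E) 𝓘(ℝ, M.E) ∞ (extChartAt 𝓘(ℝ, M.E) x₀)
      (chartAt M.E x₀).source := contMDiffOn_extChartAt
    have h2 : ContDiff ℝ ∞ (b.coord p : M.E → ℝ) :=
      (LinearMap.toContinuousLinearMap (b.coord p)).contDiff
    exact h2.contMDiff.comp_contMDiffOn h1
  choose g hg using fun p => exists_fun_eq hsrc (hc p)
  choose Y hY hY' using fun q => exists_section_eq (U := e.baseSet) (x := x₀) (by rwa [hbase])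
    (e.contMDiffOn_localFrame_baseSet (I := 𝓘(ℝ, M.E)) ∞ b q)
  refine ⟨⟨g, Y, hY, ?_, hg⟩⟩
  have hg' : ∀ᶠ y in 𝓝 x₀, ∀ p, ∀ v : M.T y, dif (g p) y v = b.coord p (e.continuousLinearMapAt ℝ y v) := by
    -- The differential at `y` depends on the germ at `y`, so equality is needed near each nearby
    -- point.
    have h1 : ∀ᶠ y in 𝓝 x₀, ∀ p, ∀ᶠ z in 𝓝 y,
        g p z = b.coord p (extChartAt 𝓘(ℝ, M.E) x₀ z) :=
      eventually_all.2 fun p => (hg p).eventually_nhds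
    filter_upwards [h1, hsrc] with y hy hys p v
    rw [dif_congr (hy p)]
    have hb : HasFDerivAt (b.coord p : M.E → ℝ) (LinearMap.toContinuousLinearMap (b.coord p))
      (extChartAt 𝓘(ℝ, M.E) x₀ y) := (LinearMap.toContinuousLinearMap (b.coord p)).hasFDerivAt
    have h3 := mvfderiv_comp_apply (I := 𝓘(ℝ, M.E)) (I' := 𝓘(ℝ, M.E))
      (g := (b.coord p : M.E → ℝ)) (f := extChartAt 𝓘(ℝ, M.E) x₀) y
      hb.differentiableAt.mdifferentiableAt (mdifferentiableAt_extChartAt hys) v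
    rw [TangentBundle.continuousLinearMapAt_trivializationAt hys]
    refine h3.trans ?_
    change mfderiv 𝓘(ℝ, M.E) 𝓘(ℝ, ℝ) (b.coord p) (extChartAt 𝓘(ℝ, M.E) x₀ y) _ = _
    rw [mfderiv_eq_fderiv, hb.fderiv]
    rfl
  filter_upwards [hg', hsrc, eventually_all.2 hY'] with y h1 h2 h3
  have h4 : ∀ q, Y q y = e.basisAt b h2 q := fun q => by
    rw [h3 q, e.localFrame_apply_of_mem_baseSet b h2]
  have h5 : ∀ p (v : M.T y), dif (g p) y v = (e.basisAt b h2).coord p v := fun p v => by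
    rw [h1, e.continuousLinearMapAt_apply (R := ℝ), e.coe_linearMapAt_of_mem (R := ℝ) h2]
    simp [Trivialization.basisAt]
    rfl
  refine ⟨fun p q => ?_, fun v => ?_⟩
  · rw [h5, h4, Module.Basis.coord_apply, Module.Basis.repr_self, Finsupp.single_apply]
    simp only [eq_comm]
  · simp only [h5, h4]
    exact ((e.basisAt b h2).sum_repr v).symm

/-- A choice of coordinates near a point. -/
def frame (x₀ : M.pt) : Frame M x₀ := (nonempty_frame x₀).some

namespace Frame

variable {x₀ : M.pt} (e : Frame M x₀)

theorem linearMap_eq {y : M.pt} (hy : ∀ v : M.T y, v = ∑ q, dif (e.g q) y v • e.Y q y)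
    {G : Type*} [AddCommGroup G] [Module ℝ G] (α : M.T y →ₗ[ℝ] G) (v : M.T y) :
    α v = ∑ q, dif (e.g q) y v • α (e.Y q y) := by
  conv_lhs => rw [hy v]
  simp

theorem dual_self : (∀ p q, dif (e.g p) x₀ (e.Y q x₀) = if p = q then 1 else 0) ∧
    ∀ v : M.T x₀, v = ∑ q, dif (e.g q) x₀ v • e.Y q x₀ := e.dual.self_of_nhds

theorem covector_eq {y : M.pt} (hy : ∀ v : M.T y, v = ∑ q, dif (e.g q) y v • e.Y q y)
    (α : M.T y →ₗ[ℝ] ℝ) : α = ∑ q, α (e.Y q y) • dif (e.g q) y := by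
  ext v
  rw [e.linearMap_eq hy α v]
  simp [mul_comm]

end Frame

/-! ### The points of a manifold in terms of its functions -/

/-- The index `K.find` of a compact exhaustion is locally bounded, near `x` by `K.find x + 1`, so
some smooth `f` dominates it. The sublevel set at `c` then lies in `K ⌈c⌉₊`. -/
theorem exists_proper : ∃ f : M.Fun, ∀ c : ℝ, IsCompact {x | f x ≤ c} := by
  let K := CompactExhaustion.choice M.pt
  obtain ⟨f, hf⟩ := exists_contMDiffMap_forall_mem_convex_of_local_const 𝓘(ℝ, M.E) (n := ⊤)
    (t := fun x => Ici (K.find x : ℝ)) (fun x => convex_Ici _) (fun x => ⟨(K.find x + 1 : ℕ), by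
      have h : K (K.find x + 1) ∈ 𝓝 x := mem_interior_iff_mem_nhds.1
        (K.subset_interior_succ _ (K.mem_find x))
      filter_upwards [h] with y hy
      simpa using (Nat.cast_le (α := ℝ)).2 (K.mem_iff_find_le.1 hy)⟩)
  refine ⟨f, fun c => (K.isCompact ⌈c⌉₊).of_isClosed_subset
    (isClosed_le f.contMDiff.continuous continuous_const) fun x hx => ?_⟩
  rw [K.mem_iff_find_le]
  have h1 : (K.find x : ℝ) ≤ f x := hf x
  exact_mod_cast (h1.trans hx).trans (Nat.le_ceil c)

/-- Every algebra homomorphism `C^∞(M) → ℝ` is the evaluation at a point. -/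
theorem exists_eq_eval (χ : M.Fun →ₐ[ℝ] ℝ) : ∃ x, ∀ f : M.Fun, χ f = f x := by
  by_contra! hcon
  choose h hh using hcon
  obtain ⟨f, hf⟩ := exists_proper (M := M)
  have hc : ∀ r : ℝ, χ (algebraMap ℝ M.Fun r) = r := fun r => by simp
  -- The squares `u g` lie in the kernel of `χ`, and some finite sum of them vanishes nowhere: `u f`
  -- is positive off the compact set `{f ≤ χ f}`, which finitely many `u (h x)` take care of. A
  -- function without zeros is invertible, so `χ` cannot kill it.
  let u : M.Fun → M.Fun := fun g => (g - algebraMap ℝ M.Fun (χ g)) * (g - algebraMap ℝ M.Fun (χ g))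
  have hu : ∀ g x, u g x = (g x - χ g) * (g x - χ g) := fun g x => rfl
  have hχu : ∀ g, χ (u g) = 0 := fun g => by simp [u, hc]
  obtain ⟨t, -, ht⟩ := (hf (χ f)).elim_nhds_subcover (fun x => {y | h x y ≠ χ (h x)})
    (fun x _ => (isOpen_ne_fun (h x).contMDiff.continuous continuous_const).mem_nhds (hh x).symm)
  let w : M.Fun := u f + ∑ x ∈ t, u (h x)
  have hw : ∀ y, w y = u f y + ∑ x ∈ t, u (h x) y := fun y => by
    have := map_sum (ContMDiffMap.evalRingHom (I := 𝓘(ℝ, M.E)) (n := ∞) (R := ℝ) y) (fun x => u (h x)) t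
    exact congrArg (u f y + ·) this
  have hpos : ∀ y, w y ≠ 0 := by
    intro y
    rw [hw]
    have h0 : ∀ g, 0 ≤ u g y := fun g => by rw [hu]; exact mul_self_nonneg _
    have h1 : 0 ≤ ∑ x ∈ t, u (h x) y := Finset.sum_nonneg fun x _ => h0 _
    by_cases hy : f y ≤ χ f
    · obtain ⟨x, hx, hxy⟩ : ∃ x ∈ t, h x y ≠ χ (h x) := by simpa using ht hy
      have h2 : u (h x) y ≤ ∑ x ∈ t, u (h x) y :=
        Finset.single_le_sum (f := fun x => u (h x) y) (fun x _ => h0 _) hx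
      have h3 : 0 < u (h x) y := by
        rw [hu]; exact mul_self_pos.2 (sub_ne_zero.2 hxy)
      linarith [h0 f]
    · have h3 : 0 < u f y := by
        rw [hu]; exact mul_self_pos.2 (sub_ne_zero.2 fun h => hy h.le)
      linarith
  let w' : M.Fun := ⟨fun y => (w y)⁻¹, fun y => (w.contMDiff y).inv₀ (hpos y)⟩
  have hww : w * w' = 1 := by
    ext y
    exact mul_inv_cancel₀ (hpos y)
  have h1 : χ w = 0 := by simp [w, hχu]
  have h2 := congrArg χ hww
  rw [map_mul, h1, map_one, zero_mul] at h2
  exact zero_ne_one h2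

/-- A family of points is smooth if its composition with each smooth function is smooth. -/
theorem contMDiff_of_comp {N : Mfd.{u}} {φ : N.pt → M.pt}
    (h : ∀ f : M.Fun, ContMDiff 𝓘(ℝ, N.E) 𝓘(ℝ, ℝ) ∞ (fun y => f (φ y))) :
    ContMDiff 𝓘(ℝ, N.E) 𝓘(ℝ, M.E) ∞ φ := by
  have hcont : Continuous φ := by
    rw [continuous_iff_continuousAt]
    intro y
    rw [ContinuousAt, tendsto_def]
    intro U hU
    -- As long as `ρ` is nonzero along `φ`, the points `φ z` stay in its support, hence in `U`.
    obtain ⟨ρ, h1, h2⟩ := exists_bump hU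
    have h3 : ∀ᶠ z in 𝓝 y, ρ (φ z) ≠ 0 := by
      have h4 := (h ρ).continuous.continuousAt (x := y)
      exact h4.eventually_ne (by rw [h1.self_of_nhds]; exact one_ne_zero)
    filter_upwards [h3] with z hz
    exact h2 (subset_tsupport _ hz)
  intro y
  rw [contMDiffAt_iff_target]
  refine ⟨hcont.continuousAt, ?_⟩
  let b := Module.finBasis ℝ M.E
  let e := frame (φ y)
  -- Near `φ y` the functions of the frame are the chart coordinates, so this sum is `φ` read in the
  -- chart.
  have hs : ContMDiffAt 𝓘(ℝ, N.E) 𝓘(ℝ, M.E) ∞ (fun z => ∑ p, e.g p (φ z) • b p) y :=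
    ContMDiffAt.sum fun p _ => (h (e.g p) y).smul contMDiffAt_const
  refine hs.congr_of_eventuallyEq ?_
  filter_upwards [hcont.continuousAt.eventually (eventually_all.2 e.coord)] with z hz
  simp only [hz, Function.comp_apply]
  exact (b.sum_repr _).symm

end Mfd

/-! ### Derivations of the algebra of smooth functions at a point -/

/-- Smooth dependence on the parameter is borrowed from convolutions: the integral is the value at
`0` of the convolution of the indicator of `(0, 1]` with `s ↦ χ s * F z (-s)`. The bump function
`χ`, equal to `1` on `[-1, 1]`, only provides compact support. -/
theorem contDiff_integral_unitInterval {E : Type*} [NormedAddCommGroup E] [NormedSpace ℝ E]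
    {F : E → ℝ → ℝ} (hF : ContDiff ℝ ∞ (fun p : E × ℝ => F p.1 p.2)) :
    ContDiff ℝ ∞ (fun z => ∫ t in (0 : ℝ)..1, F z t) := by
  let χ : ContDiffBump (0 : ℝ) := ⟨1, 2, one_pos, one_lt_two⟩
  let f : ℝ → ℝ := (Ioc (0 : ℝ) 1).indicator fun _ => 1
  let g : E → ℝ → ℝ := fun z s => χ s * F z (-s)
  have hf : MeasureTheory.LocallyIntegrable f :=
    ((MeasureTheory.integrable_indicator_iff measurableSet_Ioc).2 (by simp)).locallyIntegrable
  have hg : ContDiffOn ℝ ∞ (↿g) (univ ×ˢ univ) := by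
    rw [univ_prod_univ, contDiffOn_univ]
    have h1 : ContDiff ℝ ∞ (fun p : E × ℝ => χ p.2) := χ.contDiff.comp contDiff_snd
    have h2 : ContDiff ℝ ∞ (fun p : E × ℝ => F p.1 (-p.2)) :=
      hF.comp (contDiff_fst.prodMk contDiff_snd.neg)
    exact h1.mul h2
  have key := MeasureTheory.contDiffOn_convolution_right_with_param_comp (n := ⊤) (μ := MeasureTheory.volume)
    (ContinuousLinearMap.mul ℝ ℝ) (v := fun _ : E => (0 : ℝ)) contDiffOn_const isOpen_univ
    (k := Metric.closedBall 0 2) (isCompact_closedBall _ _) (f := f) (g := g) (s := univ)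
    (fun z s _ hs => by
      have : χ s = 0 := χ.zero_of_le_dist (not_le.1 fun h => hs (Metric.mem_closedBall.2 h)).le
      simp [g, this]) hf hg
  rw [contDiffOn_univ] at key
  convert key using 2 with z
  rw [intervalIntegral.integral_of_le zero_le_one, MeasureTheory.convolution,
    ← MeasureTheory.integral_indicator measurableSet_Ioc]
  congr 1
  ext t
  by_cases ht : t ∈ Ioc (0 : ℝ) 1
  · have h1 : χ (-t) = 1 := χ.one_of_mem_closedBall (by
      simp only [Metric.mem_closedBall, dist_zero_right, norm_neg, Real.norm_eq_abs]
      exact abs_le.2 ⟨by linarith [ht.1], ht.2⟩)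
    simp [f, g, ht, h1]
  · simp [f, ht]

/-- Hadamard's lemma. -/
theorem exists_eq_add_sum_coord_mul {E : Type*} [NormedAddCommGroup E] [NormedSpace ℝ E]
    {ι : Type*} [Fintype ι] (b : Module.Basis ι ℝ E) {v : E → ℝ} (hv : ContDiff ℝ ∞ v) (z₀ : E) :
    ∃ h : ι → E → ℝ, (∀ p, ContDiff ℝ ∞ (h p)) ∧
      ∀ z, v z = v z₀ + ∑ p, b.coord p (z - z₀) * h p z := by
  have hv' : ContDiff ℝ ∞ (fderiv ℝ v) := hv.fderiv_right (by simp)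
  have hline : ContDiff ℝ ∞ (fun q : E × ℝ => z₀ + q.2 • (q.1 - z₀)) := by fun_prop
  have hF : ∀ w, ContDiff ℝ ∞ (fun q : E × ℝ => fderiv ℝ v (z₀ + q.2 • (q.1 - z₀)) w) := fun w =>
    (hv'.comp hline).clm_apply contDiff_const
  -- The coefficient `h p` is the mean of the `p`-th partial derivative over the segment from `z₀`
  -- to `z`; the identity is the fundamental theorem of calculus on this segment.
  refine ⟨fun p z => ∫ t in (0 : ℝ)..1, fderiv ℝ v (z₀ + t • (z - z₀)) (b p),
    fun p => contDiff_integral_unitInterval (hF (b p)), fun z => ?_⟩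
  have hc : ∀ w, Continuous fun t : ℝ => fderiv ℝ v (z₀ + t • (z - z₀)) w := fun w =>
    (hF w).continuous.comp (Continuous.prodMk_right z)
  have hd : ∀ t : ℝ, HasDerivAt (fun t : ℝ => v (z₀ + t • (z - z₀)))
      (fderiv ℝ v (z₀ + t • (z - z₀)) (z - z₀)) t := by
    intro t
    have h1 : HasDerivAt (fun t : ℝ => z₀ + t • (z - z₀)) (z - z₀) t := by
      simpa using ((hasDerivAt_id t).smul_const (z - z₀)).const_add z₀
    exact ((hv.differentiable (by simp)) _).hasFDerivAt.comp_hasDerivAt t h1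
  have h2 := intervalIntegral.integral_eq_sub_of_hasDerivAt (a := 0) (b := 1) (fun t _ => hd t)
    ((hc _).intervalIntegrable _ _)
  have h3 : ∀ t : ℝ, fderiv ℝ v (z₀ + t • (z - z₀)) (z - z₀) =
      ∑ p, b.coord p (z - z₀) * fderiv ℝ v (z₀ + t • (z - z₀)) (b p) := by
    intro t
    have h4 := congrArg (fderiv ℝ v (z₀ + t • (z - z₀))) (b.sum_repr (z - z₀))
    rw [map_sum] at h4
    simp only [← h4, map_smul, smul_eq_mul, Module.Basis.coord_apply]
  simp only [h3] at h2
  rw [intervalIntegral.integral_finsetSum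
    (fun p _ => ((hc (b p)).const_mul _).intervalIntegrable _ _)] at h2
  simp only [intervalIntegral.integral_const_mul, one_smul, zero_smul, add_zero,
    add_sub_cancel] at h2
  rw [h2]
  ring

namespace Mfd

variable {M : Mfd.{u}} {x₀ : M.pt}

/-- The germ of `f` is pushed to the model space by the chart and extended to all of it; the
coefficients which Hadamard's lemma gives there are pulled back and cut off. -/
theorem exists_eq_add_sum_frame (e : Frame M x₀) (f : M.Fun) :
    ∃ h : Fin (Module.finrank ℝ M.E) → M.Fun,
      ∀ᶠ y in 𝓝 x₀, f y = f x₀ + ∑ p, (e.g p y - e.g p x₀) * h p y := by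
  let b := Module.finBasis ℝ M.E
  let c := extChartAt 𝓘(ℝ, M.E) x₀
  have : ProperSpace M.E := FiniteDimensional.proper_real M.E
  -- The model space as a manifold, so that `exists_fun_eq` also extends germs on it.
  let N : Mfd.{u} := { E := M.E, pt := M.E }
  have ht : c.target ∈ 𝓝 (c x₀) := extChartAt_target_mem_nhds x₀
  have hsrc : (chartAt M.E x₀).source ∈ 𝓝 x₀ := chart_source_mem_nhds _ _
  have hcont : ContinuousAt c x₀ := continuousAt_extChartAt x₀
  obtain ⟨v, hv⟩ := exists_fun_eq (M := N) (f := fun z => f (c.symm z)) ht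
    (f.contMDiff.comp_contMDiffOn (contMDiffOn_extChartAt_symm x₀))
  have hv1 : ContDiff ℝ ∞ v := contMDiff_iff_contDiff.1 v.contMDiff
  obtain ⟨h, hh, hvh⟩ := exists_eq_add_sum_coord_mul b hv1 (c x₀)
  choose H hH using fun p => exists_fun_eq (M := M) hsrc
    ((hh p).contMDiff.comp_contMDiffOn (contMDiffOn_extChartAt (I := 𝓘(ℝ, M.E)) (x := x₀)))
  have hf : ∀ᶠ y in 𝓝 x₀, v (c y) = f y := by
    filter_upwards [hcont.eventually hv, hsrc] with y hy hys
    rw [hy, c.left_inv (by rwa [extChartAt_source])]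
  refine ⟨H, ?_⟩
  filter_upwards [hf, eventually_all.2 hH, eventually_all.2 e.coord] with y h1 h2 h3
  rw [← h1, hvh, hf.self_of_nhds]
  congr 1
  refine Finset.sum_congr rfl fun p _ => ?_
  rw [h2, h3, (e.coord p).self_of_nhds, map_sub]
  rfl

/-- A derivation at a point is local. -/
theorem derivation_eq_of_eventuallyEq {G : Type*} [AddCommGroup G] [Module ℝ G]
    (D : M.Fun →ₗ[ℝ] G) (hD : ∀ f g : M.Fun, D (f * g) = f x₀ • D g + g x₀ • D f) {f g : M.Fun}
    (h : ∀ᶠ y in 𝓝 x₀, f y = g y) : D f = D g := by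
  -- The product `ρ * (f - g)` is zero, since `ρ` is supported where `f = g`; but the Leibniz rule
  -- gives it the value `D (f - g)`.
  obtain ⟨ρ, h1, h2⟩ := exists_bump h
  have h3 : ρ * (f - g) = 0 := by
    ext y
    change ρ y * (f y - g y) = 0
    by_cases hy : y ∈ tsupport ρ
    · rw [sub_eq_zero.2 (h2 hy), mul_zero]
    · rw [image_eq_zero_of_notMem_tsupport hy, zero_mul]
  have h4 := hD ρ (f - g)
  have h5 : (f - g) x₀ = 0 := sub_eq_zero.2 h.self_of_nhds
  rw [h3, map_zero, h5, h1.self_of_nhds, zero_smul, add_zero, one_smul, map_sub] at h4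
  exact (sub_eq_zero.1 h4.symm)

theorem derivation_const {G : Type*} [AddCommGroup G] [Module ℝ G]
    (D : M.Fun →ₗ[ℝ] G) (hD : ∀ f g : M.Fun, D (f * g) = f x₀ • D g + g x₀ • D f) (r : ℝ) :
    D (algebraMap ℝ M.Fun r) = 0 := by
  have h1 : D 1 = 0 := by
    have h2 := hD 1 1
    have h3 : (1 : M.Fun) x₀ = 1 := rfl
    rw [h3, one_smul, mul_one] at h2
    exact left_eq_add.1 h2
  rw [Algebra.algebraMap_eq_smul_one, map_smul, h1, smul_zero]

/-- Each factor `g p - g p x₀` vanishes at `x₀`, so the Leibniz rule leaves only `h p x₀ • D (g p)`.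
The coefficients `h` are an input, so that two derivations can be evaluated with the same ones. -/
theorem derivation_eq_sum_of_eventuallyEq {G : Type*} [AddCommGroup G] [Module ℝ G]
    (D : M.Fun →ₗ[ℝ] G) (hD : ∀ f g : M.Fun, D (f * g) = f x₀ • D g + g x₀ • D f) (e : Frame M x₀)
    {f : M.Fun} {h : Fin (Module.finrank ℝ M.E) → M.Fun}
    (hh : ∀ᶠ y in 𝓝 x₀, f y = f x₀ + ∑ p, (e.g p y - e.g p x₀) * h p y) :
    D f = ∑ p, h p x₀ • D (e.g p) := by
  have h1 : D f = D (algebraMap ℝ M.Fun (f x₀) +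
      ∑ p, (e.g p - algebraMap ℝ M.Fun (e.g p x₀)) * h p) := by
    refine derivation_eq_of_eventuallyEq D hD ?_
    filter_upwards [hh] with y hy
    rw [hy]
    have := map_sum (ContMDiffMap.evalRingHom (I := 𝓘(ℝ, M.E)) (n := ∞) (R := ℝ) y)
      (fun p => (e.g p - algebraMap ℝ M.Fun (e.g p x₀)) * h p) Finset.univ
    exact congrArg (f x₀ + ·) this.symm
  rw [h1, map_add, derivation_const D hD, zero_add, map_sum]
  refine Finset.sum_congr rfl fun p _ => ?_
  have h2 : (e.g p - algebraMap ℝ M.Fun (e.g p x₀)) x₀ = 0 := sub_self _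
  rw [hD, h2, zero_smul, zero_add, map_sub, derivation_const D hD, sub_zero]

/-- A derivation at a point is determined by its values on coordinate functions. -/
theorem derivation_eq_sum {G : Type*} [AddCommGroup G] [Module ℝ G] (D : M.Fun →ₗ[ℝ] G)
    (hD : ∀ f g : M.Fun, D (f * g) = f x₀ • D g + g x₀ • D f) (e : Frame M x₀) (f : M.Fun) :
    D f = ∑ p, dif f x₀ (e.Y p x₀) • D (e.g p) := by
  obtain ⟨h, hh⟩ := exists_eq_add_sum_frame e f
  rw [derivation_eq_sum_of_eventuallyEq D hD e hh]
  refine Finset.sum_congr rfl fun p _ => ?_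
  congr 1
  -- The derivation `f ↦ df(Y p)`, evaluated with the same coefficients, identifies `h p x₀`.
  let d : M.Fun →ₗ[ℝ] ℝ :=
    { toFun := fun f => dif f x₀ (e.Y p x₀)
      map_add' := fun f g => LinearMap.congr_fun (dif_add (f.mdiff x₀) (g.mdiff x₀)) _
      map_smul' := fun r f => by
        have := LinearMap.congr_fun (dif_mul (mdifferentiableAt_const (c := r)) (f.mdiff x₀))
          (e.Y p x₀)
        rw [dif_const, smul_zero, add_zero] at this
        exact this }
  have h3 := derivation_eq_sum_of_eventuallyEq d
    (fun f g => LinearMap.congr_fun (dif_mul (f.mdiff x₀) (g.mdiff x₀)) (e.Y p x₀)) e hh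
  change dif f x₀ (e.Y p x₀) = ∑ q, h q x₀ • dif (e.g q) x₀ (e.Y p x₀) at h3
  rw [h3]
  simp [e.dual_self.1]

end Mfd

/-! ### Sections of dual bundles -/

namespace DualSection

variable {M : Mfd.{u}} {F : Type u} [NormedAddCommGroup F] [NormedSpace ℝ F]
  {V : M.pt → Type u} [∀ y, AddCommGroup (V y)] [∀ y, Module ℝ (V y)]
  [∀ y, TopologicalSpace (V y)] [TopologicalSpace (TotalSpace F V)] [FiberBundle F V]

theorem toFun_injective :
    Function.Injective (DualSection.toFun : DualSection M F V → ∀ y, V y →ₗ[ℝ] ℝ) := by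
  rintro ⟨s, hs⟩ ⟨t, ht⟩ rfl
  rfl

instance : Zero (DualSection M F V) := ⟨⟨fun _ => 0, contMDiff_const⟩⟩
instance : Add (DualSection M F V) :=
  ⟨fun s t => ⟨fun y => s.toFun y + t.toFun y, s.smooth.add t.smooth⟩⟩
instance : Neg (DualSection M F V) := ⟨fun s => ⟨fun y => -s.toFun y, s.smooth.neg⟩⟩
instance : Sub (DualSection M F V) :=
  ⟨fun s t => ⟨fun y => s.toFun y - t.toFun y, s.smooth.sub t.smooth⟩⟩
instance : SMul ℕ (DualSection M F V) :=
  ⟨fun n s => ⟨fun y => n • s.toFun y, by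
    have h : ContMDiff (𝓘(ℝ, M.E).prod 𝓘(ℝ, F)) 𝓘(ℝ, ℝ) ∞
      (fun v : TotalSpace F V => (n : ℝ) * s.toFun v.proj v.snd) := contMDiff_const.mul s.smooth
    simpa using h⟩⟩
instance : SMul ℤ (DualSection M F V) :=
  ⟨fun n s => ⟨fun y => n • s.toFun y, by
    have h : ContMDiff (𝓘(ℝ, M.E).prod 𝓘(ℝ, F)) 𝓘(ℝ, ℝ) ∞
      (fun v : TotalSpace F V => (n : ℝ) * s.toFun v.proj v.snd) := contMDiff_const.mul s.smooth
    simpa using h⟩⟩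

instance : AddCommGroup (DualSection M F V) :=
  toFun_injective.addCommGroup _ rfl (fun _ _ => rfl) (fun _ => rfl) (fun _ _ => rfl)
    (fun _ _ => rfl) (fun _ _ => rfl)

instance : SMul M.Fun (DualSection M F V) :=
  ⟨fun f s => ⟨fun y => f y • s.toFun y,
    (f.contMDiff.comp (contMDiff_proj V)).mul s.smooth⟩⟩

theorem add_toFun (s t : DualSection M F V) (y : M.pt) :
    (s + t).toFun y = s.toFun y + t.toFun y := rfl

theorem smul_toFun (f : M.Fun) (s : DualSection M F V) (y : M.pt) :
    (f • s).toFun y = f y • s.toFun y := rfl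

theorem sum_toFun {κ : Type*} (t : Finset κ) (s : κ → DualSection M F V) (y : M.pt) :
    (∑ i ∈ t, s i).toFun y = ∑ i ∈ t, (s i).toFun y := by
  classical
  induction t using Finset.induction_on with
  | empty => simp; rfl
  | insert a t ha ih => rw [Finset.sum_insert ha, Finset.sum_insert ha, add_toFun, ih]

/-- The value of a section of the dual bundle on a smooth section. -/
def eval (s : DualSection M F V) {Y : ∀ y, V y}
    (hY : ContMDiff 𝓘(ℝ, M.E) (𝓘(ℝ, M.E).prod 𝓘(ℝ, F)) ∞
      (fun x => (⟨x, Y x⟩ : TotalSpace F V))) : M.Fun :=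
  ⟨fun y => s.toFun y (Y y), s.smooth.comp hY⟩

theorem eval_apply (s : DualSection M F V) {Y : ∀ y, V y}
    (hY : ContMDiff 𝓘(ℝ, M.E) (𝓘(ℝ, M.E).prod 𝓘(ℝ, F)) ∞
      (fun x => (⟨x, Y x⟩ : TotalSpace F V))) (y : M.pt) : s.eval hY y = s.toFun y (Y y) := rfl

end DualSection

namespace Mfd

variable {M : Mfd.{u}}

/-- The differential of a smooth function. -/
def Fun.d (f : M.Fun) : OneForm M where
  toFun x := dif f x
  smooth := by
    have h1 := f.contMDiff.contMDiff_tangentMap (m := ∞) (by simp)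
    exact contMDiff_snd_tangentBundle_modelSpace ℝ 𝓘(ℝ, ℝ) |>.comp h1

/-- A map on 1-forms which is tensorial at `x` is determined by its values on the differentials
of coordinate functions. -/
theorem tensorial_eq_sum {x : M.pt} {G : Type*} [AddCommGroup G] [Module ℝ G]
    (a : OneForm M →+ G) (ha : ∀ (f : M.Fun) α, a (f • α) = f x • a α) (e : Frame M x)
    (α : OneForm M) : a α = ∑ q, α.toFun x (e.Y q x) • a (e.g q).d := by
  -- After cutting off by `ρ`, the expansion of `α` in the coordinate coframe holds on all of `M`,
  -- so that `a` can be applied to it.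
  obtain ⟨ρ, h1, h2⟩ := exists_bump e.dual
  have h3 : ρ • α = ∑ q, (ρ * α.eval (e.smooth_Y q)) • (e.g q).d := by
    refine DualSection.toFun_injective (funext fun y => ?_)
    rw [DualSection.smul_toFun, DualSection.sum_toFun]
    have h4 : ∀ q, ((ρ * α.eval (e.smooth_Y q)) • (e.g q).d).toFun y =
        ρ y • (α.toFun y (e.Y q y) • dif (e.g q) y) := fun q => mul_smul _ _ _
    simp only [h4, ← Finset.smul_sum]
    by_cases hy : y ∈ tsupport ρ
    · rw [← e.covector_eq (h2 hy).2]
    · rw [image_eq_zero_of_notMem_tsupport hy, zero_smul, zero_smul]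
  have h5 := congrArg a h3
  rw [ha, h1.self_of_nhds, one_smul, map_sum] at h5
  rw [h5]
  refine Finset.sum_congr rfl fun q _ => ?_
  have h6 : (ρ * α.eval (e.smooth_Y q)) x = ρ x * α.toFun x (e.Y q x) := rfl
  rw [ha, h6, h1.self_of_nhds, one_mul]

end Mfd

/-! ### Morphisms between split N-manifolds -/

namespace GrBundle

variable {M N : Mfd.{u}} (V : GrBundle M) (W : GrBundle N)

/-- The sections which near each point are polynomials in smooth functions and smooth sections
of `V^*`. -/
def locPoly : Subalgebra ℝ V.Raw where
  carrier := {z | ∀ y₀, ∃ p ∈ V.poly, ∀ᶠ y in 𝓝 y₀, z y = p y}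
  mul_mem' := by
    intro z η h₂ h₂' y₀
    obtain ⟨p, hp, hp'⟩ := h₂ y₀
    obtain ⟨q, hq, hq'⟩ := h₂' y₀
    refine ⟨p * q, V.poly.mul_mem hp hq, ?_⟩
    filter_upwards [hp', hq'] with y h h'
    simp [h, h']
  add_mem' := by
    intro z η h₂ h₂' y₀
    obtain ⟨p, hp, hp'⟩ := h₂ y₀
    obtain ⟨q, hq, hq'⟩ := h₂' y₀
    refine ⟨p + q, V.poly.add_mem hp hq, ?_⟩
    filter_upwards [hp', hq'] with y h h'
    simp [h, h']
  algebraMap_mem' r y₀ := ⟨_, V.poly.algebraMap_mem r, Eventually.of_forall fun _ => rfl⟩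

variable {V W}

theorem mem_locPoly_of_eventuallyEq {z : V.Raw}
    (h : ∀ y₀, ∃ w ∈ V.locPoly, ∀ᶠ y in 𝓝 y₀, z y = w y) : z ∈ V.locPoly := by
  intro y₀
  obtain ⟨w, hw, hzw⟩ := h y₀
  obtain ⟨p, hp, hwp⟩ := hw y₀
  refine ⟨p, hp, ?_⟩
  filter_upwards [hzw, hwp] with y h1 h2
  rw [h1, h2]

theorem poly_le_locPoly : V.poly ≤ V.locPoly :=
  fun p hp _ => ⟨p, hp, Eventually.of_forall fun _ => rfl⟩

theorem fnRaw_mem_poly (f : M.Fun) : V.fnRaw f ∈ V.poly := Algebra.subset_adjoin (Or.inl ⟨f, rfl⟩)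

theorem secRaw_mem_poly (a : V.ι) (s : V.DualSec a) : V.secRaw a s.toFun ∈ V.poly :=
  Algebra.subset_adjoin (Or.inr ⟨a, s, rfl⟩)

theorem funAlg_le_locPoly : V.funAlg ≤ V.locPoly := by
  have h : (⨆ n, V.smoothPart n) ≤ V.locPoly.toSubmodule := iSup_le fun n z hz => hz.2
  exact h

theorem raw_injective : Function.Injective V.raw := Subtype.val_injective

theorem raw_mem (c : V.split.C) : V.raw c ∈ V.funAlg := c.2

theorem mem_deg_iff {n : ℕ} {c : V.split.C} : c ∈ V.split.deg n ↔ V.raw c ∈ V.smoothPart n :=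
  Iff.rfl

/-- The elements of the function algebra as sections, as an algebra homomorphism. -/
def rawHom : V.split.C →ₐ[ℝ] V.Raw := V.funAlg.val

theorem raw_mul (c d : V.split.C) : V.raw (c * d) = V.raw c * V.raw d := map_mul rawHom c d
theorem raw_add (c d : V.split.C) : V.raw (c + d) = V.raw c + V.raw d := map_add rawHom c d
theorem raw_sub (c d : V.split.C) : V.raw (c - d) = V.raw c - V.raw d := map_sub rawHom c d
theorem raw_smul (r : ℝ) (c : V.split.C) : V.raw (r • c) = r • V.raw c := map_smul rawHom r c
theorem raw_sum {κ : Type*} (s : Finset κ) (c : κ → V.split.C) :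
    V.raw (∑ i ∈ s, c i) = ∑ i ∈ s, V.raw (c i) := map_sum rawHom c s
theorem raw_one : V.raw 1 = 1 := map_one rawHom
theorem raw_zero : V.raw 0 = 0 := map_zero rawHom
theorem raw_fn (f : M.Fun) : V.raw (V.fn f) = V.fnRaw f := rfl

/-- An element of the function algebra given by a section. -/
def ofRaw {n : ℕ} (z : V.Raw) (hz : z ∈ V.smoothPart n) : V.split.C :=
  (⟨z, V.smoothPart_le n hz⟩ : V.funAlg)

theorem raw_ofRaw {n : ℕ} (z : V.Raw) (hz : z ∈ V.smoothPart n) : V.raw (ofRaw z hz) = z := rfl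

theorem ofRaw_mem {n : ℕ} (z : V.Raw) (hz : z ∈ V.smoothPart n) : ofRaw z hz ∈ V.split.deg n := hz

/-- Functions on `M` as elements of the function algebra, as an algebra homomorphism. -/
def fnHom : M.Fun →ₐ[ℝ] V.split.C where
  toFun := V.fn
  map_one' := raw_injective (by ext y; simp [raw_fn, fnRaw, raw_one])
  map_mul' f g := raw_injective (by ext y; simp [raw_fn, fnRaw, raw_mul])
  map_zero' := raw_injective (by ext y; simp [raw_fn, fnRaw, raw_zero])
  map_add' f g := raw_injective (by ext y; simp [raw_fn, fnRaw, raw_add])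
  commutes' r := rfl

theorem fn_mem (f : M.Fun) : V.fn f ∈ V.split.deg 0 := V.fnRaw_mem f

theorem sec_mem (a : V.ι) (s : V.DualSec a) : V.sec a s ∈ V.split.deg (V.deg a) := V.secRaw_mem a s

/-- The degree `0` component of a section, as a function. -/
theorem contMDiff_aug {z : V.Raw} (hz : z ∈ V.locPoly) :
    ContMDiff 𝓘(ℝ, M.E) 𝓘(ℝ, ℝ) ∞ (fun y => GSym.aug (z y)) := by
  have key : ∀ p ∈ V.poly, ContMDiff 𝓘(ℝ, M.E) 𝓘(ℝ, ℝ) ∞ (fun y => GSym.aug (p y)) := by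
    intro p hp
    induction hp using Algebra.adjoin_induction with
    | mem x hx =>
      rcases hx with ⟨f, rfl⟩ | ⟨a, s, rfl⟩
      · simpa [fnRaw] using f.contMDiff
      · simpa [secRaw, GSym.aug_gen] using contMDiff_const
    | algebraMap r => simpa using contMDiff_const
    | add x y _ _ hx hy => exact (hx.add hy).congr fun z => by simp
    | mul x y _ _ hx hy => exact (hx.mul hy).congr fun z => by simp
  intro y₀
  obtain ⟨p, hp, hp'⟩ := hz y₀
  refine (key p hp y₀).congr_of_eventuallyEq ?_
  filter_upwards [hp'] with y hy
  rw [hy]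

/-- An algebra homomorphism from functions on `N` to functions of degree `0` on `𝔖(V)` is the
pullback along a smooth map. -/
theorem exists_base_map (χ : N.Fun →ₐ[ℝ] V.split.C) (hχ : ∀ f, χ f ∈ V.split.deg 0) :
    ∃ φ : M.pt → N.pt, ContMDiff 𝓘(ℝ, M.E) 𝓘(ℝ, N.E) ∞ φ ∧
      ∀ f : N.Fun, V.raw (χ f) = V.fnRaw (fun y => f (φ y)) := by
  -- The degree `0` component at `y` is a real number. Composed with `χ` it is a character of
  -- `C^∞(N)`, hence the evaluation at a point `φ y`.
  let ev : ∀ y, V.split.C →ₐ[ℝ] ℝ := fun y =>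
    GSym.aug.comp ((Pi.evalAlgHom ℝ V.Fib y).comp rawHom)
  choose φ hφ using fun y => Mfd.exists_eq_eval ((ev y).comp χ)
  have h1 : ∀ f : N.Fun, V.raw (χ f) = V.fnRaw (fun y => f (φ y)) := fun f => funext fun y => by
    rw [GSym.eq_algebraMap_aug V.deg_pos ((mem_deg_iff.1 (hχ f)).1 y), fnRaw, ← hφ y f]
    rfl
  refine ⟨φ, Mfd.contMDiff_of_comp fun f => ?_, h1⟩
  have h2 := contMDiff_aug (funAlg_le_locPoly (raw_mem (χ f)))
  simpa [h1, fnRaw] using h2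

/-! ### Morphisms given by homomorphisms of fibres -/

section FibreHom

variable (φ : M.pt → N.pt)
  (h : ∀ b y, Module.Dual ℝ (W.V b (φ y)) →ₗ[ℝ] V.Fib y)
  (hdeg : ∀ b y α, h b y α ∈ V.part y (W.deg b))

/-- The homomorphism of fibres determined by its values on generators. -/
def fibHom (y : M.pt) : W.Fib (φ y) →ₐ[ℝ] V.Fib y :=
  GSym.lift (fun b => h b y) fun a b v w => GSym.part_mul_comm (hdeg a y v) (hdeg b y w)

theorem fibHom_gen (y : M.pt) (b : W.ι) (α : Module.Dual ℝ (W.V b (φ y))) :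
    fibHom φ h hdeg y (W.gen b (φ y) α) = h b y α := GSym.lift_gen _ _ _ _

theorem fibHom_mem_part (y : M.pt) {n : ℕ} {z : W.Fib (φ y)} (hz : z ∈ W.part (φ y) n) :
    fibHom φ h hdeg y z ∈ V.part y n :=
  GSym.map_mem_part (fun a v => by rw [fibHom_gen]; exact hdeg a y v) hz

/-- The homomorphism of sections determined by homomorphisms of fibres. -/
def rawPull : W.Raw →ₐ[ℝ] V.Raw where
  toFun z y := fibHom φ h hdeg y (z (φ y))
  map_one' := by ext y; simp
  map_mul' _ _ := by ext y; simp
  map_zero' := by ext y; simp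
  map_add' _ _ := by ext y; simp
  commutes' r := by ext y; simp

variable (hφ : ContMDiff 𝓘(ℝ, M.E) 𝓘(ℝ, N.E) ∞ φ)
  (hs : ∀ b (s : W.DualSec b), (fun y => h b y (s.toFun (φ y))) ∈ V.locPoly)

-- Generators suffice by multiplicativity, and continuity of `φ` carries a polynomial representation
-- near `φ y₀` to one near `y₀`.
include hφ hs in
theorem rawPull_mem_locPoly {z : W.Raw} (hz : z ∈ W.locPoly) :
    rawPull φ h hdeg z ∈ V.locPoly := by
  have key : W.poly ≤ V.locPoly.comap (rawPull φ h hdeg) := by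
    refine Algebra.adjoin_le ?_
    rintro _ (⟨f, rfl⟩ | ⟨b, s, rfl⟩)
    · have : rawPull φ h hdeg (W.fnRaw f) = V.fnRaw (f.comp ⟨φ, hφ⟩) := by
        ext y
        exact AlgHom.commutes _ _
      rw [SetLike.mem_coe, Subalgebra.mem_comap, this]
      exact poly_le_locPoly (fnRaw_mem_poly _)
    · have : rawPull φ h hdeg (W.secRaw b s.toFun) = fun y => h b y (s.toFun (φ y)) := by
        ext y
        exact fibHom_gen _ _ _ _ _ _
      rw [SetLike.mem_coe, Subalgebra.mem_comap, this]
      exact hs b s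
  refine mem_locPoly_of_eventuallyEq fun y₀ => ?_
  obtain ⟨p, hp, hzp⟩ := hz (φ y₀)
  refine ⟨_, key hp, ?_⟩
  filter_upwards [hφ.continuous.continuousAt.eventually hzp] with y hy
  change fibHom φ h hdeg y (z (φ y)) = fibHom φ h hdeg y (p (φ y))
  rw [hy]

include hφ hs in
theorem rawPull_mem_smoothPart {n : ℕ} {z : W.Raw} (hz : z ∈ W.smoothPart n) :
    rawPull φ h hdeg z ∈ V.smoothPart n :=
  ⟨fun y => fibHom_mem_part φ h hdeg y (hz.1 (φ y)), rawPull_mem_locPoly φ h hdeg hφ hs hz.2⟩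

/-- The morphism of split N-manifolds determined by homomorphisms of fibres. -/
def ofFibHom : V.split ⟶ W.split where
  pull := ((rawPull φ h hdeg).comp W.funAlg.val).codRestrict V.funAlg fun c => by
    have h1 : (⨆ n, W.smoothPart n) ≤ (⨆ n, V.smoothPart n).comap
        (rawPull φ h hdeg).toLinearMap := iSup_le fun n z hz =>
      Submodule.mem_iSup_of_mem n (rawPull_mem_smoothPart φ h hdeg hφ hs hz)
    exact h1 c.2
  pull_mem n c hc := rawPull_mem_smoothPart φ h hdeg hφ hs hc

theorem raw_ofFibHom (c : W.split.C) (y : M.pt) :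
    V.raw (NMfd.pullback (ofFibHom φ h hdeg hφ hs) c) y = fibHom φ h hdeg y (W.raw c (φ y)) := rfl

end FibreHom

end GrBundle

namespace GrBundle

variable {M N : Mfd.{u}} {V : GrBundle M} {W : GrBundle N}

/-! ### Strict morphisms -/

/-- The pullback of a section of the dual of a bundle along a bundle map. -/
def pullSec {φ : M.pt → N.pt} {f : ∀ a b y, V.V a y →ₗ[ℝ] W.V b (φ y)} (hf : IsBundleMap φ f)
    {a : V.ι} {b : W.ι} (hab : V.deg a = W.deg b) (s : W.DualSec b) : V.DualSec a :=
  ⟨fun y => (s.toFun (φ y)).comp (f a b y), s.smooth.comp (hf.2 a b hab)⟩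

/-- The values on generators of the homomorphisms of fibres given by a bundle map. -/
def strictGen (φ : M.pt → N.pt) (f : ∀ a b y, V.V a y →ₗ[ℝ] W.V b (φ y)) (b : W.ι) (y : M.pt) :
    Module.Dual ℝ (W.V b (φ y)) →ₗ[ℝ] V.Fib y :=
  ∑ a ∈ (V.finite_deg (W.deg b)).toFinset, (V.gen a y).comp (f a b y).dualMap

theorem strictGen_apply (φ : M.pt → N.pt) (f : ∀ a b y, V.V a y →ₗ[ℝ] W.V b (φ y)) (b : W.ι)
    (y : M.pt) (β : Module.Dual ℝ (W.V b (φ y))) : strictGen φ f b y β =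
      ∑ a ∈ (V.finite_deg (W.deg b)).toFinset, V.gen a y (β.comp (f a b y)) := by
  simp [strictGen, LinearMap.sum_apply, LinearMap.dualMap_def, Module.Dual.transpose_apply]

theorem strictGen_mem (φ : M.pt → N.pt) (f : ∀ a b y, V.V a y →ₗ[ℝ] W.V b (φ y)) (b : W.ι)
    (y : M.pt) (β : Module.Dual ℝ (W.V b (φ y))) : strictGen φ f b y β ∈ V.part y (W.deg b) := by
  rw [strictGen_apply]
  refine Submodule.sum_mem _ fun a ha => ?_
  have h : V.deg a = W.deg b := by simpa using ha
  rw [← h]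
  exact GSym.gen_mem_part _ _ _ _

theorem strictGen_mem_locPoly {φ : M.pt → N.pt} {f : ∀ a b y, V.V a y →ₗ[ℝ] W.V b (φ y)}
    (hf : IsBundleMap φ f) (b : W.ι) (s : W.DualSec b) :
    (fun y => strictGen φ f b y (s.toFun (φ y))) ∈ V.locPoly := by
  have h : (fun y => strictGen φ f b y (s.toFun (φ y))) =
      ∑ a ∈ (V.finite_deg (W.deg b)).toFinset,
        V.secRaw a (fun y => (s.toFun (φ y)).comp (f a b y)) := by
    ext y
    rw [strictGen_apply, Finset.sum_apply]
    rfl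
  rw [h]
  refine Subalgebra.sum_mem _ fun a ha => ?_
  have h : V.deg a = W.deg b := by simpa using ha
  exact poly_le_locPoly (secRaw_mem_poly a (pullSec hf h s))

/-- The morphism of split N-manifolds induced by a bundle map. -/
def strictHom {φ : M.pt → N.pt} {f : ∀ a b y, V.V a y →ₗ[ℝ] W.V b (φ y)} (hf : IsBundleMap φ f) :
    V.split ⟶ W.split :=
  ofFibHom φ (strictGen φ f) (strictGen_mem φ f) hf.1 (strictGen_mem_locPoly hf)

theorem raw_strictHom {φ : M.pt → N.pt} {f : ∀ a b y, V.V a y →ₗ[ℝ] W.V b (φ y)}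
    (hf : IsBundleMap φ f) (c : W.split.C) (y : M.pt) :
    V.raw (NMfd.pullback (strictHom hf) c) y =
      fibHom φ (strictGen φ f) (strictGen_mem φ f) y (W.raw c (φ y)) := rfl

theorem raw_strictHom_fn {φ : M.pt → N.pt} {f : ∀ a b y, V.V a y →ₗ[ℝ] W.V b (φ y)}
    (hf : IsBundleMap φ f) (g : N.Fun) :
    V.raw (NMfd.pullback (strictHom hf) (W.fn g)) = V.fnRaw (fun y => g (φ y)) := by
  ext y
  rw [raw_strictHom]
  exact AlgHom.commutes _ _

theorem raw_strictHom_sec {φ : M.pt → N.pt} {f : ∀ a b y, V.V a y →ₗ[ℝ] W.V b (φ y)}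
    (hf : IsBundleMap φ f) (b : W.ι) (s : W.DualSec b) :
    V.raw (NMfd.pullback (strictHom hf) (W.sec b s)) =
      ∑ a ∈ (V.finite_deg (W.deg b)).toFinset,
        V.secRaw a (fun y => (s.toFun (φ y)).comp (f a b y)) := by
  ext y
  rw [raw_strictHom, Finset.sum_apply]
  refine (fibHom_gen _ _ _ _ _ _).trans ?_
  rw [strictGen_apply]
  rfl

theorem strictHom_isInducedBy {φ : M.pt → N.pt} {f : ∀ a b y, V.V a y →ₗ[ℝ] W.V b (φ y)}
    (hf : IsBundleMap φ f) : IsInducedBy (strictHom hf) φ f :=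
  ⟨raw_strictHom_fn hf, raw_strictHom_sec hf⟩

/-! ### Linear maps determined by their values on generators -/

/-- Functions on base and sections of the dual bundle determine a linear map which satisfies a
product rule. -/
theorem eq_zero_of_generators {X : NMfd.{u}} (F : X ⟶ W.split) (D : W.split.C →ₗ[ℝ] X.C)
    (h1 : D 1 = 0) (hf : ∀ f b, D (W.fn f * b) = NMfd.pullback F (W.fn f) * D b)
    (hs : ∀ a s, ∃ c : X.C, ∀ b, D (W.sec a s * b) = c * D b) : D = 0 := by
  obtain ⟨M, V, e, he⟩ := X.splits
  let e₀ : X.C ≃ₐ[ℝ] V.split.C := e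
  let e' : X.C →ₐ[ℝ] V.split.C := e₀
  have he' : ∀ n c, c ∈ X.deg n ↔ e' c ∈ V.split.deg n := he
  obtain ⟨φ, hφ, hφ'⟩ := exists_base_map (V := V) ((e'.comp (NMfd.pullback F)).comp fnHom)
    fun f => (he' 0 _).1 (NMfd.pullback_mem F (fn_mem f))
  -- A polynomial is a combination of words in the generators. Removing letters from the left uses
  -- only `hf` and `hs`, and reduces the value of `D` on a word to `D 1 = 0`.
  have hpoly : ∀ p ∈ W.poly, ∃ c, W.raw c = p ∧ D c = 0 := by
    intro p hp
    have hp' : p ∈ Subalgebra.toSubmodule W.poly := hp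
    clear hp
    rw [poly, Algebra.adjoin_eq_span] at hp'
    induction hp' using Submodule.span_induction with
    | mem x hx =>
      induction hx using Submonoid.closure_induction_left with
      | one => exact ⟨1, raw_one, h1⟩
      | mul_left x hx y hy ih =>
        obtain ⟨c, rfl, hc⟩ := ih
        rcases hx with ⟨f, rfl⟩ | ⟨a, s, rfl⟩
        · exact ⟨W.fn f * c, raw_mul _ _, by rw [hf, hc, mul_zero]⟩
        · obtain ⟨d, hd⟩ := hs a s
          exact ⟨W.sec a s * c, raw_mul _ _, by rw [hd, hc, mul_zero]⟩
    | zero => exact ⟨0, raw_zero, map_zero _⟩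
    | add x y hx hy ihx ihy =>
      obtain ⟨c, rfl, hc⟩ := ihx
      obtain ⟨d, rfl, hd⟩ := ihy
      exact ⟨c + d, raw_add _ _, by rw [map_add, hc, hd, add_zero]⟩
    | smul r x hx ihx =>
      obtain ⟨c, rfl, hc⟩ := ihx
      exact ⟨r • c, raw_smul _ _, by rw [map_smul, hc, smul_zero]⟩
  ext z
  refine e₀.injective (raw_injective (funext fun y => ?_))
  obtain ⟨p, hp, hzp⟩ := funAlg_le_locPoly (raw_mem z) (φ y)
  obtain ⟨c, rfl, hc⟩ := hpoly p hp
  -- The element `z` is a polynomial only locally, but `ρ z = ρ c` globally. As the pullback of `ρ`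
  -- is `1` at `y`, the value of `D z` there is that of `D c`, which is zero.
  obtain ⟨ρ, hρ1, hρ2⟩ := Mfd.exists_bump hzp
  have h2 : W.fn ρ * z = W.fn ρ * c := by
    refine raw_injective (funext fun x => ?_)
    rw [raw_mul, raw_mul, Pi.mul_apply, Pi.mul_apply]
    by_cases hx : x ∈ tsupport ρ
    · rw [show W.raw z x = W.raw c x from hρ2 hx]
    · simp [raw_fn, fnRaw, image_eq_zero_of_notMem_tsupport hx]
  have h3 := congrArg D h2
  rw [hf, hf, hc, mul_zero] at h3
  have h4 := congrFun (congrArg (fun x => V.raw (e' x)) h3) y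
  simp only [map_mul, raw_mul, Pi.mul_apply, map_zero, raw_zero, Pi.zero_apply] at h4
  have h5 : V.raw (e' (NMfd.pullback F (W.fn ρ))) = V.fnRaw (fun y => ρ (φ y)) := hφ' ρ
  rw [h5, fnRaw, hρ1.self_of_nhds, map_one, one_mul] at h4
  rw [LinearMap.zero_apply, map_zero, raw_zero]
  exact h4

/-- A morphism into a split N-manifold is determined by its values on generators. -/
theorem hom_ext {X : NMfd.{u}} {F G : X ⟶ W.split}
    (hf : ∀ f, NMfd.pullback F (W.fn f) = NMfd.pullback G (W.fn f))
    (hs : ∀ a s, NMfd.pullback F (W.sec a s) = NMfd.pullback G (W.sec a s)) : F = G := by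
  have h := eq_zero_of_generators F
    ((NMfd.pullback F).toLinearMap - (NMfd.pullback G).toLinearMap) (by simp)
    (fun f b => by simp [hf, mul_sub])
    (fun a s => ⟨NMfd.pullback F (W.sec a s), fun b => by simp [hs, mul_sub]⟩)
  refine NMfd.Hom.ext (AlgHom.ext fun c => ?_)
  have h2 := LinearMap.congr_fun h c
  exact sub_eq_zero.1 h2

/-! ### Morphisms into sums of copies of the tangent bundle -/

/-- Semilinearity makes `a I α` at `y` depend only on the covector of `α` at `φ y`. This yields
homomorphisms of fibres, since the fibres of the function algebra are free on the covectors in each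
summand. -/
theorem exists_hom_split {S : Finset (Finset ℕ)} (χ : N.Fun →ₐ[ℝ] V.split.C)
    (hχ : ∀ f, χ f ∈ V.split.deg 0) (a : (copies N S).ι → OneForm N →+ V.split.C)
    (ha : ∀ I α, a I α ∈ V.split.deg I.1.card) (hl : ∀ I f α, a I (f • α) = χ f * a I α) :
    ∃ F : V.split ⟶ (copies N S).split,
      (∀ f, NMfd.pullback F ((copies N S).fn f) = χ f) ∧
      ∀ I α, NMfd.pullback F ((copies N S).sec I α) = a I α := by
  obtain ⟨φ, hφ, hφ'⟩ := exists_base_map χ hχ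
  let h₀ : ∀ (I : (copies N S).ι) (y : M.pt), (N.T (φ y) →ₗ[ℝ] ℝ) →ₗ[ℝ] V.Fib y := fun I y =>
    ∑ q, (LinearMap.applyₗ (R := ℝ) (M := N.T (φ y)) (M₂ := ℝ)
      ((Mfd.frame (φ y)).Y q (φ y))).smulRight (V.raw (a I ((Mfd.frame (φ y)).g q).d) y)
  have hh₀ : ∀ I y β, h₀ I y β = ∑ q, β ((Mfd.frame (φ y)).Y q (φ y)) •
      V.raw (a I ((Mfd.frame (φ y)).g q).d) y := fun I y β => by
    simp [h₀, LinearMap.sum_apply]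
  let h : ∀ (I : (copies N S).ι) (y : M.pt),
      Module.Dual ℝ ((copies N S).V I (φ y)) →ₗ[ℝ] V.Fib y := h₀
  have hsec : ∀ I (α : OneForm N) y, h I y (α.toFun (φ y)) = V.raw (a I α) y := by
    intro I α y
    have h1 := Mfd.tensorial_eq_sum
      (((Pi.evalAddMonoidHom V.Fib y).comp rawHom.toRingHom.toAddMonoidHom).comp (a I))
      (x := φ y) (fun f α => by
        change V.raw (a I (f • α)) y = f (φ y) • V.raw (a I α) y
        rw [hl, raw_mul, Pi.mul_apply, hφ', fnRaw, Algebra.smul_def]) (Mfd.frame (φ y)) α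
    exact (hh₀ _ _ _).trans h1.symm
  have hdeg : ∀ (I : (copies N S).ι) y β, h I y β ∈ V.part y ((copies N S).deg I) := by
    intro I y β
    refine (congrArg (· ∈ _) (hh₀ I y β)).mpr ?_
    exact Submodule.sum_mem _ fun q _ => Submodule.smul_mem _ _ ((ha I _).1 y)
  refine ⟨ofFibHom φ h hdeg hφ fun I α => ?_, fun f => ?_, fun I α => ?_⟩
  · rw [show (fun y => h I y (α.toFun (φ y))) = V.raw (a I α) from funext (hsec I α)]
    exact funAlg_le_locPoly (raw_mem _)
  · refine raw_injective (funext fun y => ?_)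
    rw [raw_ofFibHom, hφ']
    exact AlgHom.commutes _ _
  · refine raw_injective (funext fun y => ?_)
    rw [raw_ofFibHom]
    exact (fibHom_gen _ _ _ _ _ _).trans (hsec I α y)

theorem exists_hom {X : NMfd.{u}} {S : Finset (Finset ℕ)} (χ : N.Fun →ₐ[ℝ] X.C)
    (hχ : ∀ f, χ f ∈ X.deg 0) (a : (copies N S).ι → OneForm N →+ X.C)
    (ha : ∀ I α, a I α ∈ X.deg I.1.card) (hl : ∀ I f α, a I (f • α) = χ f * a I α) :
    ∃ F : X ⟶ (copies N S).split,
      (∀ f, NMfd.pullback F ((copies N S).fn f) = χ f) ∧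
      ∀ I α, NMfd.pullback F ((copies N S).sec I α) = a I α := by
  obtain ⟨M, V, e, he⟩ := X.splits
  let e' : X.C ≃ₐ[ℝ] V.split.C := e
  have he' : ∀ n c, c ∈ X.deg n ↔ e' c ∈ V.split.deg n := he
  obtain ⟨F, hF1, hF2⟩ := exists_hom_split (V := V) (S := S) ((e' : X.C →ₐ[ℝ] V.split.C).comp χ)
    (fun f => (he' _ _).1 (hχ f)) (fun I => (e' : X.C →+ V.split.C).comp (a I))
    (fun I α => (he' _ _).1 (ha I α)) (fun I f α => by
      change e' (a I (f • α)) = e' (χ f) * e' (a I α)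
      rw [hl, map_mul])
  refine ⟨⟨(e'.symm : V.split.C →ₐ[ℝ] X.C).comp (NMfd.pullback F), fun n c hc => ?_⟩,
    fun f => ?_, fun I α => ?_⟩
  · rw [he']
    change e' (e'.symm _) ∈ _
    rw [e'.apply_symm_apply]
    exact NMfd.pullback_mem F hc
  · change e'.symm (NMfd.pullback F _) = _
    rw [hF1]
    exact e'.symm_apply_apply _
  · change e'.symm (NMfd.pullback F _) = _
    rw [hF2]
    exact e'.symm_apply_apply _

/-- In any coordinate frame `A α` has to be `∑ α(Y q) D(g q)`. The frames agree on this value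
because a derivation at a point is determined by its values on coordinates. -/
theorem exists_oneForm_of_derivation_split (χ : N.Fun →ₐ[ℝ] V.split.C)
    (hχ : ∀ f, χ f ∈ V.split.deg 0) (D : N.Fun →ₗ[ℝ] V.split.C) {n : ℕ}
    (hD : ∀ f, D f ∈ V.split.deg n) (hder : ∀ f g, D (f * g) = χ f * D g + χ g * D f) :
    ∃ A : OneForm N →+ V.split.C, (∀ α, A α ∈ V.split.deg n) ∧
      (∀ f α, A (f • α) = χ f * A α) ∧ ∀ f : N.Fun, A f.d = D f := by
  obtain ⟨φ, hφ, hφ'⟩ := exists_base_map χ hχ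
  let Dy : ∀ y, N.Fun →ₗ[ℝ] V.Fib y := fun y =>
    ((LinearMap.proj y).comp rawHom.toLinearMap).comp D
  have hDy : ∀ y f, Dy y f = V.raw (D f) y := fun _ _ => rfl
  have hDy' : ∀ y f g, Dy y (f * g) = f (φ y) • Dy y g + g (φ y) • Dy y f := fun y f g => by
    simp only [hDy, hder, raw_add, raw_mul, Pi.add_apply, Pi.mul_apply, hφ', fnRaw,
      Algebra.smul_def]
  let w : OneForm N → V.Raw := fun α y =>
    ∑ q, α.toFun (φ y) ((Mfd.frame (φ y)).Y q (φ y)) • Dy y ((Mfd.frame (φ y)).g q)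
  have hw : ∀ α, w α ∈ V.smoothPart n := by
    intro α
    refine ⟨fun y => Submodule.sum_mem _ fun q _ => Submodule.smul_mem _ _ ((hD _).1 y), ?_⟩
    refine mem_locPoly_of_eventuallyEq fun y₀ => ?_
    -- In `w α` the frame is chosen separately at each `φ y`, so smoothness is not visible. Near
    -- `y₀` the single frame at `φ y₀` computes the same value.
    let e := Mfd.frame (φ y₀)
    refine ⟨∑ q, V.raw (χ (α.eval (e.smooth_Y q)) * D (e.g q)),
      Subalgebra.sum_mem _ fun q _ => funAlg_le_locPoly (raw_mem _), ?_⟩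
    filter_upwards [hφ.continuous.continuousAt.eventually e.dual] with y hy
    have h1 : ∀ q, V.raw (χ (α.eval (e.smooth_Y q)) * D (e.g q)) y =
        α.toFun (φ y) (e.Y q (φ y)) • ∑ p, Mfd.dif (e.g q) (φ y) ((Mfd.frame (φ y)).Y p (φ y)) •
          Dy y ((Mfd.frame (φ y)).g p) := fun q => by
      rw [← Mfd.derivation_eq_sum (Dy y) (hDy' y) (Mfd.frame (φ y)) (e.g q), raw_mul, Pi.mul_apply,
        hφ', fnRaw, hDy, Algebra.smul_def]
      rfl
    rw [Finset.sum_apply]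
    simp only [h1, Finset.smul_sum, smul_smul]
    rw [Finset.sum_comm]
    refine Finset.sum_congr rfl fun p _ => ?_
    rw [← Finset.sum_smul]
    congr 1
    conv_lhs => rw [e.covector_eq hy.2 (α.toFun (φ y))]
    simp [LinearMap.sum_apply]
  refine ⟨{ toFun := fun α => ofRaw (n := n) (w α) (hw α), map_zero' := ?_, map_add' := ?_ },
    fun α => ofRaw_mem (w α) (hw α), fun f α => ?_, fun f => ?_⟩
  · refine raw_injective (funext fun y => ?_)
    rw [raw_ofRaw, raw_zero]
    exact Finset.sum_eq_zero fun q _ => zero_smul _ _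
  · intro α β
    refine raw_injective (funext fun y => ?_)
    rw [raw_add, raw_ofRaw, raw_ofRaw, raw_ofRaw, Pi.add_apply]
    simp only [w, ← Finset.sum_add_distrib, ← add_smul]
    rfl
  · refine raw_injective (funext fun y => ?_)
    rw [raw_mul, Pi.mul_apply, hφ']
    change w (f • α) y = V.fnRaw (fun y => f (φ y)) y * w α y
    rw [fnRaw, ← Algebra.smul_def]
    simp only [w, Finset.smul_sum, smul_smul]
    rfl
  · refine raw_injective (funext fun y => ?_)
    exact (Mfd.derivation_eq_sum (Dy y) (hDy' y) (Mfd.frame (φ y)) f).symm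

/-- A derivation on `C^∞(N)` factors through the differential. -/
theorem exists_oneForm_of_derivation {X : NMfd.{u}} (χ : N.Fun →ₐ[ℝ] X.C)
    (hχ : ∀ f, χ f ∈ X.deg 0) (D : N.Fun →ₗ[ℝ] X.C) {n : ℕ}
    (hD : ∀ f, D f ∈ X.deg n) (hder : ∀ f g, D (f * g) = χ f * D g + χ g * D f) :
    ∃ A : OneForm N →+ X.C, (∀ α, A α ∈ X.deg n) ∧
      (∀ f α, A (f • α) = χ f * A α) ∧ ∀ f : N.Fun, A f.d = D f := by
  obtain ⟨M, V, e, he⟩ := X.splits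
  let e' : X.C ≃ₐ[ℝ] V.split.C := e
  have he' : ∀ n c, c ∈ X.deg n ↔ e' c ∈ V.split.deg n := he
  obtain ⟨A, h1, h2, h3⟩ := exists_oneForm_of_derivation_split (V := V)
    ((e' : X.C →ₐ[ℝ] V.split.C).comp χ) (fun f => (he' _ _).1 (hχ f))
    ((e' : X.C →ₐ[ℝ] V.split.C).toLinearMap.comp D) (n := n) (fun f => (he' _ _).1 (hD f))
    (fun f g => by
      change e' (D (f * g)) = e' (χ f) * e' (D g) + e' (χ g) * e' (D f)
      rw [hder, map_add, map_mul, map_mul])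
  refine ⟨(e'.symm : V.split.C →+ X.C).comp A, fun α => ?_, fun f α => ?_, fun f => ?_⟩
  · rw [he']
    change e' (e'.symm _) ∈ _
    rw [e'.apply_symm_apply]
    exact h1 α
  · change e'.symm (A (f • α)) = χ f * e'.symm (A α)
    rw [h2, map_mul]
    congr 1
    exact e'.symm_apply_apply _
  · change e'.symm (A f.d) = _
    rw [h3]
    exact e'.symm_apply_apply _

/-- A map on 1-forms which is linear over the functions is determined by its values on
differentials. -/
theorem oneForm_map_ext {X : NMfd.{u}} (χ : N.Fun →ₐ[ℝ] X.C) (hχ : ∀ f, χ f ∈ X.deg 0)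
    {A B : OneForm N →+ X.C} (hA : ∀ f α, A (f • α) = χ f * A α)
    (hB : ∀ f α, B (f • α) = χ f * B α) (h : ∀ f : N.Fun, A f.d = B f.d) : A = B := by
  obtain ⟨M, V, e, he⟩ := X.splits
  let e₀ : X.C ≃ₐ[ℝ] V.split.C := e
  let e' : X.C →ₐ[ℝ] V.split.C := e₀
  have he' : ∀ n c, c ∈ X.deg n ↔ e' c ∈ V.split.deg n := he
  obtain ⟨φ, hφ, hφ'⟩ := exists_base_map (V := V) (e'.comp χ) fun f => (he' 0 _).1 (hχ f)
  ext α
  refine e₀.injective (raw_injective (funext fun y => ?_))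
  have key : ∀ A : OneForm N →+ X.C, (∀ f α, A (f • α) = χ f * A α) → V.raw (e' (A α)) y =
      ∑ q, α.toFun (φ y) ((Mfd.frame (φ y)).Y q (φ y)) •
        V.raw (e' (A ((Mfd.frame (φ y)).g q).d)) y := by
    intro A hA
    refine Mfd.tensorial_eq_sum (((Pi.evalAddMonoidHom V.Fib y).comp
      rawHom.toRingHom.toAddMonoidHom).comp ((e' : X.C →+ V.split.C).comp A)) (x := φ y)
      (fun f α => ?_) (Mfd.frame (φ y)) α
    change V.raw (e' (A (f • α))) y = f (φ y) • V.raw (e' (A α)) y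
    have h5 : V.raw (e' (χ f)) = V.fnRaw (fun y => f (φ y)) := hφ' f
    rw [hA, map_mul, raw_mul, Pi.mul_apply, h5, fnRaw, Algebra.smul_def]
  change V.raw (e' (A α)) y = V.raw (e' (B α)) y
  rw [key A hA, key B hB]
  simp only [h]

end GrBundle

/-! ### Sums of copies of the tangent bundle -/

section Copies

variable {M : Mfd.{u}} {S S' : Finset (Finset ℕ)}

/-- The inclusion of the summand with index `a` into the fibre of the function algebra. -/
def genIdx (a : (copies M S).ι) (x : M.pt) : (M.T x →ₗ[ℝ] ℝ) →ₗ[ℝ] (copies M S).Fib x :=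
  (copies M S).gen a x

/-- The covector `β` in the summand with index `I`, or `0` if there is no such summand. -/
def genAt (M : Mfd.{u}) (S : Finset (Finset ℕ)) (I : Finset ℕ) (x : M.pt) :
    (M.T x →ₗ[ℝ] ℝ) →ₗ[ℝ] (copies M S).Fib x :=
  if h : I ∈ S ∧ I.Nonempty then genIdx ⟨I, h⟩ x else 0

theorem genAt_pos {I : Finset ℕ} (h : I ∈ S ∧ I.Nonempty) (x : M.pt) :
    genAt M S I x = genIdx ⟨I, h⟩ x := dif_pos h

theorem genAt_neg {I : Finset ℕ} (h : ¬ (I ∈ S ∧ I.Nonempty)) (x : M.pt) :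
    genAt M S I x = 0 := dif_neg h

theorem genAt_mem_part (I : Finset ℕ) (x : M.pt) (β : M.T x →ₗ[ℝ] ℝ) :
    genAt M S I x β ∈ (copies M S).part x I.card := by
  by_cases h : I ∈ S ∧ I.Nonempty
  · rw [genAt_pos h]
    exact GSym.gen_mem_part (copies M S).deg (fun a => Module.Dual ℝ ((copies M S).V a x))
      (⟨I, h⟩ : (copies M S).ι) β
  · rw [genAt_neg h]
    exact Submodule.zero_mem _

/-- The 1-form `α` in the summand with index `I`, or `0` if there is no such summand. -/
def secAt (S : Finset (Finset ℕ)) (I : Finset ℕ) (α : OneForm M) : (copies M S).split.C :=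
  if h : I ∈ S ∧ I.Nonempty then (copies M S).sec ⟨I, h⟩ α else 0

theorem secAt_pos {I : Finset ℕ} (h : I ∈ S ∧ I.Nonempty) (α : OneForm M) :
    secAt S I α = (copies M S).sec ⟨I, h⟩ α := dif_pos h

theorem secAt_neg {I : Finset ℕ} (h : ¬ (I ∈ S ∧ I.Nonempty)) (α : OneForm M) :
    secAt S I α = 0 := dif_neg h

theorem raw_secAt (I : Finset ℕ) (α : OneForm M) (x : M.pt) :
    (copies M S).raw (secAt S I α) x = genAt M S I x (α.toFun x) := by
  by_cases h : I ∈ S ∧ I.Nonempty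
  · rw [secAt_pos h, genAt_pos h]
    rfl
  · rw [secAt_neg h, genAt_neg h]
    exact congrFun GrBundle.raw_zero x

theorem secAt_mem (I : Finset ℕ) (α : OneForm M) : secAt S I α ∈ (copies M S).split.deg I.card := by
  by_cases h : I ∈ S ∧ I.Nonempty
  · rw [secAt_pos h]
    exact GrBundle.sec_mem (V := copies M S) ⟨I, h⟩ α
  · rw [secAt_neg h]
    exact Submodule.zero_mem _

theorem secAt_add (I : Finset ℕ) (α β : OneForm M) :
    secAt S I (α + β) = secAt S I α + secAt S I β := by
  refine GrBundle.raw_injective (funext fun x => ?_)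
  rw [GrBundle.raw_add, Pi.add_apply, raw_secAt, raw_secAt, raw_secAt, DualSection.add_toFun,
    map_add]

theorem secAt_smul (I : Finset ℕ) (f : M.Fun) (α : OneForm M) :
    secAt S I (f • α) = (copies M S).fn f * secAt S I α := by
  refine GrBundle.raw_injective (funext fun x => ?_)
  rw [GrBundle.raw_mul, Pi.mul_apply, raw_secAt, raw_secAt, DualSection.smul_toFun, map_smul,
    GrBundle.raw_fn, GrBundle.fnRaw, Algebra.smul_def]

theorem copies_hom_ext {X : NMfd.{u}} {F G : X ⟶ (copies M S).split}
    (hf : ∀ f, NMfd.pullback F ((copies M S).fn f) = NMfd.pullback G ((copies M S).fn f))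
    (hs : ∀ I ∈ S, I.Nonempty → ∀ α, NMfd.pullback F (secAt S I α) = NMfd.pullback G (secAt S I α)) :
    F = G :=
  GrBundle.hom_ext hf fun a α => (congrArg (NMfd.pullback F) (secAt_pos a.2 α)).symm.trans
    ((hs a.1 a.2.1 a.2.2 α).trans (congrArg (NMfd.pullback G) (secAt_pos a.2 α)))

/-- This turns sums over the summands of one degree into sums over finite sets. Since `I` is
nonempty, every `J` of the same cardinality is nonempty too and so indexes a summand. -/
theorem sum_copies_index {A : Type*} [AddCommMonoid A] (r : Finset ℕ → Prop) [DecidablePred r]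
    {I : Finset ℕ} (hI : I.Nonempty) (g : Finset ℕ → A) :
    ∑ a ∈ ((copies M S).finite_deg I.card).toFinset, (if r a.1 then g a.1 else 0) =
      ∑ J ∈ S.filter (fun J => J.card = I.card ∧ r J), g J := by
  rw [← Finset.sum_filter]
  refine Finset.sum_bij (fun a _ => a.1) ?_ ?_ ?_ fun a _ => rfl
  · intro a ha
    rw [Finset.mem_filter, Set.Finite.mem_toFinset] at ha
    exact Finset.mem_filter.2 ⟨a.2.1, ha.1, ha.2⟩
  · intro a _ a' _ h
    exact Subtype.ext h
  · intro J hJ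
    simp only [Finset.mem_filter] at hJ
    refine ⟨⟨J, hJ.1, ?_⟩, ?_, rfl⟩
    · rw [← Finset.card_pos, hJ.2.1]
      exact Finset.card_pos.2 hI
    · exact Finset.mem_filter.2 ⟨(Set.Finite.mem_toFinset _).2 hJ.2.1, hJ.2.2⟩

/-- The bundle map whose components are `1` or `0` according to a relation between the indices. -/
def relMap (M : Mfd.{u}) (S S' : Finset (Finset ℕ)) (r : Finset ℕ → Finset ℕ → Prop)
    [DecidableRel r] (a : (copies M S).ι) (b : (copies M S').ι) (x : M.pt) :
    (copies M S).V a x →ₗ[ℝ] (copies M S').V b x :=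
  if r a.1 b.1 then (LinearMap.id : M.T x →ₗ[ℝ] M.T x) else 0

variable (r : Finset ℕ → Finset ℕ → Prop) [DecidableRel r]

omit [DecidableRel r] in
theorem contMDiff_id_or_zero (P : Prop) [Decidable P] :
    ContMDiff (𝓘(ℝ, M.E).prod 𝓘(ℝ, M.E)) (𝓘(ℝ, M.E).prod 𝓘(ℝ, M.E)) ∞
      (fun v : TotalSpace M.E M.T => (⟨v.proj,
        (if P then (LinearMap.id : M.T v.proj →ₗ[ℝ] M.T v.proj) else 0) v.snd⟩ :
          TotalSpace M.E M.T)) := by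
  by_cases h : P
  · simp only [if_pos h]
    exact contMDiff_id
  · simp only [if_neg h]
    exact (contMDiff_zeroSection ℝ M.T).comp (contMDiff_proj M.T)

theorem relMap_isBundleMap : GrBundle.IsBundleMap id (relMap M S S' r) :=
  ⟨contMDiff_id, fun _ _ _ => contMDiff_id_or_zero _⟩

/-- The morphism of split N-manifolds given by a relation between the indices. -/
def relHom (M : Mfd.{u}) (S S' : Finset (Finset ℕ)) : (copies M S).split ⟶ (copies M S').split :=
  GrBundle.strictHom (relMap_isBundleMap (M := M) (S := S) (S' := S') r)

/-- The homomorphism of fibres given by a relation between the indices. -/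
def relFib (S S' : Finset (Finset ℕ)) (x : M.pt) : (copies M S').Fib x →ₐ[ℝ] (copies M S).Fib x :=
  GrBundle.fibHom id (GrBundle.strictGen id (relMap M S S' r)) (GrBundle.strictGen_mem _ _) x

theorem raw_relHom (c : (copies M S').split.C) (x : M.pt) :
    (copies M S).raw (NMfd.pullback (relHom r M S S') c) x =
      relFib r S S' x ((copies M S').raw c x) := rfl

theorem relFib_genAt {J : Finset ℕ} (hJ : J ∈ S' ∧ J.Nonempty) (x : M.pt) (β : M.T x →ₗ[ℝ] ℝ) :
    relFib r S S' x (genAt M S' J x β) =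
      ∑ I ∈ S.filter (fun I => I.card = J.card ∧ r I J), genAt M S I x β := by
  let b : (copies M S').ι := ⟨J, hJ⟩
  have h1 : relFib r S S' x (genAt M S' b.1 x β) =
      ∑ a ∈ ((copies M S).finite_deg ((copies M S').deg b)).toFinset,
        if r a.1 J then genAt M S a.1 x β else 0 := by
    rw [genAt_pos b.2]
    refine (GrBundle.fibHom_gen _ _ _ _ _ _).trans ?_
    refine (GrBundle.strictGen_apply _ _ _ _ _).trans ?_
    refine Finset.sum_congr rfl fun a _ => ?_
    rw [genAt_pos a.2]
    have h2 : ∀ (P : Prop) [Decidable P], genIdx a x (β.comp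
        (if P then (LinearMap.id : M.T x →ₗ[ℝ] M.T x) else 0)) =
          if P then genIdx a x β else 0 := by
      intro P _
      split_ifs
      · rfl
      · rw [LinearMap.comp_zero, map_zero]
    exact h2 _
  exact h1.trans (sum_copies_index (fun I => r I J) hJ.2 fun I => genAt M S I x β)

theorem relFib_mem_part (x : M.pt) {n : ℕ} {z : (copies M S').Fib x}
    (hz : z ∈ (copies M S').part x n) : relFib r S S' x z ∈ (copies M S).part x n :=
  GrBundle.fibHom_mem_part _ _ (GrBundle.strictGen_mem _ _) _ hz

theorem relFib_mem_locPoly {z : (copies M S').Raw} (hz : z ∈ (copies M S').locPoly) :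
    (fun x => relFib r S S' x (z x)) ∈ (copies M S).locPoly :=
  GrBundle.rawPull_mem_locPoly _ _ (GrBundle.strictGen_mem _ _) contMDiff_id
    (GrBundle.strictGen_mem_locPoly (relMap_isBundleMap r)) hz

omit [DecidableRel r] in
theorem copies_mul_mem_part {x : M.pt} {m n : ℕ} {z w : (copies M S).Fib x}
    (hz : z ∈ (copies M S).part x m) (hw : w ∈ (copies M S).part x n) :
    z * w ∈ (copies M S).part x (m + n) := GSym.mul_mem_part _ _ hz hw

theorem relHom_fn (f : M.Fun) :
    NMfd.pullback (relHom r M S S') ((copies M S').fn f) = (copies M S).fn f :=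
  GrBundle.raw_injective (GrBundle.raw_strictHom_fn (relMap_isBundleMap r) f)

theorem relHom_secAt {J : Finset ℕ} (hJ : J ∈ S' ∧ J.Nonempty) (α : OneForm M) :
    NMfd.pullback (relHom r M S S') (secAt S' J α) =
      ∑ I ∈ S.filter (fun I => I.card = J.card ∧ r I J), secAt S I α := by
  refine GrBundle.raw_injective (funext fun x => ?_)
  rw [raw_relHom, raw_secAt, relFib_genAt r hJ, GrBundle.raw_sum, Finset.sum_apply]
  simp only [raw_secAt]

theorem relHom_isInducedBy_copiesMap :
    GrBundle.IsInducedBy (relHom (· = ·) M S S') id (copiesMap M S S') :=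
  GrBundle.strictHom_isInducedBy _

/-- The element `∑ B(e_p, e_q) φ(e^p) ψ(e^q)`. -/
def quad {x : M.pt} {A : Type*} [Ring A] [Algebra ℝ A] (φ ψ : (M.T x →ₗ[ℝ] ℝ) →ₗ[ℝ] A)
    (B : M.T x →ₗ[ℝ] M.T x →ₗ[ℝ] ℝ) : A :=
  let e : Module.Basis _ ℝ (M.T x) := Module.finBasis ℝ M.E
  ∑ p, ∑ q, B (e p) (e q) • (φ (e.coord p) * ψ (e.coord q))

/-! ### Contraction of a bilinear form with two copies of the cotangent space -/

section Quad

variable {x : M.pt} {A : Type*} [Ring A] [Algebra ℝ A] (φ ψ : (M.T x →ₗ[ℝ] ℝ) →ₗ[ℝ] A)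
    (B : M.T x →ₗ[ℝ] M.T x →ₗ[ℝ] ℝ)

/-- The basis in `quad` is a fixed basis of the model space, carried to each tangent space by the
preferred chart there, and is not a smooth frame. As the contraction is independent of the basis, it
may be computed in a coordinate frame. -/
theorem quad_eq_sum {x₀ : M.pt} (e : Mfd.Frame M x₀)
    (hx : ∀ v : M.T x, v = ∑ q, Mfd.dif (e.g q) x v • e.Y q x) : quad φ ψ B =
      ∑ p, ∑ q, B (e.Y p x) (e.Y q x) • (φ (Mfd.dif (e.g p) x) * ψ (Mfd.dif (e.g q) x)) := by
  let b : Module.Basis _ ℝ (M.T x) := Module.finBasis ℝ M.E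
  have h1 : ∀ χ : (M.T x →ₗ[ℝ] ℝ) →ₗ[ℝ] A, ∀ p, χ (b.coord p) =
      ∑ s, b.coord p (e.Y s x) • χ (Mfd.dif (e.g s) x) := fun χ p => by
    conv_lhs => rw [e.covector_eq hx (b.coord p)]
    simp
  have h2 : ∀ s t, B (e.Y s x) (e.Y t x) =
      ∑ p, ∑ q, b.coord p (e.Y s x) * (b.coord q (e.Y t x) * B (b p) (b q)) := fun s t => by
    conv_lhs => rw [← b.sum_repr (e.Y s x), ← b.sum_repr (e.Y t x)]
    simp only [map_sum, LinearMap.sum_apply, map_smul, LinearMap.smul_apply, smul_eq_mul,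
      Finset.mul_sum, Module.Basis.coord_apply]
    rw [Finset.sum_comm]
    exact Finset.sum_congr rfl fun p _ => Finset.sum_congr rfl fun q _ => mul_left_comm _ _ _
  change ∑ p, ∑ q, B (b p) (b q) • (φ (b.coord p) * ψ (b.coord q)) = _
  simp only [h1 φ, h1 ψ, h2, Finset.sum_mul_sum, Finset.smul_sum, Finset.sum_smul,
    smul_mul_smul_comm, smul_smul]
  calc _ = ∑ p, ∑ q, ∑ s, ∑ t, (B (b p) (b q) * (b.coord p (e.Y s x) * b.coord q (e.Y t x))) •
        (φ (Mfd.dif (e.g s) x) * ψ (Mfd.dif (e.g t) x)) := rfl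
    _ = ∑ s, ∑ t, ∑ p, ∑ q, (B (b p) (b q) * (b.coord p (e.Y s x) * b.coord q (e.Y t x))) •
        (φ (Mfd.dif (e.g s) x) * ψ (Mfd.dif (e.g t) x)) := by
      rw [Finset.sum_congr rfl fun p _ => Finset.sum_comm, Finset.sum_comm]
      refine Finset.sum_congr rfl fun s _ => ?_
      rw [Finset.sum_congr rfl fun p _ => Finset.sum_comm, Finset.sum_comm]
    _ = _ := by
      refine Finset.sum_congr rfl fun s _ => Finset.sum_congr rfl fun t _ =>
        Finset.sum_congr rfl fun p _ => Finset.sum_congr rfl fun q _ => ?_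
      congr 1
      ring

theorem map_quad {A' : Type*} [Ring A'] [Algebra ℝ A'] (h : A →ₐ[ℝ] A') :
    h (quad φ ψ B) = quad (h.toLinearMap.comp φ) (h.toLinearMap.comp ψ) B := by
  simp [quad]

theorem quad_sum_right {κ : Type*} (s : Finset κ) (ψ : κ → (M.T x →ₗ[ℝ] ℝ) →ₗ[ℝ] A) :
    quad φ (∑ i ∈ s, ψ i) B = ∑ i ∈ s, quad φ (ψ i) B := by
  simp only [quad, LinearMap.sum_apply, Finset.mul_sum, Finset.smul_sum]
  rw [Finset.sum_congr rfl fun p _ => Finset.sum_comm, Finset.sum_comm]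

end Quad

theorem quadRaw_apply (a b : (copies M S).ι) (B : ∀ x, M.T x →ₗ[ℝ] M.T x →ₗ[ℝ] ℝ) (x : M.pt) :
    quadRaw a b B x = quad (genAt M S a.1 x) (genAt M S b.1 x) (B x) := by
  rw [genAt_pos a.2, genAt_pos b.2]
  rfl

end Copies

/-! ### The dual connection on 1-forms -/

section Connection

variable {M : Mfd.{u}}

/-- A vector field is smooth. -/
abbrev SmoothField (Y : ∀ x, M.T x) : Prop :=
  ContMDiff 𝓘(ℝ, M.E) (𝓘(ℝ, M.E).prod 𝓘(ℝ, M.E)) ∞ (fun x => (⟨x, Y x⟩ : TotalSpace M.E M.T))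

theorem SmoothField.mdiff {Y : ∀ x, M.T x} (hY : SmoothField Y) (x : M.pt) :
    MDifferentiableAt 𝓘(ℝ, M.E) (𝓘(ℝ, M.E).prod 𝓘(ℝ, M.E))
      (fun x => (⟨x, Y x⟩ : TotalSpace M.E M.T)) x :=
  hY.mdifferentiableAt (by simp)

variable (cov : Connection M)

theorem cov_sum {κ : Type*} (s : Finset κ) (F : κ → M.Fun) {Y : κ → ∀ x, M.T x}
    (hY : ∀ i, SmoothField (Y i)) (x : M.pt) (v : M.T x) :
    cov (fun y => ∑ i ∈ s, F i y • Y i y) x v =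
      ∑ i ∈ s, (F i x • cov (Y i) x v + Mfd.dif (F i) x v • Y i x) := by
  classical
  induction s using Finset.induction_on with
  | empty =>
    have h : (fun y : M.pt => ∑ i ∈ (∅ : Finset κ), F i y • Y i y) = (0 : ∀ y, M.T y) := by
      ext y; simp
    rw [h, cov.zero]
    simp
  | insert a s ha ih =>
    have h : (fun y : M.pt => ∑ i ∈ insert a s, F i y • Y i y) =
        ((F a : M.pt → ℝ) • Y a) + fun y => ∑ i ∈ s, F i y • Y i y := by
      ext y; simp [Finset.sum_insert ha]
    have h1 : ∀ i, SmoothField ((F i : M.pt → ℝ) • Y i) := fun i =>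
      (F i).contMDiff.smul_section (hY i)
    have h2 : SmoothField (fun y => ∑ i ∈ s, F i y • Y i y) :=
      ContMDiff.sum_section fun i _ => h1 i
    rw [h, cov.isCovariantDerivativeOnUniv.add (SmoothField.mdiff (h1 a) x) (h2.mdiff x),
      cov.isCovariantDerivativeOnUniv.leibniz ((hY a).mdiff x) ((F a).mdiff x),
      add_apply, ih, Finset.sum_insert ha]
    rfl

/-- The covariant derivative of a 1-form. -/
def covDual (α : OneForm M) (x : M.pt) : M.T x →ₗ[ℝ] M.T x →ₗ[ℝ] ℝ :=
  let e := Mfd.frame x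
  LinearMap.mk₂ ℝ (fun v w => ∑ q, Mfd.dif (e.g q) x w *
      (Mfd.dif (α.eval (e.smooth_Y q)) x v - α.toFun x (cov (e.Y q) x v)))
    (fun v v' w => by
      rw [← Finset.sum_add_distrib]
      refine Finset.sum_congr rfl fun q _ => ?_
      rw [map_add, map_add, map_add]
      ring)
    (fun r v w => by
      rw [smul_eq_mul, Finset.mul_sum]
      refine Finset.sum_congr rfl fun q _ => ?_
      rw [map_smul, map_smul, map_smul, smul_eq_mul, smul_eq_mul]
      ring)
    (fun v w w' => by
      rw [← Finset.sum_add_distrib]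
      refine Finset.sum_congr rfl fun q _ => ?_
      rw [map_add]
      ring)
    (fun r v w => by
      rw [smul_eq_mul, Finset.mul_sum]
      refine Finset.sum_congr rfl fun q _ => ?_
      rw [map_smul, smul_eq_mul]
      ring)

theorem covDual_apply (α : OneForm M) (x : M.pt) (v w : M.T x) : covDual cov α x v w =
    ∑ q, Mfd.dif ((Mfd.frame x).g q) x w *
      (Mfd.dif (α.eval ((Mfd.frame x).smooth_Y q)) x v -
        α.toFun x (cov ((Mfd.frame x).Y q) x v)) := rfl

/-- Write `Y = ∑ F q • Y q` near `x`. The terms with `dF q` in the derivative of `α(Y)` and in `α(∇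
Y)` cancel; what is left depends only on the value of `Y` at `x` and is the defining sum of
`covDual`. -/
theorem isCovDeriv_covDual (α : OneForm M) : IsCovDeriv cov α (covDual cov α) := by
  intro Y hY x v
  let e := Mfd.frame x
  let F : Fin (Module.finrank ℝ M.E) → M.Fun := fun q => (e.g q).d.eval hY
  have h1 : ∀ᶠ y in 𝓝 x, Y y = ∑ q, F q y • e.Y q y := by
    filter_upwards [e.dual] with y hy using hy.2 (Y y)
  have h2 : SmoothField (fun y => ∑ q, F q y • e.Y q y) :=
    ContMDiff.sum_section fun q _ => (F q).contMDiff.smul_section (e.smooth_Y q)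
  have h3 : cov Y x v = ∑ q, (F q x • cov (e.Y q) x v + Mfd.dif (F q) x v • e.Y q x) := by
    rw [cov.isCovariantDerivativeOnUniv.congr_of_eventuallyEq (SmoothField.mdiff hY x) (h2.mdiff x)
      univ_mem h1, cov_sum cov _ _ e.smooth_Y]
  have h4 : Mfd.dif (α.eval hY) x v = ∑ q, (F q x * Mfd.dif (α.eval (e.smooth_Y q)) x v +
      Mfd.dif (F q) x v * α.toFun x (e.Y q x)) := by
    have h5 : (α.eval hY : M.pt → ℝ) =ᶠ[𝓝 x]
        fun y => ∑ q, F q y * α.eval (e.smooth_Y q) y := by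
      filter_upwards [h1] with y hy
      simp only [DualSection.eval_apply]
      rw [hy, map_sum]
      simp only [map_smul, smul_eq_mul]
    rw [Mfd.dif_congr h5, (Mfd.dif_sum Finset.univ (f := fun q y => F q y * α.eval (e.smooth_Y q) y)
      fun q _ => (F q * α.eval (e.smooth_Y q)).mdiff x).2,
      LinearMap.sum_apply]
    refine Finset.sum_congr rfl fun q _ => ?_
    rw [Mfd.dif_mul ((F q).mdiff x) ((α.eval (e.smooth_Y q)).mdiff x)]
    simp only [LinearMap.add_apply, LinearMap.smul_apply, smul_eq_mul, DualSection.eval_apply]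
    ring
  change _ = Mfd.dif (α.eval hY) x v - _
  rw [h4, h3, map_sum, ← Finset.sum_sub_distrib, covDual_apply]
  refine Finset.sum_congr rfl fun q _ => ?_
  rw [map_add, map_smul, map_smul, smul_eq_mul, smul_eq_mul]
  change F q x * _ = _
  ring

/-- The definition of `covDual` uses a frame chosen at each point, but `isCovDeriv_covDual` rewrites
the function as `Y(α(Z)) - α(∇_Y Z)`, which is smooth. -/
theorem contMDiff_covDual [CovariantDerivative.ContMDiffCovariantDerivative cov ∞] (α : OneForm M)
    {Y Z : ∀ x, M.T x} (hY : SmoothField Y) (hZ : SmoothField Z) :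
    ContMDiff 𝓘(ℝ, M.E) 𝓘(ℝ, ℝ) ∞ (fun x => covDual cov α x (Y x) (Z x)) := by
  have h1 := (CovariantDerivative.ContMDiffCovariantDerivative.contMDiff (cov := cov)
    (k := ∞)).contMDiff (σ := Z) (by simpa using hZ.contMDiffOn)
  rw [contMDiffOn_univ] at h1
  have h2 : SmoothField (fun x => cov Z x (Y x)) := h1.clm_bundle_apply hY
  have h3 : (fun x => covDual cov α x (Y x) (Z x)) =
      fun x => (α.eval hZ).d.eval hY x - α.eval h2 x :=
    funext fun x => isCovDeriv_covDual cov α Z hZ x (Y x)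
  rw [h3]
  exact ((α.eval hZ).d.eval hY).contMDiff.sub (α.eval h2).contMDiff

/-- Near `x₀` the coordinate frame there turns the section into a polynomial with the smooth
coefficients `B(Y p, Y q)`. -/
theorem quad_mem_locPoly {S : Finset (Finset ℕ)} (I J : Finset ℕ)
    {B : ∀ x, M.T x →ₗ[ℝ] M.T x →ₗ[ℝ] ℝ} (hB : ∀ Y Z : ∀ x, M.T x, SmoothField Y → SmoothField Z →
      ContMDiff 𝓘(ℝ, M.E) 𝓘(ℝ, ℝ) ∞ (fun x => B x (Y x) (Z x))) :
    (fun x => quad (genAt M S I x) (genAt M S J x) (B x)) ∈ (copies M S).locPoly := by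
  refine GrBundle.mem_locPoly_of_eventuallyEq fun x₀ => ?_
  let e := Mfd.frame x₀
  let F : ∀ p q, M.Fun := fun p q => ⟨_, hB _ _ (e.smooth_Y p) (e.smooth_Y q)⟩
  refine ⟨(copies M S).raw (∑ p, ∑ q, (copies M S).fn (F p q) *
    (secAt S I (e.g p).d * secAt S J (e.g q).d)), GrBundle.funAlg_le_locPoly (GrBundle.raw_mem _), ?_⟩
  filter_upwards [e.dual] with y hy
  rw [quad_eq_sum _ _ _ e hy.2, GrBundle.raw_sum, Finset.sum_apply]
  refine Finset.sum_congr rfl fun p _ => ?_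
  rw [GrBundle.raw_sum, Finset.sum_apply]
  refine Finset.sum_congr rfl fun q _ => ?_
  rw [GrBundle.raw_mul, GrBundle.raw_mul, Pi.mul_apply, Pi.mul_apply, raw_secAt, raw_secAt,
    GrBundle.raw_fn, GrBundle.fnRaw, ← Algebra.smul_def]
  rfl

end Connection

/-! ### Derivatives of functions of finite rank -/

section HasDer

variable {M : Mfd.{u}} {x₀ : M.pt}

/-- `L` is the derivative at `x₀` of the vector valued function `g`, which near `x₀` takes values in
a finite dimensional subspace. -/
inductive HasDer (x₀ : M.pt) {A : Type u} [AddCommGroup A] [Module ℝ A] :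
    (M.pt → A) → (M.T x₀ →ₗ[ℝ] A) → Prop
  | smul (f : M.Fun) (b : A) : HasDer x₀ (fun y => f y • b) ((Mfd.dif f x₀).smulRight b)
  | add {g g' : M.pt → A} {L L' : M.T x₀ →ₗ[ℝ] A} : HasDer x₀ g L → HasDer x₀ g' L' →
      HasDer x₀ (fun y => g y + g' y) (L + L')
  | congr {g g' : M.pt → A} {L : M.T x₀ →ₗ[ℝ] A} : HasDer x₀ g L → g =ᶠ[𝓝 x₀] g' → HasDer x₀ g' L

namespace HasDer

section Module

variable {A : Type u} [AddCommGroup A] [Module ℝ A] {g g' : M.pt → A} {L L' : M.T x₀ →ₗ[ℝ] A}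

/-- The values of `g` lie in a vector space without topology, so a derivative is tested against
linear functionals, which separate points. -/
theorem comp_dual (h : HasDer x₀ g L) (ξ : A →ₗ[ℝ] ℝ) :
    MDifferentiableAt 𝓘(ℝ, M.E) 𝓘(ℝ, ℝ) (fun y => ξ (g y)) x₀ ∧
      Mfd.dif (fun y => ξ (g y)) x₀ = ξ.comp L := by
  induction h with
  | smul f b =>
    have h1 : (fun y => ξ (f y • b)) = (f * algebraMap ℝ M.Fun (ξ b) : M.Fun) := by
      ext y
      rw [map_smul]
      rfl
    rw [h1]
    refine ⟨Mfd.Fun.mdiff _ _, ?_⟩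
    refine (Mfd.dif_mul (f.mdiff x₀) ((algebraMap ℝ M.Fun (ξ b)).mdiff x₀)).trans ?_
    have h2 : Mfd.dif (algebraMap ℝ M.Fun (ξ b)) x₀ = 0 := Mfd.dif_const _ _
    rw [h2]
    ext v
    simp only [smul_zero, zero_add, LinearMap.smul_apply, LinearMap.comp_apply,
      LinearMap.smulRight_apply, map_smul, smul_eq_mul]
    exact mul_comm _ _
  | add _ _ ih ih' =>
    simp only [map_add]
    refine ⟨ih.1.add ih'.1, ?_⟩
    rw [Mfd.dif_add ih.1 ih'.1, ih.2, ih'.2, LinearMap.comp_add]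
  | congr _ hg ih =>
    have h1 := hg.fun_comp ξ
    exact ⟨ih.1.congr_of_eventuallyEq h1.symm, (Mfd.dif_congr h1.symm).trans ih.2⟩

/-- Otherwise a functional which kills `P` but not `L v` would vanish along `g` near `x₀` and yet
have nonzero derivative. The case `P = ⊥` gives uniqueness of derivatives. -/
theorem mem (h : HasDer x₀ g L) (P : Submodule ℝ A) (hP : ∀ᶠ y in 𝓝 x₀, g y ∈ P) (v : M.T x₀) :
    L v ∈ P := by
  by_contra hv
  obtain ⟨ξ, hξ1, hξ2⟩ := P.exists_dual_map_eq_bot_of_notMem hv inferInstance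
  refine hξ1 ?_
  have h1 : (fun y => ξ (g y)) =ᶠ[𝓝 x₀] fun _ => 0 := by
    filter_upwards [hP] with y hy
    have h2 : ξ (g y) ∈ P.map ξ := Submodule.mem_map_of_mem hy
    rwa [hξ2, Submodule.mem_bot] at h2
  have h3 := (h.comp_dual ξ).2
  rw [Mfd.dif_congr h1, Mfd.dif_const] at h3
  exact (LinearMap.congr_fun h3 v).symm

theorem zero : HasDer x₀ (fun _ => (0 : A)) 0 := by
  have h := HasDer.smul (x₀ := x₀) (1 : M.Fun) (0 : A)
  simpa using h

theorem const_smul (h : HasDer x₀ g L) (r : ℝ) : HasDer x₀ (fun y => r • g y) (r • L) := by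
  induction h with
  | smul f b =>
    have h := HasDer.smul (x₀ := x₀) f (r • b)
    convert h using 1
    · ext y
      rw [smul_comm]
    · ext v
      exact smul_comm _ _ _
  | add _ _ ih ih' =>
    simp only [smul_add]
    exact ih.add ih'
  | congr _ hg ih => exact ih.congr (hg.fun_comp (r • ·))

theorem unique (h : HasDer x₀ g L) (h' : HasDer x₀ g L') : L = L' := by
  ext v
  have h1 := (h.add (h'.const_smul (-1))).mem ⊥ (Eventually.of_forall fun y => by simp) v
  rw [Submodule.mem_bot] at h1
  simpa [sub_eq_zero, ← sub_eq_add_neg] using h1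

theorem sum {κ : Type*} (s : Finset κ) {g : κ → M.pt → A} {L : κ → M.T x₀ →ₗ[ℝ] A}
    (h : ∀ i, HasDer x₀ (g i) (L i)) :
    HasDer x₀ (fun y => ∑ i ∈ s, g i y) (∑ i ∈ s, L i) := by
  classical
  induction s using Finset.induction_on with
  | empty => simpa using HasDer.zero
  | insert a s ha ih =>
    simp only [Finset.sum_insert ha]
    exact (h a).add ih

end Module

theorem mul {A : Type u} [Ring A] [Algebra ℝ A] {g g' : M.pt → A} {L L' : M.T x₀ →ₗ[ℝ] A}
    (h : HasDer x₀ g L) (h' : HasDer x₀ g' L') : HasDer x₀ (fun y => g y * g' y)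
      ((LinearMap.mulRight ℝ (g' x₀)).comp L + (LinearMap.mulLeft ℝ (g x₀)).comp L') := by
  induction h with
  | smul f b =>
    induction h' with
    | smul f' b' =>
      have h := HasDer.smul (x₀ := x₀) (f * f') (b * b')
      convert h using 1
      · ext y
        exact smul_mul_smul_comm _ _ _ _
      · have h1 : Mfd.dif (f * f' : M.Fun) x₀ = f x₀ • Mfd.dif f' x₀ + f' x₀ • Mfd.dif f x₀ :=
          Mfd.dif_mul (f.mdiff x₀) (f'.mdiff x₀)
        rw [h1]
        ext v
        simp [add_smul, smul_smul, mul_comm, add_comm]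
    | add _ _ ih ih' =>
      have h := ih.add ih'
      simp only [← mul_add] at h
      convert h using 1
      ext v
      simp [mul_add]
      abel
    | congr _ hg ih =>
      rw [← hg.self_of_nhds]
      refine ih.congr ?_
      filter_upwards [hg] with y hy
      rw [hy]
  | add _ _ ih ih' =>
    have h := ih.add ih'
    simp only [← add_mul] at h
    convert h using 1
    ext v
    simp [add_mul]
    abel
  | congr _ hg ih =>
    rw [← hg.self_of_nhds]
    refine ih.congr ?_
    filter_upwards [hg] with y hy
    rw [hy]

end HasDer

end HasDer

/-! ### Derivatives of functions on split manifolds in a coordinate frame -/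

section Der

variable {M : Mfd.{u}} {S : Finset (Finset ℕ)}

/-- The transport of covectors which is constant in the coordinate frame at `x₀`. -/
def cotransport (x₀ y : M.pt) : (M.T y →ₗ[ℝ] ℝ) →ₗ[ℝ] (M.T x₀ →ₗ[ℝ] ℝ) :=
  ∑ q, (LinearMap.applyₗ (R := ℝ) (M := M.T y) (M₂ := ℝ) ((Mfd.frame x₀).Y q y)).smulRight
    (Mfd.dif ((Mfd.frame x₀).g q) x₀)

theorem cotransport_apply (x₀ y : M.pt) (β : M.T y →ₗ[ℝ] ℝ) : cotransport x₀ y β =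
    ∑ q, β ((Mfd.frame x₀).Y q y) • Mfd.dif ((Mfd.frame x₀).g q) x₀ := by
  simp [cotransport, LinearMap.sum_apply]

theorem cotransport_self (x₀ : M.pt) (β : M.T x₀ →ₗ[ℝ] ℝ) : cotransport x₀ x₀ β = β := by
  rw [cotransport_apply]
  exact ((Mfd.frame x₀).covector_eq (Mfd.frame x₀).dual_self.2 β).symm

variable (S)

/-- The transport of fibres of the function algebra which is constant in the coordinate frame
at `x₀`. -/
def transport (x₀ y : M.pt) : (copies M S).Fib y →ₐ[ℝ] (copies M S).Fib x₀ :=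
  GSym.lift (U := fun a => Module.Dual ℝ ((copies M S).V a y))
    (fun a => (genIdx a x₀).comp (cotransport x₀ y)) fun a b _ _ =>
      GSym.gen_mul_gen (deg := (copies M S).deg)
        (U := fun a => Module.Dual ℝ ((copies M S).V a x₀)) a b _ _

theorem transport_gen (x₀ y : M.pt) (a : (copies M S).ι) (β : M.T y →ₗ[ℝ] ℝ) :
    transport S x₀ y ((copies M S).gen a y β) = genIdx a x₀ (cotransport x₀ y β) :=
  GSym.lift_gen _ _ _ _

theorem transport_genAt (x₀ y : M.pt) (I : Finset ℕ) (β : M.T y →ₗ[ℝ] ℝ) :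
    transport S x₀ y (genAt M S I y β) = genAt M S I x₀ (cotransport x₀ y β) := by
  by_cases h : I ∈ S ∧ I.Nonempty
  · rw [genAt_pos h, genAt_pos h]
    exact transport_gen S x₀ y _ β
  · rw [genAt_neg h, genAt_neg h]
    exact map_zero _

theorem transport_self (x₀ : M.pt) (z : (copies M S).Fib x₀) : transport S x₀ x₀ z = z := by
  have h : transport S x₀ x₀ = AlgHom.id ℝ _ := GSym.algHom_ext fun a β =>
    (transport_gen S x₀ x₀ a β).trans (congrArg (genIdx a x₀) (cotransport_self x₀ β))
  rw [h]
  rfl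

theorem transport_mem_part (x₀ y : M.pt) {n : ℕ} {z : (copies M S).Fib y}
    (hz : z ∈ (copies M S).part y n) : transport S x₀ y z ∈ (copies M S).part x₀ n := by
  refine GSym.map_mem_part (fun a β => ?_) hz
  have h := transport_gen S x₀ y a β
  refine (congrArg (· ∈ _) h).mpr ?_
  exact GSym.gen_mem_part (copies M S).deg (fun a => Module.Dual ℝ ((copies M S).V a x₀)) a _

variable {S}

theorem hasDer_fn (x₀ : M.pt) (f : M.Fun) :
    HasDer x₀ (fun y => transport S x₀ y ((copies M S).fnRaw f y))
      ((Mfd.dif f x₀).smulRight (1 : (copies M S).Fib x₀)) := by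
  refine (HasDer.smul f _).congr (Eventually.of_forall fun y => ?_)
  change _ = transport S x₀ y (algebraMap ℝ _ (f y))
  rw [AlgHom.commutes, Algebra.algebraMap_eq_smul_one]

theorem hasDer_sec (x₀ : M.pt) (I : Finset ℕ) (α : OneForm M) :
    HasDer x₀ (fun y => transport S x₀ y ((copies M S).raw (secAt S I α) y))
      (∑ q, (Mfd.dif (α.eval ((Mfd.frame x₀).smooth_Y q)) x₀).smulRight
        (genAt M S I x₀ (Mfd.dif ((Mfd.frame x₀).g q) x₀))) := by
  refine (HasDer.sum Finset.univ fun q => HasDer.smul (α.eval ((Mfd.frame x₀).smooth_Y q))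
    (genAt M S I x₀ (Mfd.dif ((Mfd.frame x₀).g q) x₀))).congr (Eventually.of_forall fun y => ?_)
  dsimp only
  rw [raw_secAt, transport_genAt, cotransport_apply, map_sum]
  simp only [map_smul]
  rfl

/-- Since `transport` is a homomorphism of algebras, differentiability passes from generators to
polynomials, and it depends only on the germ. -/
theorem exists_hasDer {z : (copies M S).Raw} (hz : z ∈ (copies M S).locPoly) (x₀ : M.pt) :
    ∃ L, HasDer x₀ (fun y => transport S x₀ y (z y)) L := by
  obtain ⟨p, hp, hzp⟩ := hz x₀
  have key : ∃ L, HasDer x₀ (fun y => transport S x₀ y (p y)) L := by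
    clear hzp
    induction hp using Algebra.adjoin_induction with
    | mem p hp =>
      rcases hp with ⟨f, rfl⟩ | ⟨a, s, rfl⟩
      · exact ⟨_, hasDer_fn x₀ f⟩
      · refine ⟨_, (hasDer_sec (S := S) x₀ a.1 s).congr (Eventually.of_forall fun y => ?_)⟩
        exact congrArg (fun c => transport S x₀ y ((copies M S).raw c y)) (secAt_pos a.2 s)
    | algebraMap r =>
      refine ⟨_, (hasDer_fn x₀ (algebraMap ℝ M.Fun r)).congr (Eventually.of_forall fun y => ?_)⟩
      have h : algebraMap ℝ M.Fun r y = r := by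
        rw [Algebra.algebraMap_eq_smul_one]
        exact mul_one r
      exact congrArg (fun r => transport S x₀ y (algebraMap ℝ _ r)) h
    | add p q _ _ hp hq =>
      obtain ⟨L, hL⟩ := hp
      obtain ⟨L', hL'⟩ := hq
      refine ⟨_, (hL.add hL').congr (Eventually.of_forall fun y => ?_)⟩
      exact (map_add _ _ _).symm
    | mul p q _ _ hp hq =>
      obtain ⟨L, hL⟩ := hp
      obtain ⟨L', hL'⟩ := hq
      refine ⟨_, (hL.mul hL').congr (Eventually.of_forall fun y => ?_)⟩
      exact (map_mul _ _ _).symm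
  obtain ⟨L, hL⟩ := key
  refine ⟨L, hL.congr ?_⟩
  filter_upwards [hzp] with y hy
  rw [hy]

open Classical in
/-- The derivative at `x₀` of a section in the coordinate frame at `x₀`. -/
def der (z : (copies M S).Raw) (x₀ : M.pt) : M.T x₀ →ₗ[ℝ] (copies M S).Fib x₀ :=
  if h : ∃ L, HasDer x₀ (fun y => transport S x₀ y (z y)) L then h.choose else 0

theorem HasDer.der_eq {z : (copies M S).Raw} {x₀ : M.pt} {L : M.T x₀ →ₗ[ℝ] (copies M S).Fib x₀}
    (h : HasDer x₀ (fun y => transport S x₀ y (z y)) L) : der z x₀ = L := by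
  have h' : ∃ L, HasDer x₀ (fun y => transport S x₀ y (z y)) L := ⟨L, h⟩
  rw [der, dif_pos h']
  exact h'.choose_spec.unique h

theorem hasDer_der {z : (copies M S).Raw} (hz : z ∈ (copies M S).locPoly) (x₀ : M.pt) :
    HasDer x₀ (fun y => transport S x₀ y (z y)) (der z x₀) := by
  obtain ⟨L, hL⟩ := exists_hasDer hz x₀
  rwa [hL.der_eq]

theorem der_add {z w : (copies M S).Raw} (hz : z ∈ (copies M S).locPoly)
    (hw : w ∈ (copies M S).locPoly) (x₀ : M.pt) : der (z + w) x₀ = der z x₀ + der w x₀ :=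
  HasDer.der_eq (((hasDer_der hz x₀).add (hasDer_der hw x₀)).congr
    (Eventually.of_forall fun _ => (map_add _ _ _).symm))

theorem der_smul (r : ℝ) {z : (copies M S).Raw} (hz : z ∈ (copies M S).locPoly) (x₀ : M.pt) :
    der (r • z) x₀ = r • der z x₀ :=
  HasDer.der_eq (((hasDer_der hz x₀).const_smul r).congr
    (Eventually.of_forall fun _ => (map_smul (transport S x₀ _) _ _).symm))

theorem der_mul {z w : (copies M S).Raw} (hz : z ∈ (copies M S).locPoly)
    (hw : w ∈ (copies M S).locPoly) (x₀ : M.pt) (v : M.T x₀) :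
    der (z * w) x₀ v = der z x₀ v * w x₀ + z x₀ * der w x₀ v := by
  have h : der (z * w) x₀ = _ := HasDer.der_eq
    (((hasDer_der hz x₀).mul (hasDer_der hw x₀)).congr
      (Eventually.of_forall fun _ => (map_mul _ _ _).symm))
  rw [h, transport_self, transport_self]
  rfl

theorem der_congr {z w : (copies M S).Raw} (hz : z ∈ (copies M S).locPoly) {x₀ : M.pt}
    (h : ∀ᶠ y in 𝓝 x₀, z y = w y) : der w x₀ = der z x₀ :=
  HasDer.der_eq ((hasDer_der hz x₀).congr (by filter_upwards [h] with y hy; rw [hy]))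

theorem der_mem_part {z : (copies M S).Raw} (hz : z ∈ (copies M S).locPoly) {n : ℕ}
    (hn : ∀ y, z y ∈ (copies M S).part y n) (x₀ : M.pt) (v : M.T x₀) :
    der z x₀ v ∈ (copies M S).part x₀ n :=
  (hasDer_der hz x₀).mem _ (Eventually.of_forall fun y => transport_mem_part S x₀ y (hn y)) v

end Der

/-! ### The derivation determined by a connection -/

section Delta

variable {M : Mfd.{u}} (cov : Connection M) (l : ℕ)

/-- The subsets of `{1, …, l}`. -/
abbrev subsets (l : ℕ) : Finset (Finset ℕ) := (Finset.Icc 1 l).powerset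

theorem subsets_subset : subsets l ⊆ subsets (l + 1) :=
  Finset.powerset_mono.2 (Finset.Icc_subset_Icc_right (Nat.le_succ l))

variable {l} in
theorem notMem_of_mem_subsets {I : Finset ℕ} (hI : I ∈ subsets l) : l + 1 ∉ I := fun h => by
  have := Finset.mem_Icc.1 (Finset.mem_powerset.1 hI h)
  omega

variable {l} in
theorem insert_mem_subsets {I : Finset ℕ} (hI : I ∈ subsets l) :
    insert (l + 1) I ∈ subsets (l + 1) :=
  Finset.mem_powerset.2 (Finset.insert_subset (by simp)
    (Finset.mem_powerset.1 (subsets_subset l hI)))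

/-- The inclusion of the fibres of the function algebras of iterated tangent bundles. -/
def inclFib (x : M.pt) : (tanBundle M l).Fib x →ₐ[ℝ] (tanBundle M (l + 1)).Fib x :=
  relFib (M := M) (· = ·) (subsets (l + 1)) (subsets l) x

/-- The projection of iterated tangent bundles. -/
def inclHom (M : Mfd.{u}) (l : ℕ) : tan M (l + 1) ⟶ tan M l :=
  relHom (· = ·) M (subsets (l + 1)) (subsets l)

theorem raw_inclHom (c : (tan M l).C) (x : M.pt) :
    (tanBundle M (l + 1)).raw (NMfd.pullback (inclHom M l) c) x =
      inclFib l x ((tanBundle M l).raw c x) := rfl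

theorem inclFib_genAt {I : Finset ℕ} (hI : I ∈ subsets l) (x : M.pt) (β : M.T x →ₗ[ℝ] ℝ) :
    inclFib l x (genAt M (subsets l) I x β) = genAt M (subsets (l + 1)) I x β := by
  by_cases h : I.Nonempty
  · refine (relFib_genAt (· = ·) ⟨hI, h⟩ x β).trans ?_
    have h1 : (subsets (l + 1)).filter (fun J => J.card = I.card ∧ J = I) = {I} := by
      ext J
      simp only [Finset.mem_filter, Finset.mem_singleton]
      refine ⟨fun h => h.2.2, ?_⟩
      rintro rfl
      exact ⟨subsets_subset l hI, rfl, rfl⟩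
    rw [h1, Finset.sum_singleton]
  · rw [genAt_neg fun h' => h h'.2, genAt_neg fun h' => h h'.2]
    exact map_zero _

theorem inclHom_secAt {I : Finset ℕ} (hI : I ∈ subsets l) (α : OneForm M) :
    NMfd.pullback (inclHom M l) (secAt (subsets l) I α) = secAt (subsets (l + 1)) I α :=
  GrBundle.raw_injective (funext fun x => by
    rw [raw_inclHom, raw_secAt, inclFib_genAt l hI, raw_secAt])

theorem inclHom_fn (f : M.Fun) :
    NMfd.pullback (inclHom M l) ((tanBundle M l).fn f) = (tanBundle M (l + 1)).fn f :=
  relHom_fn _ _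

theorem inclFib_mem_part (x : M.pt) {n : ℕ} {z : (tanBundle M l).Fib x}
    (hz : z ∈ (tanBundle M l).part x n) : inclFib l x z ∈ (tanBundle M (l + 1)).part x n :=
  relFib_mem_part _ x hz

/-- The vertical part of the derivation, on generators. -/
def vertGen (I : Finset ℕ) (x : M.pt) :
    (M.T x →ₗ[ℝ] ℝ) →ₗ[ℝ] (tanBundle M (l + 1)).Fib x :=
  genAt M (subsets (l + 1)) (insert (l + 1) I) x - ∑ p, ∑ q,
    (LinearMap.applyₗ (R := ℝ) (M := M.T x) (M₂ := ℝ)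
      (cov ((Mfd.frame x).Y q) x ((Mfd.frame x).Y p x))).smulRight
    (genAt M (subsets (l + 1)) {l + 1} x (Mfd.dif ((Mfd.frame x).g p) x) *
      genAt M (subsets (l + 1)) I x (Mfd.dif ((Mfd.frame x).g q) x))

theorem vertGen_apply (I : Finset ℕ) (x : M.pt) (β : M.T x →ₗ[ℝ] ℝ) : vertGen cov l I x β =
    genAt M (subsets (l + 1)) (insert (l + 1) I) x β - ∑ p, ∑ q,
      β (cov ((Mfd.frame x).Y q) x ((Mfd.frame x).Y p x)) •
      (genAt M (subsets (l + 1)) {l + 1} x (Mfd.dif ((Mfd.frame x).g p) x) *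
        genAt M (subsets (l + 1)) I x (Mfd.dif ((Mfd.frame x).g q) x)) := by
  simp [vertGen, LinearMap.sum_apply]

theorem vertGen_mem_part {I : Finset ℕ} (hI : I ∈ subsets l) (x : M.pt) (β : M.T x →ₗ[ℝ] ℝ) :
    vertGen cov l I x β ∈ (tanBundle M (l + 1)).part x (I.card + 1) := by
  rw [vertGen_apply]
  refine Submodule.sub_mem _ ?_ (Submodule.sum_mem _ fun p _ => Submodule.sum_mem _ fun q _ =>
    Submodule.smul_mem _ _ ?_)
  · rw [← Finset.card_insert_of_notMem (notMem_of_mem_subsets hI)]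
    exact genAt_mem_part _ x β
  · have h := copies_mul_mem_part (genAt_mem_part (S := subsets (l + 1)) {l + 1} x
      (Mfd.dif ((Mfd.frame x).g p) x)) (genAt_mem_part (S := subsets (l + 1)) I x
      (Mfd.dif ((Mfd.frame x).g q) x))
    rwa [Finset.card_singleton, Nat.add_comm 1] at h

/-- The vertical part of the derivation. -/
def vert (x : M.pt) : (tanBundle M l).Fib x →ₗ[ℝ] (tanBundle M (l + 1)).Fib x :=
  GSym.oddDer (inclFib l x)
    (fun a v => inclFib_mem_part l x (GSym.gen_mem_part (tanBundle M l).deg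
      (fun a => Module.Dual ℝ ((tanBundle M l).V a x)) a v))
    (fun a => vertGen cov l a.1 x) (fun a β => vertGen_mem_part cov l a.2.1 x β)

theorem vert_genAt {I : Finset ℕ} (hI : I ∈ subsets l ∧ I.Nonempty) (x : M.pt)
    (β : M.T x →ₗ[ℝ] ℝ) : vert cov l x (genAt M (subsets l) I x β) = vertGen cov l I x β := by
  rw [genAt_pos hI]
  exact GSym.oddDer_gen _ _ _ _ _ _

/-- The derivation of degree `1` determined by a connection, on sections. -/
def deltaRaw (z : (tanBundle M l).Raw) : (tanBundle M (l + 1)).Raw := fun x =>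
  ∑ p, genAt M (subsets (l + 1)) {l + 1} x (Mfd.dif ((Mfd.frame x).g p) x) *
    inclFib l x (der z x ((Mfd.frame x).Y p x)) + vert cov l x (z x)

section Raw

variable {l} {z w : (tanBundle M l).Raw}

theorem deltaRaw_add (hz : z ∈ (tanBundle M l).locPoly) (hw : w ∈ (tanBundle M l).locPoly) :
    deltaRaw cov l (z + w) = deltaRaw cov l z + deltaRaw cov l w := by
  ext x
  simp only [deltaRaw, der_add hz hw, Pi.add_apply, LinearMap.add_apply, map_add, mul_add,
    Finset.sum_add_distrib]
  abel

theorem deltaRaw_smul (r : ℝ) (hz : z ∈ (tanBundle M l).locPoly) :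
    deltaRaw cov l (r • z) = r • deltaRaw cov l z := by
  ext x
  simp only [deltaRaw, der_smul r hz, Pi.smul_apply, LinearMap.smul_apply, map_smul,
    mul_smul_comm, Finset.smul_sum, smul_add]

theorem deltaRaw_mul {n : ℕ} (hz : z ∈ (tanBundle M l).smoothPart n)
    (hw : w ∈ (tanBundle M l).locPoly) (x : M.pt) :
    deltaRaw cov l (z * w) x = deltaRaw cov l z x * inclFib l x (w x) +
      (-1 : ℝ) ^ n • (inclFib l x (z x) * deltaRaw cov l w x) := by
  -- A covector in the new summand `{l + 1}` is odd; moving it past `z x` of degree `n` gives the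
  -- sign of the Leibniz rule.
  have h1 : ∀ β : M.T x →ₗ[ℝ] ℝ, genAt M (subsets (l + 1)) {l + 1} x β * inclFib l x (z x) =
      (-1 : ℝ) ^ n • (inclFib l x (z x) * genAt M (subsets (l + 1)) {l + 1} x β) := fun β => by
    have h := GSym.part_mul_comm (genAt_mem_part (S := subsets (l + 1)) {l + 1} x β)
      (inclFib_mem_part l x (hz.1 x))
    rwa [Finset.card_singleton, one_mul] at h
  have h2 : vert cov l x (z x * w x) = vert cov l x (z x) * inclFib l x (w x) +
      (-1 : ℝ) ^ n • (inclFib l x (z x) * vert cov l x (w x)) :=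
    GSym.oddDer_mul _ _ _ _ (hz.1 x) (w x)
  simp only [deltaRaw, der_mul hz.2 hw, Pi.mul_apply, map_add, map_mul, mul_add, h2, add_mul,
    Finset.sum_add_distrib, Finset.sum_mul, Finset.mul_sum, smul_add, Finset.smul_sum]
  simp only [← mul_assoc, h1, smul_mul_assoc]
  abel

theorem deltaRaw_mem_part {n : ℕ} (hz : z ∈ (tanBundle M l).smoothPart n) (x : M.pt) :
    deltaRaw cov l z x ∈ (tanBundle M (l + 1)).part x (n + 1) := by
  refine Submodule.add_mem _ (Submodule.sum_mem _ fun p _ => ?_) (GSym.oddDer_mem_part _ _ _ _ (hz.1 x))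
  have h := copies_mul_mem_part (genAt_mem_part (S := subsets (l + 1)) {l + 1} x
    (Mfd.dif ((Mfd.frame x).g p) x))
    (inclFib_mem_part l x (der_mem_part hz.2 hz.1 x ((Mfd.frame x).Y p x)))
  rwa [Finset.card_singleton, Nat.add_comm 1] at h

theorem deltaRaw_congr (hz : z ∈ (tanBundle M l).locPoly) {x : M.pt}
    (h : ∀ᶠ y in 𝓝 x, z y = w y) : deltaRaw cov l w x = deltaRaw cov l z x := by
  simp only [deltaRaw, der_congr hz h, h.self_of_nhds]

theorem deltaRaw_fn (f : M.Fun) (x : M.pt) : deltaRaw cov l ((tanBundle M l).fnRaw f) x =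
    genAt M (subsets (l + 1)) {l + 1} x (Mfd.dif f x) := by
  have h1 : vert cov l x ((tanBundle M l).fnRaw f x) = 0 := GSym.oddDer_algebraMap _ _ _ _ _
  rw [deltaRaw, h1, add_zero, (hasDer_fn x f).der_eq]
  conv_rhs => rw [(Mfd.frame x).covector_eq (Mfd.frame x).dual_self.2 (Mfd.dif f x), map_sum]
  refine Finset.sum_congr rfl fun p _ => ?_
  rw [LinearMap.smulRight_apply, map_smul, map_one, mul_smul_comm, mul_one, map_smul]

omit cov z w in
theorem sum_mul_sum_add_sub {κ A : Type*} [Fintype κ] [Ring A] [Algebra ℝ A] (a b : κ → A)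
    (c d : κ → κ → ℝ) (g : A) : ∑ p, a p * ∑ q, d p q • b q + (g - ∑ p, ∑ q, c p q • (a p * b q)) =
      g + ∑ p, ∑ q, (d p q - c p q) • (a p * b q) := by
  simp only [sub_smul, Finset.sum_sub_distrib, Finset.mul_sum, mul_smul_comm]
  abel

/-- The horizontal part differentiates the coefficients `α(Y q)` and the vertical part subtracts
`α(∇_{Y p} Y q)`. Together these are the matrix entries of `∇α`, so the auxiliary frame disappears.
-/
theorem deltaRaw_sec {I : Finset ℕ} (hI : I ∈ subsets l ∧ I.Nonempty) (α : OneForm M) (x : M.pt) :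
    deltaRaw cov l ((tanBundle M l).raw (secAt (subsets l) I α)) x =
      genAt M (subsets (l + 1)) (insert (l + 1) I) x (α.toFun x) +
      quad (genAt M (subsets (l + 1)) {l + 1} x) (genAt M (subsets (l + 1)) I x)
        (covDual cov α x) := by
  rw [deltaRaw, (hasDer_sec x I α).der_eq, raw_secAt, vert_genAt cov l hI, vertGen_apply,
    quad_eq_sum _ _ _ (Mfd.frame x) (Mfd.frame x).dual_self.2]
  have h1 : ∀ p q, covDual cov α x ((Mfd.frame x).Y p x) ((Mfd.frame x).Y q x) =
      Mfd.dif (α.eval ((Mfd.frame x).smooth_Y q)) x ((Mfd.frame x).Y p x) -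
        α.toFun x (cov ((Mfd.frame x).Y q) x ((Mfd.frame x).Y p x)) := fun p q =>
    isCovDeriv_covDual cov α _ ((Mfd.frame x).smooth_Y q) x _
  simp only [h1, LinearMap.sum_apply, LinearMap.smulRight_apply, map_sum, map_smul,
    inclFib_genAt l hI.1]
  exact sum_mul_sum_add_sub _ _ _ _ _

variable [CovariantDerivative.ContMDiffCovariantDerivative cov ∞]

/-- As `deltaRaw` uses a frame chosen at each point, its smoothness is checked on functions and
1-forms, where `deltaRaw_fn` and `deltaRaw_sec` give formulas without frames. The Leibniz rule
extends this to polynomials. -/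
theorem deltaRaw_mem_locPoly (hz : z ∈ (tanBundle M l).locPoly) :
    deltaRaw cov l z ∈ (tanBundle M (l + 1)).locPoly := by
  have hj : ∀ p ∈ (tanBundle M l).locPoly,
      (fun x => inclFib l x (p x)) ∈ (tanBundle M (l + 1)).locPoly := fun p hp =>
    relFib_mem_locPoly _ hp
  have hsec : ∀ (I : Finset ℕ) (hI : I ∈ subsets l ∧ I.Nonempty) (α : OneForm M),
      deltaRaw cov l ((tanBundle M l).raw ((tanBundle M l).sec ⟨I, hI⟩ α)) ∈
        (tanBundle M (l + 1)).locPoly := by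
    intro I hI α
    have h : deltaRaw cov l ((tanBundle M l).raw (secAt (subsets l) I α)) =
        (tanBundle M (l + 1)).raw (secAt (subsets (l + 1)) (insert (l + 1) I) α) +
        fun x => quad (genAt M (subsets (l + 1)) {l + 1} x)
          (genAt M (subsets (l + 1)) I x) (covDual cov α x) := by
      ext x
      rw [deltaRaw_sec cov hI, Pi.add_apply, raw_secAt]
    rw [secAt_pos hI] at h
    rw [h]
    exact Subalgebra.add_mem _ (GrBundle.funAlg_le_locPoly (GrBundle.raw_mem _))
      (quad_mem_locPoly _ _ fun Y Z hY hZ => contMDiff_covDual cov α hY hZ)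
  have key : ∀ p ∈ (tanBundle M l).poly, p ∈ (tanBundle M l).locPoly ∧
      deltaRaw cov l p ∈ (tanBundle M (l + 1)).locPoly := by
    intro p hp
    have hp' : p ∈ Subalgebra.toSubmodule (tanBundle M l).poly := hp
    clear hp
    rw [GrBundle.poly, Algebra.adjoin_eq_span] at hp'
    induction hp' using Submodule.span_induction with
    | mem x hx =>
      induction hx using Submonoid.closure_induction_left with
      | one =>
        have h : deltaRaw cov l (1 : (tanBundle M l).Raw) = 0 := by
          have h1 : (1 : (tanBundle M l).Raw) = (tanBundle M l).fnRaw (1 : M.Fun) := by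
            ext y
            exact (map_one (algebraMap ℝ _)).symm
          rw [h1]
          ext x
          rw [deltaRaw_fn]
          have h2 : Mfd.dif (1 : M.Fun) x = 0 := Mfd.dif_const _ _
          rw [h2, map_zero]
          rfl
        rw [h]
        exact ⟨Subalgebra.one_mem _, Subalgebra.zero_mem _⟩
      | mul_left x hx y hy ih =>
        have hx' : ∃ n, x ∈ (tanBundle M l).smoothPart n ∧
            deltaRaw cov l x ∈ (tanBundle M (l + 1)).locPoly := by
          rcases hx with ⟨f, rfl⟩ | ⟨a, s, rfl⟩
          · refine ⟨0, (tanBundle M l).fnRaw_mem f, ?_⟩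
            have h : deltaRaw cov l ((tanBundle M l).fnRaw f) =
                (tanBundle M (l + 1)).raw (secAt (subsets (l + 1)) {l + 1} f.d) :=
              funext fun x => by rw [deltaRaw_fn, raw_secAt]; rfl
            rw [h]
            exact GrBundle.funAlg_le_locPoly (GrBundle.raw_mem _)
          · refine ⟨_, (tanBundle M l).secRaw_mem a s, ?_⟩
            exact hsec a.1 a.2 s
        obtain ⟨n, hx1, hx2⟩ := hx'
        have h : deltaRaw cov l (x * y) = deltaRaw cov l x * (fun z => inclFib l z (y z)) +
            (-1 : ℝ) ^ n • ((fun z => inclFib l z (x z)) * deltaRaw cov l y) :=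
          funext fun z => deltaRaw_mul cov hx1 ih.1 z
        rw [h]
        exact ⟨Subalgebra.mul_mem _ hx1.2 ih.1,
          Subalgebra.add_mem _ (Subalgebra.mul_mem _ hx2 (hj y ih.1))
          (Subalgebra.smul_mem _ (Subalgebra.mul_mem _ (hj x hx1.2) ih.2) _)⟩
    | zero =>
      have h := deltaRaw_smul cov 0 (z := (0 : (tanBundle M l).Raw)) (Subalgebra.zero_mem _)
      rw [zero_smul, zero_smul] at h
      rw [h]
      exact ⟨Subalgebra.zero_mem _, Subalgebra.zero_mem _⟩
    | add x y hx hy ihx ihy =>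
      rw [deltaRaw_add cov ihx.1 ihy.1]
      exact ⟨Subalgebra.add_mem _ ihx.1 ihy.1, Subalgebra.add_mem _ ihx.2 ihy.2⟩
    | smul r x hx ihx =>
      rw [deltaRaw_smul cov r ihx.1]
      exact ⟨Subalgebra.smul_mem _ ihx.1 r, Subalgebra.smul_mem _ ihx.2 r⟩
  refine GrBundle.mem_locPoly_of_eventuallyEq fun x₀ => ?_
  obtain ⟨p, hp, hzp⟩ := hz x₀
  refine ⟨_, (key p hp).2, ?_⟩
  filter_upwards [hzp.eventually_nhds] with y hy
  exact (deltaRaw_congr cov hz hy).symm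

theorem deltaRaw_mem_smoothPart {n : ℕ} (hz : z ∈ (tanBundle M l).smoothPart n) :
    deltaRaw cov l z ∈ (tanBundle M (l + 1)).smoothPart (n + 1) :=
  ⟨deltaRaw_mem_part cov hz, deltaRaw_mem_locPoly cov hz.2⟩

theorem deltaRaw_mem_funAlg (hz : z ∈ (tanBundle M l).funAlg) :
    deltaRaw cov l z ∈ (tanBundle M (l + 1)).funAlg := by
  have hz' : z ∈ ⨆ n, (tanBundle M l).smoothPart n := hz
  have h : z ∈ (tanBundle M l).locPoly ∧ deltaRaw cov l z ∈ (tanBundle M (l + 1)).funAlg := by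
    induction hz' using Submodule.iSup_induction' with
    | mem n x hx =>
      exact ⟨hx.2, GrBundle.smoothPart_le _ _ (deltaRaw_mem_smoothPart cov hx)⟩
    | zero =>
      exact ⟨Subalgebra.zero_mem _, GrBundle.smoothPart_le _ _ (deltaRaw_mem_smoothPart cov
        (Submodule.zero_mem ((tanBundle M l).smoothPart 0)))⟩
    | add x y _ _ hx hy =>
      obtain ⟨hx1, hx2⟩ := hx (by assumption)
      obtain ⟨hy1, hy2⟩ := hy (by assumption)
      refine ⟨Subalgebra.add_mem _ hx1 hy1, ?_⟩
      rw [deltaRaw_add cov hx1 hy1]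
      exact Subalgebra.add_mem _ hx2 hy2
  exact h.2

end Raw

variable [CovariantDerivative.ContMDiffCovariantDerivative cov ∞]

/-- The derivation of degree `1` over the projection of iterated tangent bundles which is determined
by a connection. -/
def delta : (tan M l).C →ₗ[ℝ] (tan M (l + 1)).C where
  toFun c := (⟨deltaRaw cov l ((tanBundle M l).raw c),
    deltaRaw_mem_funAlg cov (GrBundle.raw_mem c)⟩ : (tanBundle M (l + 1)).funAlg)
  map_add' c d := by
    have h : deltaRaw cov l ((tanBundle M l).raw (c + d)) =
        deltaRaw cov l ((tanBundle M l).raw c) + deltaRaw cov l ((tanBundle M l).raw d) := by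
      rw [GrBundle.raw_add]
      exact deltaRaw_add cov (GrBundle.funAlg_le_locPoly (GrBundle.raw_mem c))
        (GrBundle.funAlg_le_locPoly (GrBundle.raw_mem d))
    exact GrBundle.raw_injective h
  map_smul' r c := by
    have h : deltaRaw cov l ((tanBundle M l).raw (r • c)) =
        r • deltaRaw cov l ((tanBundle M l).raw c) := by
      rw [GrBundle.raw_smul]
      exact deltaRaw_smul cov r (GrBundle.funAlg_le_locPoly (GrBundle.raw_mem c))
    exact GrBundle.raw_injective h

theorem raw_delta (c : (tan M l).C) :
    (tanBundle M (l + 1)).raw (delta cov l c) = deltaRaw cov l ((tanBundle M l).raw c) := rfl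

variable {l}

theorem delta_mem {n : ℕ} {c : (tan M l).C} (hc : c ∈ (tan M l).deg n) :
    delta cov l c ∈ (tan M (l + 1)).deg (n + 1) := deltaRaw_mem_smoothPart cov hc

theorem delta_mul {n : ℕ} {c : (tan M l).C} (hc : c ∈ (tan M l).deg n) (d : (tan M l).C) :
    delta cov l (c * d) = delta cov l c * NMfd.pullback (inclHom M l) d +
      (-1 : ℝ) ^ n • (NMfd.pullback (inclHom M l) c * delta cov l d) := by
  refine GrBundle.raw_injective (funext fun x => ?_)
  have hc' : (tanBundle M l).raw c ∈ (tanBundle M l).smoothPart n := hc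
  rw [raw_delta, GrBundle.raw_mul, deltaRaw_mul cov hc' (GrBundle.funAlg_le_locPoly
    (GrBundle.raw_mem d)), GrBundle.raw_add, GrBundle.raw_smul, GrBundle.raw_mul, GrBundle.raw_mul]
  rfl

theorem delta_fn (f : M.Fun) :
    delta cov l ((tanBundle M l).fn f) = secAt (subsets (l + 1)) {l + 1} f.d := by
  refine GrBundle.raw_injective (funext fun x => ?_)
  rw [raw_delta, GrBundle.raw_fn, deltaRaw_fn, raw_secAt]
  rfl

theorem raw_delta_secAt {I : Finset ℕ} (hI : I ∈ subsets l ∧ I.Nonempty) (α : OneForm M)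
    (x : M.pt) : (tanBundle M (l + 1)).raw (delta cov l (secAt (subsets l) I α)) x =
      genAt M (subsets (l + 1)) (insert (l + 1) I) x (α.toFun x) +
      quad (genAt M (subsets (l + 1)) {l + 1} x) (genAt M (subsets (l + 1)) I x)
        (covDual cov α x) :=
  deltaRaw_sec cov hI α x

theorem delta_one : delta cov l 1 = 0 := by
  have h1 : (1 : (tan M l).C) ∈ (tan M l).deg 0 := by
    rw [← map_one (GrBundle.fnHom (V := tanBundle M l))]
    exact GrBundle.fn_mem (V := tanBundle M l) 1
  have h := delta_mul cov h1 1
  rw [mul_one, map_one (NMfd.pullback _), mul_one, one_mul, pow_zero, one_smul] at h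
  exact left_eq_add.1 h

end Delta

/-! ### The universal points determined by a connection -/

section Points

/-- The number of inversions which sort `ε_A ε_B`. -/
abbrev inv (A B : Finset ℕ) : ℕ := ((A ×ˢ B).filter fun p => p.1 < p.2).card

/-- A largest element `N` contributes no pair when it is put into `A`, and `A.card` pairs when it is
put into `B`. The latter is the sign with which an odd derivation passes a coefficient of degree
`A.card`. -/
theorem inv_insert_left {A B : Finset ℕ} {N : ℕ} (hB : ∀ b ∈ B, b < N) :
    inv (insert N A) B = inv A B := by
  unfold inv
  congr 1
  ext ⟨a, b⟩
  simp only [Finset.mem_filter, Finset.mem_product, Finset.mem_insert]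
  constructor
  · rintro ⟨⟨rfl | ha, hb⟩, hab⟩
    · exact absurd hab (hB b hb).not_gt
    · exact ⟨⟨ha, hb⟩, hab⟩
  · rintro ⟨⟨ha, hb⟩, hab⟩
    exact ⟨⟨Or.inr ha, hb⟩, hab⟩

theorem inv_insert_right {A B : Finset ℕ} {N : ℕ} (hA : ∀ a ∈ A, a < N) (hN : N ∉ B) :
    inv A (insert N B) = inv A B + A.card := by
  unfold inv
  rw [Finset.card_filter, Finset.card_filter, Finset.sum_product, Finset.sum_product,
    Finset.card_eq_sum_ones, ← Finset.sum_add_distrib]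
  refine Finset.sum_congr rfl fun a ha => ?_
  rw [Finset.sum_insert hN, if_pos (hA a ha), add_comm]

variable {M : Mfd.{u}} (cov : Connection M)

/-- The universal point with values in `M`. -/
def zeroPoint (M : Mfd.{u}) : DPoint 0 M (tan M 0) where
  c I := if I = ∅ then (GrBundle.fnHom (V := tanBundle M 0)).toLinearMap else 0
  supp I h := if_neg fun h' => h (by simp [h'])
  mem I f := by
    split_ifs with h
    · subst h
      exact GrBundle.fn_mem (V := tanBundle M 0) f
    · exact Submodule.zero_mem _
  one I := by
    split_ifs with h
    · exact map_one (GrBundle.fnHom (V := tanBundle M 0))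
    · rfl
  mul I f g := by
    by_cases h : I = ∅
    · subst h
      simp
    · rw [if_neg h]
      refine (Finset.sum_eq_zero fun A hA => ?_).symm
      by_cases hA' : A = ∅
      · rw [if_neg (c := I \ A = ∅) (by simpa [hA'] using h)]
        simp
      · rw [if_neg hA']
        simp

variable [CovariantDerivative.ContMDiffCovariantDerivative cov ∞] {l : ℕ}

open Classical in
/-- The coefficients of the universal point on `T[1]^{l+1} M` in terms of those on `T[1]^l M`. -/
def succCoeff (p : DPoint l M (tan M l)) (I : Finset ℕ) : M.Fun →ₗ[ℝ] (tan M (l + 1)).C :=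
  if l + 1 ∈ I then (delta cov l).comp (p.c (I.erase (l + 1)))
  else (NMfd.pullback (inclHom M l)).toLinearMap.comp (p.c I)

variable (p : DPoint l M (tan M l))

theorem succCoeff_insert {I : Finset ℕ} (hI : l + 1 ∉ I) (f : M.Fun) :
    succCoeff cov p (insert (l + 1) I) f = delta cov l (p.c I f) := by
  rw [succCoeff, if_pos (Finset.mem_insert_self _ _), Finset.erase_insert hI]
  rfl

theorem succCoeff_of_notMem {I : Finset ℕ} (hI : l + 1 ∉ I) (f : M.Fun) :
    succCoeff cov p I f = NMfd.pullback (inclHom M l) (p.c I f) := by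
  rw [succCoeff, if_neg hI]
  rfl

theorem succCoeff_supp (I : Finset ℕ) (hI : ¬ I ⊆ Finset.Icc 1 (l + 1)) :
    succCoeff cov p I = 0 := by
  have key : ∀ J ⊆ I, (∀ x ∈ I, x ∉ J → x = l + 1) → p.c J = 0 := fun J hJ hJI =>
    p.supp J fun h => hI fun x hx => by
      by_cases hxJ : x ∈ J
      · exact Finset.Icc_subset_Icc_right (Nat.le_succ l) (h hxJ)
      · rw [hJI x hx hxJ]
        simp
  rw [succCoeff]
  split_ifs with h
  · rw [key _ (Finset.erase_subset _ _) fun x hx hx' => by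
      by_contra hne
      exact hx' (Finset.mem_erase.2 ⟨hne, hx⟩), LinearMap.comp_zero]
  · rw [key I subset_rfl fun x hx hx' => absurd hx hx', LinearMap.comp_zero]

/-- The universal point on `T[1]^{l+1} M` in terms of that on `T[1]^l M`. -/
def succPoint : DPoint (l + 1) M (tan M (l + 1)) where
  c := succCoeff cov p
  supp := succCoeff_supp cov p
  mem I f := by
    by_cases h : l + 1 ∈ I
    · obtain ⟨J, hJ, rfl⟩ : ∃ J, l + 1 ∉ J ∧ I = insert (l + 1) J :=
        ⟨I.erase (l + 1), Finset.notMem_erase _ _, (Finset.insert_erase h).symm⟩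
      rw [succCoeff_insert cov p hJ, Finset.card_insert_of_notMem hJ]
      exact delta_mem cov (p.mem J f)
    · rw [succCoeff_of_notMem cov p h]
      exact NMfd.pullback_mem _ (p.mem I f)
  one I := by
    by_cases h : l + 1 ∈ I
    · obtain ⟨J, hJ, rfl⟩ : ∃ J, l + 1 ∉ J ∧ I = insert (l + 1) J :=
        ⟨I.erase (l + 1), Finset.notMem_erase _ _, (Finset.insert_erase h).symm⟩
      rw [succCoeff_insert cov p hJ, p.one, if_neg (Finset.insert_ne_empty _ _)]
      split_ifs
      · exact delta_one cov
      · exact map_zero _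
    · rw [succCoeff_of_notMem cov p h, p.one]
      split_ifs
      · exact map_one _
      · exact map_zero _
  mul I f g := by
    by_cases hI : I ⊆ Finset.Icc 1 (l + 1)
    · by_cases h : l + 1 ∈ I
      · obtain ⟨J, hJ, rfl⟩ : ∃ J, l + 1 ∉ J ∧ I = insert (l + 1) J :=
          ⟨I.erase (l + 1), Finset.notMem_erase _ _, (Finset.insert_erase h).symm⟩
        have hlt : ∀ x ∈ J, x < l + 1 := fun x hx => by
          have h1 := Finset.mem_Icc.1 (hI (Finset.mem_insert_of_mem hx))
          have h2 : x ≠ l + 1 := fun h => hJ (h ▸ hx)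
          omega
        -- The subsets of `insert (l + 1) J` come in pairs `A`, `insert (l + 1) A`. A pair gives the
        -- two terms of the Leibniz rule for `c A f * c (J \ A) g`, with matching signs by the two
        -- lemmas on `inv`.
        rw [succCoeff_insert cov p hJ, p.mul, map_sum, Finset.sum_powerset_insert hJ,
          ← Finset.sum_add_distrib]
        refine Finset.sum_congr rfl fun A hA => ?_
        rw [Finset.mem_powerset] at hA
        have hA1 : l + 1 ∉ A := fun h => hJ (hA h)
        have hB1 : l + 1 ∉ J \ A := fun h => hJ (Finset.sdiff_subset h)
        have e1 : insert (l + 1) J \ A = insert (l + 1) (J \ A) :=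
          Finset.insert_sdiff_of_notMem _ hA1
        have e2 : insert (l + 1) J \ insert (l + 1) A = J \ A := by
          rw [Finset.insert_sdiff_insert, Finset.sdiff_insert_of_notMem hJ]
        have e3 := inv_insert_left (A := A) (B := J \ A) (N := l + 1)
          fun b hb => hlt b (Finset.sdiff_subset hb)
        have e4 := inv_insert_right (A := A) (B := J \ A) (N := l + 1)
          (fun a ha => hlt a (hA ha)) hB1
        simp only [inv] at e3 e4
        rw [e1, e2, e3, e4, succCoeff_insert cov p hA1, succCoeff_insert cov p hB1,
          succCoeff_of_notMem cov p hA1, succCoeff_of_notMem cov p hB1, map_smul,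
          delta_mul cov (p.mem A f), smul_add, smul_smul, pow_add]
        exact add_comm _ _
      · rw [succCoeff_of_notMem cov p h, p.mul, map_sum]
        refine Finset.sum_congr rfl fun A hA => ?_
        rw [Finset.mem_powerset] at hA
        rw [succCoeff_of_notMem cov p fun h' => h (hA h'),
          succCoeff_of_notMem cov p fun h' => h (Finset.sdiff_subset h'), map_smul, map_mul]
    · rw [succCoeff_supp cov p I hI]
      refine (Finset.sum_eq_zero fun A hA => ?_).symm
      rw [Finset.mem_powerset] at hA
      by_cases hA' : A ⊆ Finset.Icc 1 (l + 1)
      · rw [succCoeff_supp cov p (I \ A) fun h => hI fun x hx => by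
          by_cases hxA : x ∈ A
          · exact hA' hxA
          · exact h (Finset.mem_sdiff.2 ⟨hx, hxA⟩)]
        simp
      · rw [succCoeff_supp cov p A hA']
        simp

/-- The morphisms `D^l × T[1]^l M → M` determined by a connection. -/
def splitPoint : ∀ l, DPoint l M (tan M l)
  | 0 => zeroPoint M
  | l + 1 => succPoint cov (splitPoint l)

theorem splitPoint_zero (f : M.Fun) : (splitPoint cov 0).c ∅ f = (tanBundle M 0).fn f := by
  have h : (zeroPoint M).c ∅ = (GrBundle.fnHom (V := tanBundle M 0)).toLinearMap := by
    simp [zeroPoint]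
  exact LinearMap.congr_fun h f

theorem splitPoint_insert {I : Finset ℕ} (hI : l + 1 ∉ I) (f : M.Fun) :
    (splitPoint cov (l + 1)).c (insert (l + 1) I) f = delta cov l ((splitPoint cov l).c I f) :=
  succCoeff_insert cov _ hI f

theorem splitPoint_of_notMem {I : Finset ℕ} (hI : l + 1 ∉ I) (f : M.Fun) :
    (splitPoint cov (l + 1)).c I f = NMfd.pullback (inclHom M l) ((splitPoint cov l).c I f) :=
  succCoeff_of_notMem cov _ hI f

theorem isSplitting_splitPoint : IsSplitting cov (splitPoint cov) := by
  refine ⟨splitPoint_zero cov, fun l => ⟨inclHom M l, delta cov l,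
    relHom_isInducedBy_copiesMap, fun n a ha b => delta_mul cov ha b, fun f => ?_,
    fun I α => ⟨covDual cov α, isCovDeriv_covDual cov α, ?_⟩, fun I hI f => ?_⟩⟩
  · rw [delta_fn]
    exact congrArg (tanBundle M (l + 1)).raw (secAt_pos (newIdx M l).2 f.d)
  · have h := raw_delta_secAt cov I.2 α
    rw [secAt_pos I.2] at h
    refine (funext h).trans (funext fun x => ?_)
    rw [Pi.add_apply, quadRaw_apply]
    exact congrArg (· + _) (LinearMap.congr_fun (genAt_pos (insIdx I).2 x) (α.toFun x))
  · have hI' : l + 1 ∉ I := notMem_of_mem_subsets (Finset.mem_powerset.2 hI)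
    exact ⟨splitPoint_of_notMem cov hI' f, splitPoint_insert cov hI' f⟩

end Points

/-! ### The universal property of the iterated tangent bundles -/

theorem NMfd.mul_comm_of_mem {X : NMfd.{u}} {m n : ℕ} {a b : X.C} (ha : a ∈ X.deg m)
    (hb : b ∈ X.deg n) : a * b = (-1 : ℝ) ^ (m * n) • (b * a) := by
  obtain ⟨M, V, e, he⟩ := X.splits
  let e₀ : X.C ≃ₐ[ℝ] V.split.C := e
  have he' : ∀ n c, c ∈ X.deg n ↔ e₀ c ∈ V.split.deg n := he
  refine e₀.injective (GrBundle.raw_injective (funext fun y => ?_))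
  rw [map_mul, map_smul, map_mul, GrBundle.raw_mul, GrBundle.raw_smul, GrBundle.raw_mul]
  exact GSym.part_mul_comm (((he' m a).1 ha).1 y) (((he' n b).1 hb).1 y)

section Represents

variable {M : Mfd.{u}} {l : ℕ}

/-- The endomorphism of `T[1]^l M` which kills the summands in degrees `≥ n`. -/
def trunc (M : Mfd.{u}) (l n : ℕ) : tan M l ⟶ tan M l :=
  relHom (fun a b => a = b ∧ b.card < n) M (subsets l) (subsets l)

/-- The endomorphism of fibres which kills the summands in degrees `≥ n`. -/
def truncFib (l n : ℕ) (x : M.pt) : (tanBundle M l).Fib x →ₐ[ℝ] (tanBundle M l).Fib x :=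
  relFib (fun a b => a = b ∧ b.card < n) (subsets l) (subsets l) x

theorem raw_trunc (n : ℕ) (c : (tan M l).C) (x : M.pt) :
    (tanBundle M l).raw (NMfd.pullback (trunc M l n) c) x =
      truncFib l n x ((tanBundle M l).raw c x) := rfl

theorem trunc_fn (n : ℕ) (f : M.Fun) :
    NMfd.pullback (trunc M l n) ((tanBundle M l).fn f) = (tanBundle M l).fn f := relHom_fn _ _

theorem truncFib_genAt (n : ℕ) {I : Finset ℕ} (hI : I ∈ subsets l) (x : M.pt)
    (β : M.T x →ₗ[ℝ] ℝ) : truncFib l n x (genAt M (subsets l) I x β) =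
      if I.card < n then genAt M (subsets l) I x β else 0 := by
  by_cases h : I.Nonempty
  · refine (relFib_genAt _ ⟨hI, h⟩ x β).trans ?_
    split_ifs with hn
    · have h1 : (subsets l).filter (fun J => J.card = I.card ∧ J = I ∧ I.card < n) = {I} := by
        ext J
        simp only [Finset.mem_filter, Finset.mem_singleton]
        refine ⟨fun h => h.2.2.1, ?_⟩
        rintro rfl
        exact ⟨hI, rfl, rfl, hn⟩
      rw [h1, Finset.sum_singleton]
    · refine Finset.sum_eq_zero fun J hJ => ?_
      exact absurd (Finset.mem_filter.1 hJ).2.2.2 hn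
  · rw [genAt_neg fun h' => h h'.2]
    simp

theorem trunc_secAt (n : ℕ) {I : Finset ℕ} (hI : I ∈ subsets l) (α : OneForm M) :
    NMfd.pullback (trunc M l n) (secAt (subsets l) I α) =
      if I.card < n then secAt (subsets l) I α else 0 := by
  refine GrBundle.raw_injective (funext fun x => ?_)
  rw [raw_trunc, raw_secAt, truncFib_genAt n hI]
  split_ifs
  · rw [raw_secAt]
  · rw [GrBundle.raw_zero]
    rfl

theorem trunc_trunc {m n : ℕ} (hmn : m ≤ n) (c : (tan M l).C) :
    NMfd.pullback (trunc M l n) (NMfd.pullback (trunc M l m) c) =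
      NMfd.pullback (trunc M l m) c := by
  have h : trunc M l n ≫ trunc M l m = trunc M l m := by
    refine copies_hom_ext (fun f => ?_) fun I hI _ α => ?_
    · change NMfd.pullback (trunc M l n) (NMfd.pullback (trunc M l m) ((tanBundle M l).fn f)) =
        NMfd.pullback (trunc M l m) ((tanBundle M l).fn f)
      rw [trunc_fn, trunc_fn]
    · change NMfd.pullback (trunc M l n) (NMfd.pullback (trunc M l m) (secAt (subsets l) I α)) =
        NMfd.pullback (trunc M l m) (secAt (subsets l) I α)
      rw [trunc_secAt m hI]
      split_ifs with h
      · rw [trunc_secAt n hI, if_pos (h.trans_le hmn)]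
      · exact map_zero _
  exact congrArg (fun F => NMfd.pullback F c) h

theorem trunc_inclHom (n : ℕ) (c : (tan M l).C) :
    NMfd.pullback (trunc M (l + 1) n) (NMfd.pullback (inclHom M l) c) =
      NMfd.pullback (inclHom M l) (NMfd.pullback (trunc M l n) c) := by
  have h : trunc M (l + 1) n ≫ inclHom M l = inclHom M l ≫ trunc M l n := by
    refine copies_hom_ext (fun f => ?_) fun I hI _ α => ?_
    · change NMfd.pullback (trunc M (l + 1) n) (NMfd.pullback (inclHom M l) ((tanBundle M l).fn f)) =
        NMfd.pullback (inclHom M l) (NMfd.pullback (trunc M l n) ((tanBundle M l).fn f))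
      rw [inclHom_fn, trunc_fn, trunc_fn, inclHom_fn]
    · change NMfd.pullback (trunc M (l + 1) n)
          (NMfd.pullback (inclHom M l) (secAt (subsets l) I α)) =
        NMfd.pullback (inclHom M l) (NMfd.pullback (trunc M l n) (secAt (subsets l) I α))
      rw [inclHom_secAt l hI, trunc_secAt n hI, trunc_secAt n (subsets_subset l hI)]
      split_ifs
      · rw [inclHom_secAt l hI]
      · exact (map_zero _).symm
  exact congrArg (fun F => NMfd.pullback F c) h

variable (cov : Connection M) [CovariantDerivative.ContMDiffCovariantDerivative cov ∞]

theorem singleton_mem_subsets : {l + 1} ∈ subsets (l + 1) := by simp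

/-- Apart from its leading term in the summand `insert (l + 1) I`, the derivative of a 1-form is
quadratic in generators of degrees `1` and `I.card`, and both are at most `n`. -/
theorem trunc_delta_secAt_sub {n : ℕ} {I : Finset ℕ} (hI : I ∈ subsets l ∧ I.Nonempty)
    (hn : I.card ≤ n) (α : OneForm M) :
    NMfd.pullback (trunc M (l + 1) (n + 1)) (delta cov l (secAt (subsets l) I α) -
        secAt (subsets (l + 1)) (insert (l + 1) I) α) =
      delta cov l (secAt (subsets l) I α) - secAt (subsets (l + 1)) (insert (l + 1) I) α := by
  have h1 := Finset.card_pos.2 hI.2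
  refine GrBundle.raw_injective (funext fun x => ?_)
  rw [raw_trunc, GrBundle.raw_sub, Pi.sub_apply, raw_delta_secAt cov hI, raw_secAt,
    add_sub_cancel_left, map_quad]
  congr 1
  · ext β
    refine (truncFib_genAt (n + 1) singleton_mem_subsets x β).trans (if_pos ?_)
    rw [Finset.card_singleton]
    omega
  · ext β
    exact (truncFib_genAt (n + 1) (subsets_subset l hI.1) x β).trans (if_pos (by omega))

theorem trunc_delta_secAt {n : ℕ} {I : Finset ℕ} (hI : I ∈ subsets l ∧ I.Nonempty)
    (hn : I.card < n) (α : OneForm M) :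
    NMfd.pullback (trunc M (l + 1) (n + 1)) (delta cov l (secAt (subsets l) I α)) =
      delta cov l (secAt (subsets l) I α) := by
  have h := trunc_delta_secAt_sub cov hI hn.le α
  rw [map_sub, trunc_secAt _ (insert_mem_subsets hI.1), if_pos, sub_left_inj] at h
  · exact h
  · rw [Finset.card_insert_of_notMem (notMem_of_mem_subsets hI.1)]
    omega

/-- The difference of the two sides obeys a product rule, so it is enough to treat generators; those
of degree at least `n` are killed at once. The meaning is that `delta` raises the degrees of the
generators on which a function depends by at most one. Positivity of `n` is needed because functions
on `M` acquire differentials, of degree `1`. -/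
theorem trunc_delta_trunc {n : ℕ} (hn : 0 < n) (c : (tan M l).C) :
    NMfd.pullback (trunc M (l + 1) (n + 1)) (delta cov l (NMfd.pullback (trunc M l n) c)) =
      delta cov l (NMfd.pullback (trunc M l n) c) := by
  let D₀ : (tan M l).C →ₗ[ℝ] (tan M (l + 1)).C :=
    (delta cov l).comp (NMfd.pullback (trunc M l n)).toLinearMap
  let D : (tan M l).C →ₗ[ℝ] (tan M (l + 1)).C :=
    (NMfd.pullback (trunc M (l + 1) (n + 1))).toLinearMap.comp D₀ - D₀
  have hD : ∀ c, D c = NMfd.pullback (trunc M (l + 1) (n + 1))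
      (delta cov l (NMfd.pullback (trunc M l n) c)) -
        delta cov l (NMfd.pullback (trunc M l n) c) := fun c => rfl
  have key : ∀ (m : ℕ) (h : (tan M l).C), NMfd.pullback (trunc M l n) h ∈ (tan M l).deg m →
      NMfd.pullback (trunc M (l + 1) (n + 1)) (delta cov l (NMfd.pullback (trunc M l n) h)) =
        delta cov l (NMfd.pullback (trunc M l n) h) → ∀ b, D (h * b) =
      ((-1 : ℝ) ^ m • NMfd.pullback (inclHom M l) (NMfd.pullback (trunc M l n) h)) * D b := by
    intro m h hm hh b
    rw [hD, hD, map_mul, delta_mul cov hm, map_add, map_smul, map_mul, map_mul, hh,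
      trunc_inclHom, trunc_inclHom, trunc_trunc (Nat.le_succ n), trunc_trunc (Nat.le_succ n),
      smul_mul_assoc, mul_sub, smul_sub]
    abel
  have h0 : D = 0 := by
    refine GrBundle.eq_zero_of_generators (W := tanBundle M l) (inclHom M l) D ?_ ?_ ?_
    · rw [hD, map_one, delta_one, map_zero, sub_zero]
    · intro f b
      refine (key 0 _ ?_ ?_ b).trans ?_
      · rw [trunc_fn]
        exact GrBundle.fn_mem (V := tanBundle M l) f
      · rw [trunc_fn, delta_fn, trunc_secAt _ singleton_mem_subsets, if_pos]
        rw [Finset.card_singleton]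
        omega
      · rw [trunc_fn, pow_zero, one_smul]
    · intro a s
      have h1 : (tanBundle M l).sec a s = secAt (subsets l) a.1 s := (secAt_pos a.2 s).symm
      by_cases ha : a.1.card < n
      · have h2 : NMfd.pullback (trunc M l n) (secAt (subsets l) a.1 s) =
            secAt (subsets l) a.1 s := (trunc_secAt n a.2.1 s).trans (if_pos ha)
        refine ⟨(-1 : ℝ) ^ a.1.card • NMfd.pullback (inclHom M l)
          (NMfd.pullback (trunc M l n) (secAt (subsets l) a.1 s)), fun b => ?_⟩
        rw [h1]
        refine key a.1.card _ ?_ ?_ b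
        · rw [h2]
          exact secAt_mem _ _
        · rw [h2]
          exact trunc_delta_secAt cov a.2 ha s
      · refine ⟨0, fun b => ?_⟩
        have h2 : NMfd.pullback (trunc M l n) (secAt (subsets l) a.1 s) = 0 :=
          (trunc_secAt n a.2.1 s).trans (if_neg ha)
        rw [h1, hD, map_mul, h2, zero_mul, map_zero, map_zero, sub_zero, zero_mul]
  exact sub_eq_zero.1 (LinearMap.congr_fun h0 c)

theorem splitPoint_empty (l : ℕ) (f : M.Fun) :
    (splitPoint cov l).c ∅ f = (tanBundle M l).fn f := by
  induction l with
  | zero => exact splitPoint_zero cov f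
  | succ l ih => rw [splitPoint_of_notMem cov (Finset.notMem_empty _), ih, inclHom_fn]

/-- In the recursion, `delta` creates the leading term `df` in the enlarged summand and raises the
degrees of the other generators by at most one. This triangularity of the coefficients carries the
universal property. -/
theorem trunc_splitPoint_sub (l : ℕ) {I : Finset ℕ} (hI : I ∈ subsets l) (hI' : I.Nonempty)
    (f : M.Fun) :
    NMfd.pullback (trunc M l I.card) ((splitPoint cov l).c I f - secAt (subsets l) I f.d) =
      (splitPoint cov l).c I f - secAt (subsets l) I f.d := by
  induction l generalizing I with
  | zero =>
    have h : I = ∅ := by simpa using hI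
    exact absurd hI' (by simp [h])
  | succ l ih =>
    by_cases h : l + 1 ∈ I
    · obtain ⟨J, hJ, rfl⟩ : ∃ J, l + 1 ∉ J ∧ I = insert (l + 1) J :=
        ⟨I.erase (l + 1), Finset.notMem_erase _ _, (Finset.insert_erase h).symm⟩
      have hJl : J ∈ subsets l := by
        refine Finset.mem_powerset.2 fun x hx => ?_
        have h1 := Finset.mem_Icc.1 (Finset.mem_powerset.1 hI (Finset.mem_insert_of_mem hx))
        have h2 : x ≠ l + 1 := fun h => hJ (h ▸ hx)
        exact Finset.mem_Icc.2 (by omega)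
      rw [splitPoint_insert cov hJ, Finset.card_insert_of_notMem hJ]
      rcases J.eq_empty_or_nonempty with rfl | hJ'
      · rw [splitPoint_empty, delta_fn]
        simp
      · have h1 : delta cov l ((splitPoint cov l).c J f) -
              secAt (subsets (l + 1)) (insert (l + 1) J) f.d =
            (delta cov l (secAt (subsets l) J f.d) -
              secAt (subsets (l + 1)) (insert (l + 1) J) f.d) +
            delta cov l (NMfd.pullback (trunc M l J.card)
              ((splitPoint cov l).c J f - secAt (subsets l) J f.d)) := by
          rw [ih hJl hJ', map_sub]
          abel
        rw [h1, map_add, trunc_delta_secAt_sub cov ⟨hJl, hJ'⟩ le_rfl,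
          trunc_delta_trunc cov (Finset.card_pos.2 hJ')]
    · have hIl : I ∈ subsets l := by
        refine Finset.mem_powerset.2 fun x hx => ?_
        have h1 := Finset.mem_Icc.1 (Finset.mem_powerset.1 hI hx)
        have h2 : x ≠ l + 1 := fun h' => h (h' ▸ hx)
        exact Finset.mem_Icc.2 (by omega)
      rw [splitPoint_of_notMem cov h, ← inclHom_secAt l hIl, ← map_sub, trunc_inclHom,
        ih hIl hI']

theorem trunc_splitPoint {n : ℕ} {I : Finset ℕ} (hI : I.card < n) (f : M.Fun) :
    NMfd.pullback (trunc M l n) ((splitPoint cov l).c I f) = (splitPoint cov l).c I f := by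
  by_cases hIl : I ∈ subsets l
  · rcases I.eq_empty_or_nonempty with rfl | hI'
    · rw [splitPoint_empty, trunc_fn]
    · have h := trunc_splitPoint_sub cov l hIl hI' f
      have h1 : (splitPoint cov l).c I f = NMfd.pullback (trunc M l I.card)
          ((splitPoint cov l).c I f - secAt (subsets l) I f.d) + secAt (subsets l) I f.d := by
        rw [h, sub_add_cancel]
      rw [h1, map_add, trunc_trunc hI.le, trunc_secAt n hIl, if_pos hI]
  · rw [(splitPoint cov l).supp I fun h => hIl (Finset.mem_powerset.2 h)]
    exact map_zero _

/-- Two morphisms which agree on the generators in degrees `< n` agree on the functions which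
depend only on these. -/
theorem pullback_trunc_eq {X : NMfd.{u}} {F G : X ⟶ tan M l} {n : ℕ}
    (hf : ∀ f, NMfd.pullback F ((tanBundle M l).fn f) = NMfd.pullback G ((tanBundle M l).fn f))
    (hs : ∀ I ∈ subsets l, I.Nonempty → I.card < n → ∀ α,
      NMfd.pullback F (secAt (subsets l) I α) = NMfd.pullback G (secAt (subsets l) I α))
    (c : (tan M l).C) : NMfd.pullback F (NMfd.pullback (trunc M l n) c) =
      NMfd.pullback G (NMfd.pullback (trunc M l n) c) := by
  have h : F ≫ trunc M l n = G ≫ trunc M l n := by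
    refine copies_hom_ext (fun f => ?_) fun I hI hI' α => ?_
    · change NMfd.pullback F (NMfd.pullback (trunc M l n) ((tanBundle M l).fn f)) =
        NMfd.pullback G (NMfd.pullback (trunc M l n) ((tanBundle M l).fn f))
      rw [trunc_fn, hf]
    · change NMfd.pullback F (NMfd.pullback (trunc M l n) (secAt (subsets l) I α)) =
        NMfd.pullback G (NMfd.pullback (trunc M l n) (secAt (subsets l) I α))
      rw [trunc_secAt n hI]
      split_ifs with hn
      · exact hs I hI hI' hn α
      · rw [map_zero, map_zero]
  exact congrArg (fun F => NMfd.pullback F c) h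

theorem Mfd.Fun.d_add (f g : M.Fun) : (f + g).d = f.d + g.d :=
  DualSection.toFun_injective (funext fun x => Mfd.dif_add (f.mdiff x) (g.mdiff x))

theorem Mfd.Fun.d_mul (f g : M.Fun) : (f * g).d = f • g.d + g • f.d :=
  DualSection.toFun_injective (funext fun x => Mfd.dif_mul (f.mdiff x) (g.mdiff x))

/-- The differential of a function in the summand with index `I`, as a linear map. -/
def secD (l : ℕ) (I : Finset ℕ) : M.Fun →ₗ[ℝ] (tan M l).C where
  toFun f := secAt (subsets l) I f.d
  map_add' f g := by rw [Mfd.Fun.d_add, secAt_add]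
  map_smul' r f := by
    have h1 : (r • f).d = (algebraMap ℝ M.Fun r) • f.d := by
      have h2 : (algebraMap ℝ M.Fun r).d = 0 :=
        DualSection.toFun_injective (funext fun x => Mfd.dif_const r x)
      have h3 : f • (0 : OneForm M) = 0 :=
        DualSection.toFun_injective (funext fun x => smul_zero _)
      rw [Algebra.smul_def, Mfd.Fun.d_mul, h2, h3, add_zero]
    have h4 : (tanBundle M l).fn (algebraMap ℝ M.Fun r) = algebraMap ℝ (tan M l).C r :=
      (GrBundle.fnHom (V := tanBundle M l)).commutes r
    rw [h1, secAt_smul, RingHom.id_apply, Algebra.smul_def]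
    exact congrArg (· * _) h4

theorem secD_apply (I : Finset ℕ) (f : M.Fun) : secD l I f = secAt (subsets l) I f.d := rfl

/-- The 1-forms in the summand with index `I`, as an additive map. -/
def secHom (l : ℕ) (I : Finset ℕ) : OneForm M →+ (tan M l).C :=
  AddMonoidHom.mk' (secAt (subsets l) I) (secAt_add I)

theorem DPoint.c_empty_mul {X : NMfd.{u}} (p : DPoint l M X) (f g : M.Fun) :
    p.c ∅ (f * g) = p.c ∅ f * p.c ∅ g := by
  rw [p.mul]
  simp

/-- The underlying map of base manifolds of a point with values in `M`. -/
def DPoint.base {X : NMfd.{u}} (p : DPoint l M X) : M.Fun →ₐ[ℝ] X.C :=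
  AlgHom.ofLinearMap (p.c ∅) (by rw [p.one, if_pos rfl]) p.c_empty_mul

/-- The difference of the highest coefficients of points with the same lower coefficients is a
derivation. -/
theorem DPoint.sub_mul_of_eq {X : NMfd.{u}} (p p' : DPoint l M X) {I : Finset ℕ}
    (hI : I.Nonempty) (h : ∀ J, J.card < I.card → p.c J = p'.c J) (f g : M.Fun) :
    p.c I (f * g) - p'.c I (f * g) =
      p.c ∅ f * (p.c I g - p'.c I g) + p.c ∅ g * (p.c I f - p'.c I f) := by
  have h0 : p.c ∅ = p'.c ∅ := h ∅ (by simpa using Finset.card_pos.2 hI)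
  have hcomm : ∀ a ∈ X.deg I.card, p.c ∅ g * a = a * p.c ∅ g := fun a ha => by
    have h1 := NMfd.mul_comm_of_mem (p.mem ∅ g) ha
    simpa using h1
  rw [p.mul, p'.mul, ← Finset.sum_sub_distrib]
  -- Only `A = ∅` and `A = I` survive in the difference: otherwise `A` and `I \ A` are both smaller
  -- than `I`, where the two points agree.
  have hsub : ({∅, I} : Finset (Finset ℕ)) ⊆ I.powerset := by
    intro A hA
    rcases Finset.mem_insert.1 hA with rfl | hA
    · exact Finset.empty_mem_powerset _
    · rw [Finset.mem_singleton.1 hA]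
      exact Finset.mem_powerset_self _
  rw [← Finset.sum_subset hsub]
  · rw [Finset.sum_pair hI.ne_empty.symm, hcomm _ (Submodule.sub_mem _ (p.mem I f) (p'.mem I f))]
    simp [← h0, mul_sub, sub_mul]
  · intro A hA hA'
    rw [Finset.mem_powerset] at hA
    have h1 : A ≠ ∅ := fun h => hA' (by simp [h])
    have h2 : A ≠ I := fun h => hA' (by simp [h])
    have h3 : A.card < I.card := Finset.card_lt_card (hA.ssubset_of_ne h2)
    have h4 : (I \ A).card < I.card := Finset.card_lt_card
      (Finset.sdiff_ssubset hA (Finset.nonempty_iff_ne_empty.2 h1))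
    rw [h A h3, h _ h4, sub_self]

/-- By triangularity, the images of the generators of degree `n + 1` can be adjusted to produce the
coefficients of `p` of that size, without disturbing the smaller ones. -/
theorem exists_hom_of_card_lt {X : NMfd.{u}} (p : DPoint l M X) (n : ℕ) :
    ∃ F : X ⟶ tan M l, ∀ I : Finset ℕ, I.card < n + 1 →
      p.c I = ((splitPoint cov l).restrict F).c I := by
  have hres : ∀ (F : X ⟶ tan M l) I f, ((splitPoint cov l).restrict F).c I f =
    NMfd.pullback F ((splitPoint cov l).c I f) := fun F I f => rfl
  induction n with
  | zero =>
    obtain ⟨F, hF, -⟩ := GrBundle.exists_hom (S := subsets l) p.base (fun f => p.mem ∅ f)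
      (fun _ => 0) (fun I α => Submodule.zero_mem _) (fun I f α => (mul_zero _).symm)
    refine ⟨F, fun I hI => ?_⟩
    have hI' : I = ∅ := Finset.card_eq_zero.1 (by omega)
    subst hI'
    refine LinearMap.ext fun f => ?_
    rw [hres, splitPoint_empty]
    exact (hF f).symm
  | succ n ih =>
    obtain ⟨F, hF⟩ := ih
    have hbase : ∀ f, NMfd.pullback F ((tanBundle M l).fn f) = p.base f := fun f => by
      rw [← splitPoint_empty cov, ← hres, ← hF ∅ (by simp)]
      rfl
    have hFs : ∀ I f α, NMfd.pullback F (secAt (subsets l) I (f • α)) =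
        p.base f * NMfd.pullback F (secAt (subsets l) I α) := fun I f α => by
      rw [secAt_smul, map_mul]
      exact congrArg (· * _) (hbase f)
    have hA : ∀ I : (tanBundle M l).ι, ∃ A : OneForm M →+ X.C,
        (∀ α, A α ∈ X.deg I.1.card) ∧ (∀ f α, A (f • α) = p.base f * A α) ∧
        (I.1.card = n + 1 → ∀ f : M.Fun, A f.d = p.c I.1 f - NMfd.pullback F
          ((splitPoint cov l).c I.1 f - secAt (subsets l) I.1 f.d)) ∧
        (I.1.card ≠ n + 1 → ∀ α, A α = NMfd.pullback F (secAt (subsets l) I.1 α)) := by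
      intro I
      by_cases hI : I.1.card = n + 1
      -- The value required on `df` is the defect between `p` and the coefficient produced by `F`,
      -- plus the pullback under `F` of `df` in the summand `I`. Both are derivations in `f`, the
      -- defect by `DPoint.sub_mul_of_eq`, so the value extends to all 1-forms.
      · obtain ⟨A, hA1, hA2, hA3⟩ := GrBundle.exists_oneForm_of_derivation p.base
          (fun f => p.mem ∅ f)
          (p.c I.1 - ((splitPoint cov l).restrict F).c I.1 +
            (NMfd.pullback F).toLinearMap.comp (secD l I.1)) (n := I.1.card)
          (fun f => Submodule.add_mem _ (Submodule.sub_mem _ (p.mem _ _) (DPoint.mem _ _ _))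
            (NMfd.pullback_mem F (secAt_mem _ _))) (fun f g => by
              have h1 := DPoint.sub_mul_of_eq p ((splitPoint cov l).restrict F) I.2.2
                (fun J hJ => hF J (by omega)) f g
              have h2 : NMfd.pullback F (secD l I.1 (f * g)) =
                  p.base f * NMfd.pullback F (secD l I.1 g) +
                    p.base g * NMfd.pullback F (secD l I.1 f) := by
                rw [secD_apply, Mfd.Fun.d_mul, secAt_add, map_add, hFs, hFs]
                rfl
              change p.c I.1 (f * g) - ((splitPoint cov l).restrict F).c I.1 (f * g) +
                NMfd.pullback F (secD l I.1 (f * g)) = p.c ∅ f * (p.c I.1 g -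
                ((splitPoint cov l).restrict F).c I.1 g + NMfd.pullback F (secD l I.1 g)) +
                p.c ∅ g * (p.c I.1 f - ((splitPoint cov l).restrict F).c I.1 f +
                NMfd.pullback F (secD l I.1 f))
              rw [h1, h2]
              change _ + (p.c ∅ f * _ + p.c ∅ g * _) = _
              noncomm_ring)
        refine ⟨A, hA1, hA2, fun _ f => ?_, fun h => absurd hI h⟩
        rw [hA3]
        change p.c I.1 f - NMfd.pullback F _ + NMfd.pullback F (secAt (subsets l) I.1 f.d) = _
        rw [map_sub]
        abel
      · exact ⟨(NMfd.pullback F : (tan M l).C →+ X.C).comp (secHom l I.1),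
          fun α => NMfd.pullback_mem F (secAt_mem _ _), hFs I.1, fun h => absurd h hI,
          fun _ α => rfl⟩
    choose A hA1 hA2 hA3 hA4 using hA
    obtain ⟨G, hG1, hG2⟩ := GrBundle.exists_hom (S := subsets l) p.base (fun f => p.mem ∅ f)
      A hA1 hA2
    have hG3 : ∀ (I : Finset ℕ) (hI : I ∈ subsets l ∧ I.Nonempty) α,
        NMfd.pullback G (secAt (subsets l) I α) = A ⟨I, hI⟩ α := fun I hI α => by
      rw [secAt_pos hI]
      exact hG2 ⟨I, hI⟩ α
    -- `G` and `F` have the same values on all generators of degree at most `n`, hence on all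
    -- functions of these. This covers the smaller coefficients and the non-leading parts of those
    -- of size `n + 1`.
    have hGF : ∀ c, NMfd.pullback G (NMfd.pullback (trunc M l (n + 1)) c) =
        NMfd.pullback F (NMfd.pullback (trunc M l (n + 1)) c) :=
      pullback_trunc_eq (fun f => (hG1 f).trans (hbase f).symm) fun I hI hI' hn α =>
        (hG3 I ⟨hI, hI'⟩ α).trans (hA4 ⟨I, hI, hI'⟩ hn.ne α)
    refine ⟨G, fun I hI => ?_⟩
    rcases Nat.lt_succ_iff_lt_or_eq.1 hI with hI' | hI'
    · rw [hF I hI']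
      refine LinearMap.ext fun f => ?_
      rw [hres, hres, ← trunc_splitPoint cov hI', hGF]
    · by_cases hIl : I ∈ subsets l
      · have hI0 : I.Nonempty := Finset.card_pos.1 (by omega)
        refine LinearMap.ext fun f => ?_
        have h1 := trunc_splitPoint_sub cov l hIl hI0 f
        rw [hI'] at h1
        have h2 := hGF ((splitPoint cov l).c I f - secAt (subsets l) I f.d)
        have h3 : A ⟨I, hIl, hI0⟩ f.d = _ := hA3 ⟨I, hIl, hI0⟩ hI' f
        rw [h1, map_sub, hG3 I ⟨hIl, hI0⟩, h3] at h2
        rw [hres]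
        exact (sub_eq_zero.1 ((sub_eq_iff_eq_add.1 h2 ▸ by abel))).symm
      · rw [p.supp I fun h => hIl (Finset.mem_powerset.2 h),
          DPoint.supp _ I fun h => hIl (Finset.mem_powerset.2 h)]

/-- Subsets of `{1, …, l}` have at most `l` elements, so finitely many adjustments suffice. For
uniqueness, triangularity recovers the pullback of `df` in the summand `I` from the coefficient at
`I` and generators of lower degree, and `oneForm_map_ext` passes from differentials to all 1-forms.
-/
theorem represents_splitPoint (l : ℕ) : (splitPoint cov l).Represents := by
  intro X p
  obtain ⟨F, hF⟩ := exists_hom_of_card_lt cov p l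
  refine ⟨F, ?_, fun G hG => ?_⟩
  · refine DPoint.ext (funext fun I => ?_)
    by_cases hI : I ⊆ Finset.Icc 1 l
    · refine (hF I ?_).symm
      have := Finset.card_le_card hI
      simp only [Nat.card_Icc] at this
      omega
    · rw [p.supp I hI, DPoint.supp _ I hI]
  · have hFG : ∀ I f, NMfd.pullback G ((splitPoint cov l).c I f) =
        NMfd.pullback F ((splitPoint cov l).c I f) := by
      intro I f
      have h1 : NMfd.pullback G ((splitPoint cov l).c I f) = p.c I f := by rw [← hG]; rfl
      rw [h1]
      by_cases hI : I ⊆ Finset.Icc 1 l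
      · rw [hF I]
        · rfl
        · have := Finset.card_le_card hI
          simp only [Nat.card_Icc] at this
          omega
      · rw [p.supp I hI, (splitPoint cov l).supp I hI, LinearMap.zero_apply, LinearMap.zero_apply,
          map_zero]
    have hbase : ∀ f, NMfd.pullback G ((tanBundle M l).fn f) =
        NMfd.pullback F ((tanBundle M l).fn f) := fun f => by
      rw [← splitPoint_empty cov, hFG]
    have hs : ∀ n, ∀ I ∈ subsets l, I.Nonempty → I.card < n → ∀ α,
        NMfd.pullback G (secAt (subsets l) I α) = NMfd.pullback F (secAt (subsets l) I α) := by
      intro n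
      induction n with
      | zero => intro I _ _ h; omega
      | succ n ih =>
        intro I hI hI' hn α
        rcases Nat.lt_succ_iff_lt_or_eq.1 hn with hn' | hn'
        · exact ih I hI hI' hn' α
        · have h1 := pullback_trunc_eq hbase ih
          let χ : M.Fun →ₐ[ℝ] X.C := (NMfd.pullback F).comp (GrBundle.fnHom (V := tanBundle M l))
          have h2 := GrBundle.oneForm_map_ext χ
            (fun f => NMfd.pullback_mem F (GrBundle.fn_mem (V := tanBundle M l) f))
            (A := (NMfd.pullback G : (tan M l).C →+ X.C).comp (secHom l I))
            (B := (NMfd.pullback F : (tan M l).C →+ X.C).comp (secHom l I))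
            (fun f α => by
              change NMfd.pullback G (secAt (subsets l) I (f • α)) = _
              rw [secAt_smul, map_mul]
              exact congrArg (· * _) (hbase f))
            (fun f α => by
              change NMfd.pullback F (secAt (subsets l) I (f • α)) = _
              rw [secAt_smul, map_mul]
              rfl)
            (fun f => by
              have h3 := h1 ((splitPoint cov l).c I f - secAt (subsets l) I f.d)
              rw [← hn', trunc_splitPoint_sub cov l hI hI', map_sub, map_sub, hFG] at h3
              exact sub_right_injective h3)
          exact DFunLike.congr_fun h2 α
    exact copies_hom_ext hbase fun I hI hI' α => hs (I.card + 1) I hI hI' (Nat.lt_succ_self _) α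

end Represents

/-! ### The degeneracy maps on indices -/

section Degeneracy

/-- The sets on which the `i`-th degeneracy is injective with image `I`. -/
def degFib (l i : ℕ) (I : Finset ℕ) : Finset (Finset ℕ) :=
  (subsets l).filter fun J => J.card = I.card ∧ J.image (degen i) = I

theorem mem_degFib {l i : ℕ} {I J : Finset ℕ} :
    J ∈ degFib l i I ↔ J ⊆ Finset.Icc 1 l ∧ J.card = I.card ∧ J.image (degen i) = I := by
  rw [degFib, Finset.mem_filter, Finset.mem_powerset]

theorem degen_of_le {i j : ℕ} (h : j ≤ i) : degen i j = j := if_pos h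

theorem degen_of_lt {i j : ℕ} (h : i < j) : degen i j = j - 1 := if_neg (not_le.2 h)

theorem image_degen_of_le {i : ℕ} {J : Finset ℕ} (h : ∀ j ∈ J, j ≤ i) :
    J.image (degen i) = J := by
  refine (Finset.image_congr (g := id) fun j hj => ?_).trans Finset.image_id
  exact degen_of_le (h j hj)

theorem subset_Icc_of_notMem {l : ℕ} {J : Finset ℕ} (hJ : J ⊆ Finset.Icc 1 (l + 1))
    (h : l + 1 ∉ J) : J ⊆ Finset.Icc 1 l := fun x hx => by
  have h1 := Finset.mem_Icc.1 (hJ hx)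
  have h2 : x ≠ l + 1 := fun h' => h (h' ▸ hx)
  exact Finset.mem_Icc.2 (by omega)

theorem degFib_empty (l i : ℕ) : degFib l i ∅ = {∅} := by
  ext J
  rw [mem_degFib, Finset.mem_singleton]
  constructor
  · rintro ⟨-, h, -⟩
    exact Finset.card_eq_zero.1 h
  · rintro rfl
    simp

variable {n i : ℕ} {I : Finset ℕ}

theorem degFib_of_le (hi : i ≤ n) (hI : I ∈ subsets n) :
    degFib (n + 2) i I = degFib (n + 1) i I := by
  ext J
  rw [mem_degFib, mem_degFib]
  refine ⟨fun ⟨h1, h2, h3⟩ => ⟨subset_Icc_of_notMem h1 fun h => ?_, h2, h3⟩,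
    fun ⟨h1, h2, h3⟩ => ⟨h1.trans (Finset.Icc_subset_Icc_right (Nat.le_succ _)), h2, h3⟩⟩
  have h4 : degen i (n + 1 + 1) ∈ I := h3 ▸ Finset.mem_image_of_mem _ h
  rw [degen_of_lt (by omega)] at h4
  exact notMem_of_mem_subsets hI h4

/-- For `i ≤ n`, the only element of `{1, …, n + 2}` sent to `n + 1` is `n + 2`, so the top elements
on both sides correspond. -/
theorem degFib_insert_of_le (hi : i ≤ n) (hI : I ∈ subsets n) :
    degFib (n + 2) i (insert (n + 1) I) = (degFib (n + 1) i I).image (insert (n + 2)) := by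
  have hI' := notMem_of_mem_subsets hI
  have hdeg : degen i (n + 2) = n + 1 := degen_of_lt (by omega)
  ext J
  rw [mem_degFib, Finset.mem_image, Finset.card_insert_of_notMem hI']
  constructor
  · rintro ⟨h1, h2, h3⟩
    have hJ : n + 2 ∈ J := by
      have h4 : n + 1 ∈ J.image (degen i) := h3 ▸ Finset.mem_insert_self _ _
      obtain ⟨j, hj, hj'⟩ := Finset.mem_image.1 h4
      have h5 := Finset.mem_Icc.1 (h1 hj)
      have h6 : j = n + 2 := by
        unfold degen at hj'
        split_ifs at hj' <;> omega
      exact h6 ▸ hj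
    refine ⟨J.erase (n + 2), mem_degFib.2 ⟨subset_Icc_of_notMem
      ((Finset.erase_subset _ _).trans h1) (Finset.notMem_erase _ _), ?_, ?_⟩,
      Finset.insert_erase hJ⟩
    · rw [Finset.card_erase_of_mem hJ, h2]
      rfl
    · ext y
      rw [Finset.mem_image]
      constructor
      · rintro ⟨x, hx, rfl⟩
        rw [Finset.mem_erase] at hx
        have h4 : degen i x ∈ insert (n + 1) I := h3 ▸ Finset.mem_image_of_mem _ hx.2
        have h5 := Finset.mem_Icc.1 (h1 hx.2)
        refine (Finset.mem_insert.1 h4).resolve_left fun h6 => hx.1 ?_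
        unfold degen at h6
        split_ifs at h6 <;> omega
      · intro hy
        have h4 : y ∈ J.image (degen i) := h3 ▸ Finset.mem_insert_of_mem hy
        obtain ⟨x, hx, rfl⟩ := Finset.mem_image.1 h4
        refine ⟨x, Finset.mem_erase.2 ⟨?_, hx⟩, rfl⟩
        rintro rfl
        exact hI' (hdeg ▸ hy)
  · rintro ⟨J, hJ, rfl⟩
    obtain ⟨h1, h2, h3⟩ := mem_degFib.1 hJ
    have hJ' : n + 2 ∉ J := fun h => by
      have := Finset.mem_Icc.1 (h1 h)
      omega
    refine ⟨Finset.insert_subset (by simp) (h1.trans (Finset.Icc_subset_Icc_right (Nat.le_succ _))),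
      ?_, ?_⟩
    · rw [Finset.card_insert_of_notMem hJ', h2]
    · rw [Finset.image_insert, h3, hdeg]

theorem sum_degFib_insert_of_le {A : Type*} [AddCommMonoid A] (hi : i ≤ n) (hI : I ∈ subsets n)
    (g : Finset ℕ → A) : ∑ J ∈ degFib (n + 2) i (insert (n + 1) I), g J =
      ∑ J ∈ degFib (n + 1) i I, g (insert (n + 2) J) := by
  rw [degFib_insert_of_le hi hI, Finset.sum_image]
  intro J hJ J' hJ' h
  have key : ∀ J ∈ degFib (n + 1) i I, n + 2 ∉ J := fun J hJ h => by
    have := Finset.mem_Icc.1 ((mem_degFib.1 hJ).1 h)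
    omega
  have h1 := congrArg (fun s => s.erase (n + 2)) h
  simpa [Finset.erase_insert (key J hJ), Finset.erase_insert (key J' hJ')] using h1

theorem degFib_last (hI : I ∈ subsets n) : degFib (n + 2) (n + 1) I = {I} := by
  have hI' := notMem_of_mem_subsets hI
  ext J
  rw [mem_degFib, Finset.mem_singleton]
  constructor
  · rintro ⟨h1, h2, h3⟩
    have h4 : ∀ j ∈ J, j ≤ n + 1 := fun j hj => by
      by_contra h
      have h5 := Finset.mem_Icc.1 (h1 hj)
      have h6 : degen (n + 1) j ∈ I := h3 ▸ Finset.mem_image_of_mem _ hj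
      rw [degen_of_lt (by omega), show j - 1 = n + 1 by omega] at h6
      exact hI' h6
    rwa [image_degen_of_le h4] at h3
  · rintro rfl
    refine ⟨(Finset.mem_powerset.1 hI).trans (Finset.Icc_subset_Icc_right (by omega)), rfl,
      image_degen_of_le fun j hj => ?_⟩
    have := Finset.mem_Icc.1 (Finset.mem_powerset.1 hI hj)
    omega

/-- The last degeneracy fixes `1, …, n + 1` and sends `n + 2` to `n + 1` too. By injectivity a set
in the fibre contains exactly one of the two preimages of `n + 1`. -/
theorem degFib_last_insert (hI : I ∈ subsets n) :
    degFib (n + 2) (n + 1) (insert (n + 1) I) = {insert (n + 1) I, insert (n + 2) I} := by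
  have hI' := notMem_of_mem_subsets hI
  have hle : ∀ j ∈ I, j ≤ n + 1 := fun j hj => by
    have := Finset.mem_Icc.1 (Finset.mem_powerset.1 hI hj)
    omega
  have hdeg : degen (n + 1) (n + 2) = n + 1 := degen_of_lt (by omega)
  have hI2 : n + 2 ∉ I := fun h => by have := hle _ h; omega
  have hsub : I ⊆ Finset.Icc 1 (n + 2) :=
    (Finset.mem_powerset.1 hI).trans (Finset.Icc_subset_Icc_right (by omega))
  ext J
  rw [mem_degFib, Finset.mem_insert, Finset.mem_singleton]
  constructor
  · rintro ⟨h1, h2, h3⟩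
    by_cases hJ : n + 2 ∈ J
    · right
      have hinj : Set.InjOn (degen (n + 1)) J := Finset.card_image_iff.1 (by rw [h3, h2])
      have hJ1 : n + 1 ∉ J := fun h => by
        have := hinj h hJ (by rw [hdeg, degen_of_le le_rfl])
        omega
      have h4 : ∀ j ∈ J.erase (n + 2), j ≤ n + 1 := fun j hj => by
        rw [Finset.mem_erase] at hj
        have h5 := Finset.mem_Icc.1 (h1 hj.2)
        omega
      rw [← Finset.insert_erase hJ, Finset.image_insert, image_degen_of_le h4, hdeg] at h3
      have h5 := congrArg (fun s => s.erase (n + 1)) h3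
      simp only [Finset.erase_insert hI'] at h5
      rw [Finset.erase_insert fun h => hJ1 (Finset.mem_of_mem_erase h)] at h5
      rw [← h5, Finset.insert_erase hJ]
    · left
      have h4 : ∀ j ∈ J, j ≤ n + 1 := fun j hj =>
        (Finset.mem_Icc.1 (subset_Icc_of_notMem h1 hJ hj)).2
      rwa [image_degen_of_le h4] at h3
  · rintro (rfl | rfl)
    · refine ⟨Finset.insert_subset (by simp) hsub, rfl, image_degen_of_le fun j hj => ?_⟩
      rcases Finset.mem_insert.1 hj with rfl | hj
      · exact le_rfl
      · exact hle j hj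
    · refine ⟨Finset.insert_subset (by simp) hsub, ?_, ?_⟩
      · rw [Finset.card_insert_of_notMem hI', Finset.card_insert_of_notMem hI2]
      · rw [Finset.image_insert, hdeg, image_degen_of_le hle]

end Degeneracy

/-! ### The degeneracy morphisms -/

section DegeneracyHom

variable {M : Mfd.{u}}

theorem copies_eq_zero_of_derivation {X : NMfd.{u}} {S : Finset (Finset ℕ)}
    (F : X ⟶ (copies M S).split) (D : (copies M S).split.C →ₗ[ℝ] X.C)
    (hD : ∀ n, ∀ a ∈ (copies M S).split.deg n, ∀ b, D (a * b) =
      D a * NMfd.pullback F b + (-1 : ℝ) ^ n • (NMfd.pullback F a * D b))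
    (hf : ∀ f, D ((copies M S).fn f) = 0)
    (hs : ∀ I ∈ S, I.Nonempty → ∀ α, D (secAt S I α) = 0) : D = 0 := by
  refine GrBundle.eq_zero_of_generators F D ?_ (fun f b => ?_) fun a s => ?_
  · rw [← map_one (GrBundle.fnHom (V := copies M S))]
    exact hf 1
  · rw [hD 0 _ (GrBundle.fn_mem f), hf, zero_mul, zero_add, pow_zero, one_smul]
  · have h1 : (copies M S).sec a s = secAt S a.1 s := (secAt_pos a.2 s).symm
    refine ⟨(-1 : ℝ) ^ a.1.card • NMfd.pullback F (secAt S a.1 s), fun b => ?_⟩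
    rw [h1]
    refine (hD a.1.card _ (secAt_mem _ _) b).trans ?_
    have h2 : D (secAt S a.1 s) = 0 := hs a.1 a.2.1 a.2.2 s
    rw [h2, zero_mul, zero_add, smul_mul_assoc]

/-- The morphism of split N-manifolds induced by the `i`-th degeneracy. -/
def degHom (M : Mfd.{u}) (S : Finset (Finset ℕ)) (m i : ℕ) : (copies M S).split ⟶ tan M m :=
  relHom (fun J I => J.image (degen i) = I) M S (subsets m)

/-- The homomorphism of fibres induced by the `i`-th degeneracy. -/
def degFibHom (l m i : ℕ) (x : M.pt) : (tanBundle M m).Fib x →ₐ[ℝ] (tanBundle M l).Fib x :=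
  relFib (fun J I => J.image (degen i) = I) (subsets l) (subsets m) x

variable {l m i : ℕ}

theorem raw_degHom (c : (tan M m).C) (x : M.pt) :
    (tanBundle M l).raw (NMfd.pullback (degHom M (subsets l) m i) c) x =
      degFibHom l m i x ((tanBundle M m).raw c x) := rfl

theorem degHom_fn (S : Finset (Finset ℕ)) (f : M.Fun) :
    NMfd.pullback (degHom M S m i) ((tanBundle M m).fn f) = (copies M S).fn f :=
  relHom_fn _ _

theorem degFibHom_genAt {I : Finset ℕ} (hI : I ∈ subsets m) (x : M.pt) (β : M.T x →ₗ[ℝ] ℝ) :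
    degFibHom l m i x (genAt M (subsets m) I x β) =
      ∑ J ∈ degFib l i I, genAt M (subsets l) J x β := by
  by_cases h : I.Nonempty
  · exact relFib_genAt _ ⟨hI, h⟩ x β
  · rw [Finset.not_nonempty_iff_eq_empty] at h
    subst h
    rw [degFib_empty, Finset.sum_singleton, genAt_neg (by simp), genAt_neg (by simp)]
    exact map_zero _

theorem degHom_secAt {I : Finset ℕ} (hI : I ∈ subsets m) (α : OneForm M) :
    NMfd.pullback (degHom M (subsets l) m i) (secAt (subsets m) I α) =
      ∑ J ∈ degFib l i I, secAt (subsets l) J α := by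
  refine GrBundle.raw_injective (funext fun x => ?_)
  rw [raw_degHom, raw_secAt, degFibHom_genAt hI, GrBundle.raw_sum, Finset.sum_apply]
  simp only [raw_secAt]

theorem degHom_inclHom_of_le {n : ℕ} (hi : i ≤ n) (c : (tan M n).C) :
    NMfd.pullback (degHom M (subsets (n + 2)) (n + 1) i) (NMfd.pullback (inclHom M n) c) =
      NMfd.pullback (inclHom M (n + 1)) (NMfd.pullback (degHom M (subsets (n + 1)) n i) c) := by
  have h : degHom M (subsets (n + 2)) (n + 1) i ≫ inclHom M n =
      inclHom M (n + 1) ≫ degHom M (subsets (n + 1)) n i := by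
    refine copies_hom_ext (fun f => ?_) fun I hI _ α => ?_
    · change NMfd.pullback (degHom M (subsets (n + 2)) (n + 1) i)
          (NMfd.pullback (inclHom M n) ((tanBundle M n).fn f)) = NMfd.pullback (inclHom M (n + 1))
          (NMfd.pullback (degHom M (subsets (n + 1)) n i) ((tanBundle M n).fn f))
      rw [inclHom_fn, degHom_fn, degHom_fn, inclHom_fn]
    · change NMfd.pullback (degHom M (subsets (n + 2)) (n + 1) i)
          (NMfd.pullback (inclHom M n) (secAt (subsets n) I α)) = NMfd.pullback (inclHom M (n + 1))
          (NMfd.pullback (degHom M (subsets (n + 1)) n i) (secAt (subsets n) I α))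
      rw [inclHom_secAt n hI, degHom_secAt hI, degHom_secAt (subsets_subset n hI),
        degFib_of_le hi hI, map_sum]
      exact Finset.sum_congr rfl fun J hJ =>
        (inclHom_secAt (n + 1) (Finset.mem_filter.1 hJ).1 α).symm
  exact congrArg (fun F => NMfd.pullback F c) h

theorem degHom_inclHom_last {n : ℕ} (c : (tan M n).C) :
    NMfd.pullback (degHom M (subsets (n + 2)) (n + 1) (n + 1)) (NMfd.pullback (inclHom M n) c) =
      NMfd.pullback (inclHom M (n + 1)) (NMfd.pullback (inclHom M n) c) := by
  have h : degHom M (subsets (n + 2)) (n + 1) (n + 1) ≫ inclHom M n =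
      inclHom M (n + 1) ≫ inclHom M n := by
    refine copies_hom_ext (fun f => ?_) fun I hI _ α => ?_
    · change NMfd.pullback (degHom M (subsets (n + 2)) (n + 1) (n + 1))
          (NMfd.pullback (inclHom M n) ((tanBundle M n).fn f)) =
        NMfd.pullback (inclHom M (n + 1)) (NMfd.pullback (inclHom M n) ((tanBundle M n).fn f))
      rw [inclHom_fn, degHom_fn, inclHom_fn]
    · change NMfd.pullback (degHom M (subsets (n + 2)) (n + 1) (n + 1))
          (NMfd.pullback (inclHom M n) (secAt (subsets n) I α)) =
        NMfd.pullback (inclHom M (n + 1)) (NMfd.pullback (inclHom M n) (secAt (subsets n) I α))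
      rw [inclHom_secAt n hI, degHom_secAt (subsets_subset n hI), degFib_last hI,
        Finset.sum_singleton, inclHom_secAt (n + 1) (subsets_subset n hI)]
  exact congrArg (fun F => NMfd.pullback F c) h

variable (cov : Connection M) [CovariantDerivative.ContMDiffCovariantDerivative cov ∞] {n : ℕ}

theorem insert_empty_eq_singleton (n : ℕ) : ({n} : Finset ℕ) = insert n ∅ := rfl

theorem degFibHom_genAt_singleton (hi : i ≤ n) (x : M.pt) :
    (degFibHom (n + 2) (n + 1) i x).toLinearMap.comp (genAt M (subsets (n + 1)) {n + 1} x) =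
      genAt M (subsets (n + 2)) {n + 2} x := by
  ext β
  change degFibHom (n + 2) (n + 1) i x (genAt M (subsets (n + 1)) {n + 1} x β) = _
  rw [degFibHom_genAt singleton_mem_subsets, insert_empty_eq_singleton (n + 1),
    sum_degFib_insert_of_le hi (Finset.empty_mem_powerset _), degFib_empty, Finset.sum_singleton]
  rfl

theorem degFibHom_genAt_singleton_last (x : M.pt) :
    (degFibHom (n + 2) (n + 1) (n + 1) x).toLinearMap.comp
        (genAt M (subsets (n + 1)) {n + 1} x) =
      genAt M (subsets (n + 2)) {n + 1} x + genAt M (subsets (n + 2)) {n + 2} x := by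
  ext β
  change degFibHom (n + 2) (n + 1) (n + 1) x (genAt M (subsets (n + 1)) {n + 1} x β) = _
  rw [degFibHom_genAt singleton_mem_subsets, insert_empty_eq_singleton (n + 1),
    degFib_last_insert (Finset.empty_mem_powerset _), Finset.sum_pair]
  · rfl
  · simp

/-- Both composites are derivations over the same morphism, so it suffices to compare them on
generators. There the quadratic terms agree summand by summand, because the same `∇` is used at both
levels. -/
theorem degHom_delta_of_le (hi : i ≤ n) (c : (tan M n).C) :
    NMfd.pullback (degHom M (subsets (n + 2)) (n + 1) i) (delta cov n c) =
      delta cov (n + 1) (NMfd.pullback (degHom M (subsets (n + 1)) n i) c) := by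
  let D : (tan M n).C →ₗ[ℝ] (tan M (n + 2)).C :=
    (NMfd.pullback (degHom M (subsets (n + 2)) (n + 1) i)).toLinearMap.comp (delta cov n) -
      (delta cov (n + 1)).comp (NMfd.pullback (degHom M (subsets (n + 1)) n i)).toLinearMap
  have hD : ∀ c, D c = NMfd.pullback (degHom M (subsets (n + 2)) (n + 1) i) (delta cov n c) -
      delta cov (n + 1) (NMfd.pullback (degHom M (subsets (n + 1)) n i) c) := fun c => rfl
  have h0 : D = 0 := by
    refine copies_eq_zero_of_derivation (inclHom M (n + 1) ≫ degHom M (subsets (n + 1)) n i) D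
      (fun m a ha b => ?_) (fun f => ?_) fun I hI hI' α => ?_
    · change _ = D a * NMfd.pullback (inclHom M (n + 1))
          (NMfd.pullback (degHom M (subsets (n + 1)) n i) b) +
        (-1 : ℝ) ^ m • (NMfd.pullback (inclHom M (n + 1))
          (NMfd.pullback (degHom M (subsets (n + 1)) n i) a) * D b)
      rw [hD, hD, hD, delta_mul cov ha, map_mul, delta_mul cov (NMfd.pullback_mem _ ha), map_add,
        map_smul, map_mul, map_mul, degHom_inclHom_of_le hi, degHom_inclHom_of_le hi, sub_mul,
        mul_sub, smul_sub]
      abel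
    · rw [hD, delta_fn, degHom_fn, delta_fn, degHom_secAt singleton_mem_subsets,
        insert_empty_eq_singleton (n + 1), sum_degFib_insert_of_le hi
        (Finset.empty_mem_powerset _), degFib_empty, Finset.sum_singleton]
      exact sub_self _
    · rw [hD, degHom_secAt hI, map_sum, sub_eq_zero]
      refine GrBundle.raw_injective (funext fun x => ?_)
      have h1 : (degFibHom (n + 2) (n + 1) i x).toLinearMap.comp
          (genAt M (subsets (n + 1)) I x) =
          ∑ J ∈ degFib (n + 1) i I, genAt M (subsets (n + 2)) J x := by
        ext β
        rw [LinearMap.sum_apply, ← degFib_of_le hi hI]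
        exact degFibHom_genAt (subsets_subset n hI) x β
      rw [raw_degHom, raw_delta_secAt cov ⟨hI, hI'⟩, map_add, map_quad,
        degFibHom_genAt_singleton hi, h1, degFibHom_genAt (insert_mem_subsets hI),
        sum_degFib_insert_of_le hi hI, quad_sum_right, ← Finset.sum_add_distrib,
        GrBundle.raw_sum, Finset.sum_apply]
      refine Finset.sum_congr rfl fun J hJ => ?_
      have hJ1 := mem_degFib.1 hJ
      have hJ2 : J.Nonempty := Finset.card_pos.1 (by rw [hJ1.2.1]; exact Finset.card_pos.2 hI')
      rw [raw_delta_secAt cov ⟨Finset.mem_powerset.2 hJ1.1, hJ2⟩]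
  exact sub_eq_zero.1 (LinearMap.congr_fun h0 c)

theorem quad_add_left {x : M.pt} {A : Type*} [Ring A] [Algebra ℝ A]
    (φ φ' ψ : (M.T x →ₗ[ℝ] ℝ) →ₗ[ℝ] A) (B : M.T x →ₗ[ℝ] M.T x →ₗ[ℝ] ℝ) :
    quad (φ + φ') ψ B = quad φ ψ B + quad φ' ψ B := by
  simp only [quad, LinearMap.add_apply, add_mul, smul_add, Finset.sum_add_distrib]

/-- Under the last degeneracy both `ε_{n+1}` and `ε_{n+2}` pull back to `ε_{n+1}`, so the derivation
becomes a sum of derivations in the two new directions. -/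
theorem degHom_delta_last (c : (tan M n).C) :
    NMfd.pullback (degHom M (subsets (n + 2)) (n + 1) (n + 1)) (delta cov n c) =
      NMfd.pullback (inclHom M (n + 1)) (delta cov n c) +
        delta cov (n + 1) (NMfd.pullback (inclHom M n) c) := by
  let D : (tan M n).C →ₗ[ℝ] (tan M (n + 2)).C :=
    (NMfd.pullback (degHom M (subsets (n + 2)) (n + 1) (n + 1))).toLinearMap.comp (delta cov n) -
      ((NMfd.pullback (inclHom M (n + 1))).toLinearMap.comp (delta cov n) +
        (delta cov (n + 1)).comp (NMfd.pullback (inclHom M n)).toLinearMap)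
  have hD : ∀ c, D c =
      NMfd.pullback (degHom M (subsets (n + 2)) (n + 1) (n + 1)) (delta cov n c) -
      (NMfd.pullback (inclHom M (n + 1)) (delta cov n c) +
        delta cov (n + 1) (NMfd.pullback (inclHom M n) c)) := fun c => rfl
  have h0 : D = 0 := by
    refine copies_eq_zero_of_derivation (inclHom M (n + 1) ≫ inclHom M n) D
      (fun m a ha b => ?_) (fun f => ?_) fun I hI hI' α => ?_
    · change _ = D a * NMfd.pullback (inclHom M (n + 1)) (NMfd.pullback (inclHom M n) b) +
        (-1 : ℝ) ^ m • (NMfd.pullback (inclHom M (n + 1)) (NMfd.pullback (inclHom M n) a) * D b)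
      rw [hD, hD, hD, delta_mul cov ha, map_mul (NMfd.pullback (inclHom M n)),
        delta_mul cov (NMfd.pullback_mem _ ha), map_add, map_add,
        map_smul, map_smul, map_mul, map_mul, map_mul, map_mul, degHom_inclHom_last,
        degHom_inclHom_last, sub_mul, mul_sub, smul_sub, mul_add, add_mul, smul_add]
      abel
    · rw [hD, delta_fn, inclHom_fn, delta_fn, degHom_secAt singleton_mem_subsets,
        inclHom_secAt _ singleton_mem_subsets, insert_empty_eq_singleton (n + 1),
        degFib_last_insert (Finset.empty_mem_powerset _), Finset.sum_pair]
      · exact sub_self _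
      · simp
    · rw [hD, inclHom_secAt n hI, sub_eq_zero]
      refine GrBundle.raw_injective (funext fun x => ?_)
      have h1 : (degFibHom (n + 2) (n + 1) (n + 1) x).toLinearMap.comp
          (genAt M (subsets (n + 1)) I x) = genAt M (subsets (n + 2)) I x := by
        ext β
        refine (degFibHom_genAt (subsets_subset n hI) x β).trans ?_
        rw [degFib_last hI, Finset.sum_singleton]
      have h2 : (inclFib (n + 1) x).toLinearMap.comp (genAt M (subsets (n + 1)) I x) =
          genAt M (subsets (n + 2)) I x := by
        ext β
        exact inclFib_genAt (n + 1) (subsets_subset n hI) x β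
      have h3 : (inclFib (n + 1) x).toLinearMap.comp (genAt M (subsets (n + 1)) {n + 1} x) =
          genAt M (subsets (n + 2)) {n + 1} x := by
        ext β
        exact inclFib_genAt (n + 1) singleton_mem_subsets x β
      have hne : insert (n + 1) I ≠ insert (n + 2) I := fun h => by
        have h4 : n + 2 ∈ insert (n + 1) I := h ▸ Finset.mem_insert_self _ _
        rcases Finset.mem_insert.1 h4 with h5 | h5
        · omega
        · have := Finset.mem_Icc.1 (Finset.mem_powerset.1 hI h5)
          omega
      rw [GrBundle.raw_add, Pi.add_apply, raw_degHom, raw_inclHom,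
        raw_delta_secAt cov ⟨hI, hI'⟩, raw_delta_secAt cov ⟨subsets_subset n hI, hI'⟩, map_add,
        map_add, map_quad, map_quad, h1, h2, h3, degFibHom_genAt_singleton_last,
        degFibHom_genAt (insert_mem_subsets hI), degFib_last_insert hI, Finset.sum_pair hne,
        inclFib_genAt _ (insert_mem_subsets hI), quad_add_left]
      abel
  exact sub_eq_zero.1 (LinearMap.congr_fun h0 c)

/-- The coefficients are iterated images under `inclHom` and `delta`, and the strict morphism
`degHom` is compatible with both. Hence it is the degeneracy, and no correction terms in `∇` occur.
-/
theorem degHom_splitPoint (m : ℕ) (hi : i ≤ m) {I : Finset ℕ} (hI : I ∈ subsets m) (f : M.Fun) :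
    NMfd.pullback (degHom M (subsets (m + 1)) m i) ((splitPoint cov m).c I f) =
      ∑ J ∈ degFib (m + 1) i I, (splitPoint cov (m + 1)).c J f := by
  have hempty : ∀ m, NMfd.pullback (degHom M (subsets (m + 1)) m i) ((splitPoint cov m).c ∅ f) =
      ∑ J ∈ degFib (m + 1) i ∅, (splitPoint cov (m + 1)).c J f := fun m => by
    rw [degFib_empty, Finset.sum_singleton, splitPoint_empty, splitPoint_empty, degHom_fn]
  induction m generalizing I with
  | zero =>
    have h : I = ∅ := by simpa using hI
    subst h
    exact hempty 0
  | succ n ih =>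
    have hcase : I ∈ subsets n ∨ ∃ J ∈ subsets n, I = insert (n + 1) J := by
      by_cases h : n + 1 ∈ I
      · exact Or.inr ⟨I.erase (n + 1), Finset.mem_powerset.2 (subset_Icc_of_notMem
          ((Finset.erase_subset _ _).trans (Finset.mem_powerset.1 hI)) (Finset.notMem_erase _ _)),
          (Finset.insert_erase h).symm⟩
      · exact Or.inl (Finset.mem_powerset.2 (subset_Icc_of_notMem (Finset.mem_powerset.1 hI) h))
    have hnot : ∀ J ∈ degFib (n + 1) i I, n + 2 ∉ J := fun J hJ h => by
      have := Finset.mem_Icc.1 ((mem_degFib.1 hJ).1 h)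
      omega
    rcases Nat.lt_or_ge n i with hn | hn
    · have hin : i = n + 1 := by omega
      subst hin
      rcases hcase with h | ⟨J, hJ, rfl⟩
      · rw [splitPoint_of_notMem cov (notMem_of_mem_subsets h), degHom_inclHom_last,
          degFib_last h, Finset.sum_singleton,
          splitPoint_of_notMem cov (notMem_of_mem_subsets hI),
          splitPoint_of_notMem cov (notMem_of_mem_subsets h)]
      · have hJ2 := notMem_of_mem_subsets (subsets_subset n hJ)
        have hne : insert (n + 1) J ≠ insert (n + 2) J := fun h => by
          have h4 : n + 2 ∈ insert (n + 1) J := h ▸ Finset.mem_insert_self _ _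
          rcases Finset.mem_insert.1 h4 with h5 | h5
          · omega
          · exact hJ2 h5
        have h5 : (splitPoint cov (n + 1 + 1)).c (insert (n + 2) J) f =
            delta cov (n + 1) ((splitPoint cov (n + 1)).c J f) := splitPoint_insert cov hJ2 f
        rw [splitPoint_insert cov (notMem_of_mem_subsets hJ), degHom_delta_last,
          degFib_last_insert hJ, Finset.sum_pair hne,
          splitPoint_of_notMem cov (notMem_of_mem_subsets hI),
          splitPoint_insert cov (notMem_of_mem_subsets hJ),
          h5, splitPoint_of_notMem cov (notMem_of_mem_subsets hJ)]
    · rcases hcase with h | ⟨J, hJ, rfl⟩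
      · rw [splitPoint_of_notMem cov (notMem_of_mem_subsets h), degHom_inclHom_of_le hn,
          ih hn h, map_sum, degFib_of_le hn h]
        exact Finset.sum_congr rfl fun J hJ => (splitPoint_of_notMem cov (hnot J hJ) f).symm
      · rw [splitPoint_insert cov (notMem_of_mem_subsets hJ), degHom_delta_of_le cov hn,
          ih hn hJ, map_sum, sum_degFib_insert_of_le hn hJ]
        refine Finset.sum_congr rfl fun K hK => (splitPoint_insert cov ?_ f).symm
        exact notMem_of_mem_subsets (Finset.mem_powerset.2 (mem_degFib.1 hK).1)

theorem isDegeneracy_degHom (l i : ℕ) (hi : i < l) :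
    IsDegeneracy i (splitPoint cov l) (splitPoint cov (l - 1))
      (degHom M (subsets l) (l - 1) i) := by
  obtain ⟨m, rfl⟩ : ∃ m, l = m + 1 := ⟨l - 1, by omega⟩
  intro I hI f
  refine (degHom_splitPoint cov m (by omega) (Finset.mem_powerset.2 hI) f).trans ?_
  refine Finset.sum_congr ?_ fun _ _ => rfl
  ext J
  simp only [degFib, Finset.mem_filter]
  tauto

end DegeneracyHom

/-! ### Degeneracies and faces of finite sets -/

section Faces

/-- The increasing map which misses the value `i + 1`. -/
def face (i j : ℕ) : ℕ := if j ≤ i then j else j + 1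

theorem degen_face (i j : ℕ) : degen i (face i j) = j := by
  unfold degen face
  split_ifs <;> omega

theorem degen_face_pred {i j : ℕ} (hi : i ≠ 0) : degen i (face (i - 1) j) = j := by
  unfold degen face
  split_ifs <;> omega

theorem face_degen {i j : ℕ} (hj : j ≠ i + 1) : face i (degen i j) = j := by
  unfold degen face
  split_ifs <;> omega

theorem face_pred_degen {i j : ℕ} (hi : i ≠ 0) (hj : j ≠ i) : face (i - 1) (degen i j) = j := by
  unfold degen face
  split_ifs <;> omega

theorem face_injective (i : ℕ) : Function.Injective (face i) := fun a b h => by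
  rw [← degen_face i a, h, degen_face]

theorem face_ne (i j : ℕ) : face i j ≠ i + 1 := by
  unfold face
  split_ifs <;> omega

theorem degen_comp_degen {i j : ℕ} (h : i ≤ j) (x : ℕ) :
    degen i (degen (j + 1) x) = degen j (degen i x) := by
  unfold degen
  split_ifs <;> omega

variable {m i : ℕ} {I J : Finset ℕ}

theorem image_face_mem_subsets (hI : I ∈ subsets m) : I.image (face i) ∈ subsets (m + 1) := by
  refine Finset.mem_powerset.2 fun x hx => ?_
  obtain ⟨y, hy, rfl⟩ := Finset.mem_image.1 hx
  have := Finset.mem_Icc.1 (Finset.mem_powerset.1 hI hy)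
  refine Finset.mem_Icc.2 ?_
  unfold face
  split_ifs <;> omega

theorem image_degen_mem_subsets (hi : i ≤ m) (hJ : J ∈ subsets (m + 1)) (h : i + 1 ∉ J) :
    J.image (degen i) ∈ subsets m := by
  refine Finset.mem_powerset.2 fun x hx => ?_
  obtain ⟨y, hy, rfl⟩ := Finset.mem_image.1 hx
  have := Finset.mem_Icc.1 (Finset.mem_powerset.1 hJ hy)
  have hne : y ≠ i + 1 := fun h' => h (h' ▸ hy)
  refine Finset.mem_Icc.2 ?_
  unfold degen
  split_ifs <;> omega

theorem image_face_image_degen (h : i + 1 ∉ J) : (J.image (degen i)).image (face i) = J := by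
  rw [Finset.image_image]
  exact (Finset.image_congr (g := id) fun j hj =>
    face_degen fun h' => h (h' ▸ hj)).trans Finset.image_id

theorem image_degen_image_face (i : ℕ) (I : Finset ℕ) : (I.image (face i)).image (degen i) = I := by
  rw [Finset.image_image]
  exact (Finset.image_congr (g := id) fun j _ => degen_face i j).trans Finset.image_id

theorem card_image_degen (h : i + 1 ∉ J) : (J.image (degen i)).card = J.card :=
  Finset.card_image_of_injOn fun a ha b hb hab => by
    rw [← face_degen (i := i) fun h' => h (h' ▸ ha), hab, face_degen fun h' => h (h' ▸ hb)]

theorem notMem_image_face (i : ℕ) (I : Finset ℕ) : i + 1 ∉ I.image (face i) := fun h => by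
  obtain ⟨j, -, hj⟩ := Finset.mem_image.1 h
  exact face_ne i j hj

theorem image_face_mem_degFib (hI : I ∈ subsets m) : I.image (face i) ∈ degFib (m + 1) i I :=
  mem_degFib.2 ⟨Finset.mem_powerset.1 (image_face_mem_subsets hI),
    Finset.card_image_of_injective _ (face_injective i), image_degen_image_face i I⟩

theorem eq_image_face_of_mem_degFib (hJ : J ∈ degFib (m + 1) i I) (h : i + 1 ∉ J) :
    J = I.image (face i) := by
  rw [← (mem_degFib.1 hJ).2.2, image_face_image_degen h]

/-- Only `i` and `i + 1` have a common image. As `J` contains `i + 1` and the degeneracy is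
injective on it, `i ∉ J`, and off `i` the degeneracy is inverted by `face (i - 1)`. Here `i ≠ 0`,
because `i ∈ I`. -/
theorem eq_image_face_pred_of_mem_degFib (hI : I ∈ subsets m) (hJ : J ∈ degFib (m + 1) i I)
    (h : i + 1 ∈ J) : i ∈ I ∧ J = I.image (face (i - 1)) := by
  obtain ⟨h1, h2, h3⟩ := mem_degFib.1 hJ
  have hdeg : degen i (i + 1) = i := degen_of_lt (Nat.lt_succ_self i)
  have h4 : i ∈ I := by
    rw [← h3]
    exact Finset.mem_image.2 ⟨_, h, hdeg⟩
  have hi : i ≠ 0 := by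
    have := Finset.mem_Icc.1 (Finset.mem_powerset.1 hI h4)
    omega
  have hinj : Set.InjOn (degen i) J := Finset.card_image_iff.1 (by rw [h3, h2])
  have h5 : i ∉ J := fun h5 => by
    have := hinj h5 h (by rw [hdeg, degen_of_le le_rfl])
    omega
  refine ⟨h4, ?_⟩
  rw [← h3, Finset.image_image]
  exact ((Finset.image_congr (g := id) fun j hj =>
    face_pred_degen hi fun h' => h5 (h' ▸ hj)).trans Finset.image_id).symm

theorem image_face_pred_mem_degFib (hI : I ∈ subsets m) (h : i ∈ I) :
    I.image (face (i - 1)) ∈ degFib (m + 1) i I := by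
  have hi : i ≠ 0 := by
    have := Finset.mem_Icc.1 (Finset.mem_powerset.1 hI h)
    omega
  refine mem_degFib.2 ⟨Finset.mem_powerset.1 (image_face_mem_subsets hI),
    Finset.card_image_of_injective _ (face_injective _), ?_⟩
  rw [Finset.image_image]
  exact (Finset.image_congr (g := id) fun j _ => degen_face_pred hi).trans Finset.image_id

variable {A : Type*} [AddCommGroup A]

/-- The sections `face i` and `face (i - 1)` of the degeneracy account for the whole fibre; they
differ in whether the element `i` of `I` is lifted to `i` or to `i + 1`. -/
theorem sum_degFib (hI : I ∈ subsets m) (y : Finset ℕ → A) :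
    ∑ J ∈ degFib (m + 1) i I, y J =
      y (I.image (face i)) + if i ∈ I then y (I.image (face (i - 1))) else 0 := by
  have h0 := image_face_mem_degFib (i := i) hI
  split_ifs with h
  · have h1 := image_face_pred_mem_degFib hI h
    have hi : i ≠ 0 := by
      have := Finset.mem_Icc.1 (Finset.mem_powerset.1 hI h)
      omega
    have h2 : i + 1 ∈ I.image (face (i - 1)) :=
      Finset.mem_image.2 ⟨i, h, by unfold face; split_ifs <;> omega⟩
    have hne : I.image (face i) ≠ I.image (face (i - 1)) := fun h3 =>
      notMem_image_face i I (h3 ▸ h2)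
    rw [← Finset.sum_pair hne]
    congr 1
    ext J
    rw [Finset.mem_insert, Finset.mem_singleton]
    constructor
    · intro hJ
      by_cases h4 : i + 1 ∈ J
      · exact Or.inr (eq_image_face_pred_of_mem_degFib hI hJ h4).2
      · exact Or.inl (eq_image_face_of_mem_degFib hJ h4)
    · rintro (rfl | rfl)
      · exact h0
      · exact h1
  · rw [add_zero, Finset.sum_eq_single_of_mem _ h0]
    intro J hJ hne
    by_cases h4 : i + 1 ∈ J
    · exact absurd (eq_image_face_pred_of_mem_degFib hI hJ h4).1 h
    · exact absurd (eq_image_face_of_mem_degFib hJ h4) hne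

/-- The sets with as many elements as `I`, and image `I` under the composite of two degeneracies. -/
def degFib₂ (l i j : ℕ) (I : Finset ℕ) : Finset (Finset ℕ) :=
  (subsets l).filter fun J => J.card = I.card ∧ J.image (fun x => degen i (degen j x)) = I

/-- Cardinality cannot grow under images, so its preservation by the composite forces its
preservation at the intermediate set. Double sums thus depend only on the composite degeneracy. -/
theorem sum_sum_degFib {j : ℕ} (hj : j ≤ m + 1) (hI : I ∈ subsets m) (y : Finset ℕ → A) :
    ∑ J ∈ degFib (m + 1) i I, ∑ K ∈ degFib (m + 2) j J, y K =
      ∑ K ∈ degFib₂ (m + 2) i j I, y K := by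
  have hmaps : ∀ K ∈ degFib₂ (m + 2) i j I, K.image (degen j) ∈ degFib (m + 1) i I := by
    intro K hK
    rw [degFib₂, Finset.mem_filter, Finset.mem_powerset] at hK
    obtain ⟨h1, h2, h3⟩ := hK
    have h4 : (K.image (degen j)).image (degen i) = I := by
      rw [Finset.image_image]
      exact h3
    refine mem_degFib.2 ⟨fun x hx => ?_, le_antisymm ?_ ?_, h4⟩
    -- The degeneracies fix `0`; as `0 ∉ I`, it cannot lie in the intermediate set.
    · have hx0 : x ≠ 0 := by
        rintro rfl
        have h5 : degen i 0 ∈ I := by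
          rw [← h4]
          exact Finset.mem_image_of_mem _ hx
        rw [degen_of_le (Nat.zero_le i)] at h5
        have := Finset.mem_Icc.1 (Finset.mem_powerset.1 hI h5)
        omega
      obtain ⟨y, hy, rfl⟩ := Finset.mem_image.1 hx
      have := Finset.mem_Icc.1 (h1 hy)
      refine Finset.mem_Icc.2 ⟨by omega, ?_⟩
      unfold degen
      split_ifs <;> omega
    · rw [← h2]
      exact Finset.card_image_le
    · rw [← h4]
      exact Finset.card_image_le
  rw [← Finset.sum_fiberwise_of_maps_to hmaps]
  refine Finset.sum_congr rfl fun J hJ => Finset.sum_congr ?_ fun _ _ => rfl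
  obtain ⟨-, h2, h3⟩ := mem_degFib.1 hJ
  ext K
  simp only [degFib, degFib₂, Finset.mem_filter]
  constructor
  · rintro ⟨h4, h5, h6⟩
    refine ⟨⟨h4, h5.trans h2, ?_⟩, h6⟩
    rw [← h3, ← h6, Finset.image_image]
    rfl
  · rintro ⟨⟨h4, h5, -⟩, h6⟩
    exact ⟨h4, h5.trans h2.symm, h6⟩

theorem sum_sum_degFib_comm {j : ℕ} (hij : i ≤ j) (hj : j ≤ m) (hI : I ∈ subsets m)
    (y : Finset ℕ → A) :
    ∑ J ∈ degFib (m + 1) i I, ∑ K ∈ degFib (m + 2) (j + 1) J, y K =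
      ∑ J ∈ degFib (m + 1) j I, ∑ K ∈ degFib (m + 2) i J, y K := by
  rw [sum_sum_degFib (by omega) hI, sum_sum_degFib (by omega) hI, degFib₂, degFib₂]
  simp only [degen_comp_degen hij]

theorem degFib_subset {l : ℕ} : degFib l i I ⊆ subsets l := Finset.filter_subset _ _

/-- A function on the proper subsets of `{1, …, m + 1}` is determined by its sums over the fibres
of the degeneracies. -/
theorem eq_zero_of_sum_degFib (y : Finset ℕ → A)
    (h : ∀ i ≤ m, ∀ I ∈ subsets m, ∑ J ∈ degFib (m + 1) i I, y J = 0)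
    (hJ : J ∈ subsets (m + 1)) (hne : J ≠ Finset.Icc 1 (m + 1)) : y J = 0 := by
  -- Induction on the missing element: a set without `r + 1` is the first set over its image under
  -- the `r`-th degeneracy, and the second set over this image misses `r`, where `y` already
  -- vanishes. For `r = 0` there is no second set, since `0` is never in `I`.
  have key : ∀ r ≤ m, ∀ J ∈ subsets (m + 1), r + 1 ∉ J → y J = 0 := by
    intro r
    induction r with
    | zero =>
      intro hr J hJ h0
      have hI := image_degen_mem_subsets hr hJ h0
      have h1 := h 0 hr _ hI
      rwa [sum_degFib hI, image_face_image_degen h0, if_neg, add_zero] at h1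
      intro h2
      have := Finset.mem_Icc.1 (Finset.mem_powerset.1 hI h2)
      omega
    | succ r ih =>
      intro hr J hJ h0
      have hI := image_degen_mem_subsets hr hJ h0
      have h1 := h _ hr _ hI
      rw [sum_degFib hI, image_face_image_degen h0, Nat.add_sub_cancel,
        ih (by omega) _ (image_face_mem_subsets hI) (notMem_image_face r _), ite_self,
        add_zero] at h1
      exact h1
  obtain ⟨x, hx, hxJ⟩ : ∃ x ∈ Finset.Icc 1 (m + 1), x ∉ J := by
    by_contra! h0
    exact hne (Finset.Subset.antisymm (Finset.mem_powerset.1 hJ) h0)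
  rw [Finset.mem_Icc] at hx
  refine key (x - 1) (by omega) J hJ ?_
  rwa [Nat.sub_add_cancel hx.1]

/-- Extension by zero along the face of sets which do not contain `r + 1`. -/
def extendFace (r : ℕ) (e : Finset ℕ → A) (J : Finset ℕ) : A :=
  if r + 1 ∈ J then 0 else e (J.image (degen r))

/-- The second set in the fibre contains `i + 1`, where the extension is zero. -/
theorem sum_degFib_extendFace (e : Finset ℕ → A) (hI : I ∈ subsets m) :
    ∑ J ∈ degFib (m + 1) i I, extendFace i e J = e I := by
  rw [sum_degFib hI, extendFace, if_neg (notMem_image_face i I), image_degen_image_face]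
  split_ifs with h
  · have hi : i ≠ 0 := by
      have := Finset.mem_Icc.1 (Finset.mem_powerset.1 hI h)
      omega
    rw [extendFace, if_pos, add_zero]
    exact Finset.mem_image.2 ⟨i, h, by unfold face; split_ifs <;> omega⟩
  · exact add_zero _

theorem mem_image_face_of_lt {r j : ℕ} (h : j < r) : r + 1 ∈ I.image (face j) ↔ r ∈ I := by
  rw [Finset.mem_image]
  constructor
  · rintro ⟨x, hx, hx'⟩
    have h1 : x = r := by
      unfold face at hx'
      split_ifs at hx' <;> omega
    exact h1 ▸ hx
  · intro hr
    exact ⟨r, hr, by unfold face; split_ifs <;> omega⟩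

theorem image_degen_image_face_of_lt {r j : ℕ} (h : j < r) (hr : r ∉ I) :
    (I.image (face j)).image (degen r) = (I.image (degen (r - 1))).image (face j) := by
  rw [Finset.image_image, Finset.image_image]
  refine Finset.image_congr fun x hx => ?_
  have hx' : x ≠ r := fun h' => hr (h' ▸ hx)
  change degen r (face j x) = face j (degen (r - 1) x)
  unfold degen face
  split_ifs <;> omega

/-- For `i < r` and `r ∉ I`, the `r`-th degeneracy carries the fibre over `I` to the fibre over
`I.image (degen (r - 1))`, so the sum is one of the vanishing sums of `e`. If `r ∈ I`, all sets in
the fibre contain `r + 1`. -/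
theorem sum_degFib_extendFace_of_lt {r : ℕ} (hi : i < r) (hr : r ≤ m + 1) (e : Finset ℕ → A)
    (he : ∀ K ∈ subsets m, ∑ J ∈ degFib (m + 1) i K, e J = 0) (hI : I ∈ subsets (m + 1)) :
    ∑ J ∈ degFib (m + 2) i I, extendFace r e J = 0 := by
  rw [sum_degFib hI, extendFace, extendFace]
  simp only [mem_image_face_of_lt hi, mem_image_face_of_lt ((Nat.sub_le i 1).trans_lt hi)]
  by_cases h : r ∈ I
  · simp [h]
  · have hK : I.image (degen (r - 1)) ∈ subsets m :=
      image_degen_mem_subsets (by omega) hI (by rwa [Nat.sub_add_cancel (by omega)])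
    have h1 := he _ hK
    have h2 : i ∈ I.image (degen (r - 1)) ↔ i ∈ I := by
      rw [Finset.mem_image]
      constructor
      · rintro ⟨x, hx, hx'⟩
        have hne : x ≠ r := fun h' => h (h' ▸ hx)
        have h3 : x = i := by
          unfold degen at hx'
          split_ifs at hx' <;> omega
        exact h3 ▸ hx
      · intro h3
        exact ⟨i, h3, degen_of_le (by omega)⟩
    rw [sum_degFib hK] at h1
    rw [if_neg h, if_neg h, image_degen_image_face_of_lt hi h,
      image_degen_image_face_of_lt ((Nat.sub_le i 1).trans_lt hi) h]
    refine Eq.trans ?_ h1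
    simp only [h2]

/-- A compatible family of functions on the subsets of `{1, …, m}` comes from a function on the
subsets of `{1, …, m + 1}`. -/
theorem exists_sum_degFib_eq (P : ℕ → AddSubgroup A) (x : ℕ → Finset ℕ → A)
    (hP : ∀ i ≤ m, ∀ I ∈ subsets m, x i I ∈ P I.card)
    (hx : ∀ i j, i ≤ j → j + 1 ≤ m → ∀ K ∈ subsets (m - 1),
      ∑ I ∈ degFib m i K, x (j + 1) I = ∑ I ∈ degFib m j K, x i I) :
    ∃ y : Finset ℕ → A, (∀ J ∈ subsets (m + 1), y J ∈ P J.card) ∧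
      ∀ i ≤ m, ∀ I ∈ subsets m, ∑ J ∈ degFib (m + 1) i I, y J = x i I := by
  -- The equations are solved one degeneracy at a time: the remaining error `e` for the degeneracy
  -- `r`, extended by zero along the face, repairs this equation and preserves the earlier ones. The
  -- subgroups `P` keep track of degrees.
  have key : ∀ r ≤ m + 1, ∃ y : Finset ℕ → A, (∀ J ∈ subsets (m + 1), y J ∈ P J.card) ∧
      ∀ i < r, ∀ I ∈ subsets m, ∑ J ∈ degFib (m + 1) i I, y J = x i I := by
    intro r
    induction r with
    | zero => exact fun _ => ⟨0, fun J _ => zero_mem _, fun i hi => absurd hi (Nat.not_lt_zero i)⟩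
    | succ r ih =>
      intro hr
      obtain ⟨y, hy, hy'⟩ := ih (by omega)
      let e : Finset ℕ → A := fun I => x r I - ∑ J ∈ degFib (m + 1) r I, y J
      have heP : ∀ I ∈ subsets m, e I ∈ P I.card := fun I hI => sub_mem (hP r (by omega) I hI) <|
        sum_mem fun J hJ => (mem_degFib.1 hJ).2.1 ▸ hy J (degFib_subset hJ)
      refine ⟨y + extendFace r e, fun J hJ => add_mem (hy J hJ) ?_, fun i hi I hI => ?_⟩
      · unfold extendFace
        split_ifs with h
        · exact zero_mem _
        · rw [← card_image_degen h]
          exact heP _ (image_degen_mem_subsets (by omega) hJ h)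
      · simp only [Pi.add_apply, Finset.sum_add_distrib]
        rcases Nat.lt_or_ge i r with h | h
        · obtain ⟨n, rfl⟩ : ∃ n, m = n + 1 := ⟨m - 1, by omega⟩
          rw [hy' i h I hI, sum_degFib_extendFace_of_lt h (by omega) e (fun K hK => ?_) hI,
            add_zero]
          -- The error has zero sums over the fibres of the degeneracy `i < r`: this is the
          -- compatibility of the family together with the commutation of double sums.
          obtain ⟨j, rfl⟩ : ∃ j, r = j + 1 := ⟨r - 1, by omega⟩
          simp only [e, Finset.sum_sub_distrib]
          rw [hx i j (by omega) (by omega) K hK, sum_sum_degFib_comm (by omega) (by omega) hK,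
            ← Finset.sum_sub_distrib]
          refine Finset.sum_eq_zero fun J hJ => ?_
          rw [hy' i h J (degFib_subset hJ), sub_self]
        · have hir : i = r := by omega
          subst hir
          rw [sum_degFib_extendFace e hI]
          exact add_sub_cancel _ _
  obtain ⟨y, hy, hy'⟩ := key (m + 1) le_rfl
  exact ⟨y, hy, fun i hi => hy' i (by omega)⟩

end Faces

/-! ### The limit of the degeneracies -/

section Limit

variable {M : Mfd.{u}} {m i : ℕ} {I : Finset ℕ}

/-- The full set has `m + 1` elements, more than any subset of `{1, …, m}`. This is why the
degeneracies descend to the quotient. -/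
theorem degFib_subset_properSubsets (hI : I ∈ subsets m) :
    degFib (m + 1) i I ⊆ properSubsets (m + 1) := fun J hJ => by
  refine Finset.mem_erase.2 ⟨?_, degFib_subset hJ⟩
  rintro rfl
  have h1 := (mem_degFib.1 hJ).2.1
  have h2 := Finset.card_le_card (Finset.mem_powerset.1 hI)
  simp only [Nat.card_Icc] at h1 h2
  omega

theorem degFib_eq_filter_properSubsets {i : ℕ} {I : Finset ℕ} (hI : I ∈ subsets m) :
    degFib (m + 1) i I = (properSubsets (m + 1)).filter
      fun J => J.card = I.card ∧ J.image (degen i) = I := by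
  ext J
  rw [Finset.mem_filter]
  exact ⟨fun hJ => ⟨degFib_subset_properSubsets hI hJ, (mem_degFib.1 hJ).2⟩,
    fun hJ => mem_degFib.2 ⟨Finset.mem_powerset.1 (Finset.mem_of_mem_erase hJ.1), hJ.2⟩⟩

theorem degHom_quot_secAt (hI : I ∈ subsets m) (α : OneForm M) :
    NMfd.pullback (degHom M (properSubsets (m + 1)) m i) (secAt (subsets m) I α) =
      ∑ J ∈ degFib (m + 1) i I, secAt (properSubsets (m + 1)) J α := by
  by_cases h : I.Nonempty
  · rw [degFib_eq_filter_properSubsets hI]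
    exact relHom_secAt _ ⟨hI, h⟩ α
  · rw [Finset.not_nonempty_iff_eq_empty] at h
    subst h
    rw [degFib_empty, Finset.sum_singleton, secAt_neg (by simp), secAt_neg (by simp)]
    exact map_zero _

theorem degHom_comp_comm (S : Finset (Finset ℕ)) (hS : ∀ {i : ℕ} {I} (_ : I ∈ subsets m) α,
      NMfd.pullback (degHom M S m i) (secAt (subsets m) I α) =
        ∑ J ∈ degFib (m + 1) i I, secAt S J α) {i j : ℕ} (hij : i ≤ j) (hj : j + 1 ≤ m) :
    degHom M S m (j + 1) ≫ degHom M (subsets m) (m - 1) i =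
      degHom M S m i ≫ degHom M (subsets m) (m - 1) j := by
  obtain ⟨n, rfl⟩ : ∃ n, m = n + 1 := ⟨m - 1, by omega⟩
  refine copies_hom_ext (fun f => ?_) fun I hI _ α => ?_
  · change NMfd.pullback (degHom M S (n + 1) (j + 1)) (NMfd.pullback
      (degHom M (subsets (n + 1)) n i) ((tanBundle M n).fn f)) =
      NMfd.pullback (degHom M S (n + 1) i) (NMfd.pullback
      (degHom M (subsets (n + 1)) n j) ((tanBundle M n).fn f))
    rw [degHom_fn, degHom_fn, degHom_fn, degHom_fn]
  · have hI' : I ∈ subsets n := hI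
    change NMfd.pullback (degHom M S (n + 1) (j + 1)) (NMfd.pullback
      (degHom M (subsets (n + 1)) n i) (secAt (subsets n) I α)) =
      NMfd.pullback (degHom M S (n + 1) i) (NMfd.pullback
      (degHom M (subsets (n + 1)) n j) (secAt (subsets n) I α))
    rw [degHom_secAt hI', degHom_secAt hI', map_sum, map_sum,
      Finset.sum_congr rfl fun J hJ => hS (degFib_subset hJ) α,
      Finset.sum_congr rfl fun J hJ => hS (i := i) (degFib_subset hJ) α]
    exact sum_sum_degFib_comm hij (by omega) hI' _

theorem degHom_quot_comp_comm {i j : ℕ} (hij : i ≤ j) (hj : j + 1 ≤ m) :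
    degHom M (properSubsets (m + 1)) m (j + 1) ≫ degHom M (subsets m) (m - 1) i =
      degHom M (properSubsets (m + 1)) m i ≫ degHom M (subsets m) (m - 1) j :=
  degHom_comp_comm _ (fun hI α => degHom_quot_secAt hI α) hij hj

/-- The quotient morphism `T[1]^k M → T[1]^k M / T[k]M`. -/
def quotHom (M : Mfd.{u}) (k : ℕ) : tan M k ⟶ quot M k :=
  relHom (· = ·) M (subsets k) (properSubsets k)

theorem quotHom_secAt {k : ℕ} {J : Finset ℕ} (hJ : J ∈ properSubsets k) (α : OneForm M) :
    NMfd.pullback (quotHom M k) (secAt (properSubsets k) J α) = secAt (subsets k) J α := by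
  by_cases h : J.Nonempty
  · refine (relHom_secAt _ ⟨hJ, h⟩ α).trans ?_
    rw [Finset.sum_eq_single_of_mem J (Finset.mem_filter.2 ⟨Finset.mem_of_mem_erase hJ, rfl, rfl⟩)]
    exact fun I hI hne => absurd (Finset.mem_filter.1 hI).2.2 hne
  · rw [secAt_neg fun h' => h h'.2, secAt_neg fun h' => h h'.2]
    exact map_zero _

theorem quotHom_degHom :
    quotHom M (m + 1) ≫ degHom M (properSubsets (m + 1)) m i = degHom M (subsets (m + 1)) m i := by
  refine copies_hom_ext (fun f => ?_) fun I hI _ α => ?_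
  · change NMfd.pullback (quotHom M (m + 1)) (NMfd.pullback
      (degHom M (properSubsets (m + 1)) m i) ((tanBundle M m).fn f)) = _
    rw [degHom_fn, degHom_fn]
    exact relHom_fn _ f
  · have hI' : I ∈ subsets m := hI
    change NMfd.pullback (quotHom M (m + 1)) (NMfd.pullback
      (degHom M (properSubsets (m + 1)) m i) (secAt (subsets m) I α)) = _
    rw [degHom_quot_secAt hI', degHom_secAt hI', map_sum]
    exact Finset.sum_congr rfl fun J hJ => quotHom_secAt (degFib_subset_properSubsets hI' hJ) α

/-- The differences of the two pullbacks of `α`, as a function of the summand, have zero sums over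
all fibres, so they vanish on the proper subsets, which are the summands of the quotient. -/
theorem quot_hom_ext {X : NMfd.{u}} {F G : X ⟶ quot M (m + 1)}
    (h : ∀ i ≤ m, F ≫ degHom M (properSubsets (m + 1)) m i =
      G ≫ degHom M (properSubsets (m + 1)) m i) : F = G := by
  have h' : ∀ i ≤ m, ∀ c, NMfd.pullback F (NMfd.pullback (degHom M (properSubsets (m + 1)) m i) c) =
      NMfd.pullback G (NMfd.pullback (degHom M (properSubsets (m + 1)) m i) c) :=
    fun i hi c => congrArg (fun H => NMfd.pullback H c) (h i hi)
  refine copies_hom_ext (fun f => ?_) fun J hJ _ α => ?_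
  · have h1 := h' 0 (Nat.zero_le m) ((tanBundle M m).fn f)
    rwa [degHom_fn] at h1
  · refine sub_eq_zero.1 (eq_zero_of_sum_degFib (fun J => NMfd.pullback F
      (secAt (properSubsets (m + 1)) J α) - NMfd.pullback G (secAt (properSubsets (m + 1)) J α))
      (fun i hi I hI => ?_) (Finset.mem_of_mem_erase hJ) (Finset.ne_of_mem_erase hJ))
    have h1 := h' i hi (secAt (subsets m) I α)
    rw [degHom_quot_secAt hI, map_sum, map_sum] at h1
    rw [Finset.sum_sub_distrib, h1, sub_self]

/-- The semilinear maps from 1-forms to functions of degree `n`. -/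
def semilinear {X : NMfd.{u}} (χ : M.Fun →ₐ[ℝ] X.C) (n : ℕ) : AddSubgroup (OneForm M → X.C) where
  carrier := {a | (∀ α, a α ∈ X.deg n) ∧ (∀ α β, a (α + β) = a α + a β) ∧
    ∀ (f : M.Fun) α, a (f • α) = χ f * a α}
  zero_mem' := ⟨fun _ => zero_mem _, fun _ _ => (add_zero _).symm, fun _ _ => (mul_zero _).symm⟩
  add_mem' := by
    rintro a b ⟨h1, h2, h3⟩ ⟨h1', h2', h3'⟩
    refine ⟨fun α => add_mem (h1 α) (h1' α), fun α β => ?_, fun f α => ?_⟩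
    · simp only [Pi.add_apply, h2, h2']
      abel
    · simp only [Pi.add_apply, h3, h3', mul_add]
  neg_mem' := by
    rintro a ⟨h1, h2, h3⟩
    refine ⟨fun α => neg_mem (h1 α), fun α β => ?_, fun f α => ?_⟩
    · simp only [Pi.neg_apply, h2]
      abel
    · simp only [Pi.neg_apply, h3, mul_neg]

/-- The values on generators are found by `exists_sum_degFib_eq` in the group of maps from 1-forms
to `X.C`, with the semilinear maps of degree `n` as subgroups. -/
theorem exists_quot_lift {X : NMfd.{u}} (g : ℕ → (X ⟶ tan M m))
    (hg : ∀ i j, i ≤ j → j + 1 ≤ m → g (j + 1) ≫ degHom M (subsets m) (m - 1) i =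
      g i ≫ degHom M (subsets m) (m - 1) j) :
    ∃ F : X ⟶ quot M (m + 1), ∀ i ≤ m, F ≫ degHom M (properSubsets (m + 1)) m i = g i := by
  have hg' : ∀ i j, i ≤ j → j + 1 ≤ m → ∀ c, NMfd.pullback (g (j + 1))
      (NMfd.pullback (degHom M (subsets m) (m - 1) i) c) =
      NMfd.pullback (g i) (NMfd.pullback (degHom M (subsets m) (m - 1) j) c) :=
    fun i j h1 h2 c => congrArg (fun H => NMfd.pullback H c) (hg i j h1 h2)
  let χ : M.Fun →ₐ[ℝ] X.C := (NMfd.pullback (g 0)).comp (GrBundle.fnHom (V := tanBundle M m))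
  -- The square with indices `0 ≤ j` shows that `g (j + 1)` and `g 0` agree on functions of `M`.
  have hχ : ∀ i ≤ m, ∀ f, NMfd.pullback (g i) ((tanBundle M m).fn f) = χ f := by
    intro i hi f
    rcases i with _ | j
    · rfl
    · have h1 := hg' 0 j (Nat.zero_le j) hi ((tanBundle M (m - 1)).fn f)
      rw [degHom_fn, degHom_fn] at h1
      exact h1
  obtain ⟨y, hy, hy'⟩ := exists_sum_degFib_eq (m := m) (A := OneForm M → X.C) (semilinear χ)
    (fun i I α => NMfd.pullback (g i) (secAt (subsets m) I α))
    (fun i hi I hI => ⟨fun α => NMfd.pullback_mem (g i) (secAt_mem I α),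
      fun α β => by beta_reduce; rw [secAt_add, map_add],
      fun f α => by
        beta_reduce
        rw [secAt_smul, map_mul]
        exact congrArg (· * _) (hχ i hi f)⟩)
    (fun i j hij hj K hK => by
      obtain ⟨n, rfl⟩ : ∃ n, m = n + 1 := ⟨m - 1, by omega⟩
      funext α
      have h1 := hg' i j hij hj (secAt (subsets n) K α)
      have hK' : K ∈ subsets n := hK
      change NMfd.pullback (g (j + 1)) (NMfd.pullback (degHom M (subsets (n + 1)) n i) _) =
        NMfd.pullback (g i) (NMfd.pullback (degHom M (subsets (n + 1)) n j) _) at h1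
      rw [degHom_secAt hK', degHom_secAt hK', map_sum, map_sum] at h1
      rw [Finset.sum_apply, Finset.sum_apply]
      exact h1)
  have hJ : ∀ J : (quotBundle M (m + 1)).ι, J.1 ∈ subsets (m + 1) := fun J =>
    Finset.mem_of_mem_erase J.2.1
  obtain ⟨F, hF, hF'⟩ := GrBundle.exists_hom (S := properSubsets (m + 1)) χ
    (fun f => NMfd.pullback_mem (g 0) (GrBundle.fn_mem f))
    (fun J => AddMonoidHom.mk' (y J.1) (hy _ (hJ J)).2.1) (fun J => (hy _ (hJ J)).1)
    (fun J => (hy _ (hJ J)).2.2)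
  refine ⟨F, fun i hi => copies_hom_ext (fun f => ?_) fun I hI hI' α => ?_⟩
  · change NMfd.pullback F (NMfd.pullback
      (degHom M (properSubsets (m + 1)) m i) ((tanBundle M m).fn f)) = _
    rw [degHom_fn, hχ i hi]
    exact hF f
  · have hI2 : I ∈ subsets m := hI
    change NMfd.pullback F (NMfd.pullback
      (degHom M (properSubsets (m + 1)) m i) (secAt (subsets m) I α)) = _
    rw [degHom_quot_secAt hI2, map_sum]
    have h1 := congrFun (hy' i hi I hI2) α
    rw [Finset.sum_apply] at h1
    refine Eq.trans (Finset.sum_congr rfl fun J hJ => ?_) h1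
    have h2 : J ∈ properSubsets (m + 1) ∧ J.Nonempty :=
      ⟨degFib_subset_properSubsets hI2 hJ, Finset.card_pos.1
        (by rw [(mem_degFib.1 hJ).2.1]; exact Finset.card_pos.2 hI')⟩
    rw [secAt_pos h2]
    exact hF' ⟨J, h2⟩ α

theorem isLimit_quot (M : Mfd.{u}) (m : ℕ) :
    ∃ h, Nonempty (Limits.IsLimit (Limits.Multifork.ofι
      (squares (m + 1) (fun i => degHom M (subsets m) (m - 1) i)) (quot M (m + 1))
      (fun i : Fin (m + 1) => degHom M (properSubsets (m + 1)) m i) h)) := by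
  refine ⟨fun p => degHom_quot_comp_comm p.2.1 (by have := p.2.2; omega), ?_⟩
  have key : ∀ E : Limits.Multifork (squares (m + 1) fun i => degHom M (subsets m) (m - 1) i),
      ∃ F : E.pt ⟶ quot M (m + 1), ∀ i : Fin (m + 1),
        F ≫ degHom M (properSubsets (m + 1)) m i = E.ι i := by
    intro E
    let g : ℕ → (E.pt ⟶ tan M m) := fun i => if h : i < m + 1 then E.ι ⟨i, h⟩ else E.ι 0
    have hg : ∀ i (h : i < m + 1), g i = E.ι ⟨i, h⟩ := fun i h => dif_pos h
    obtain ⟨F, hF⟩ := exists_quot_lift g fun i j hij hj => by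
      rw [hg i (by omega), hg (j + 1) (by omega)]
      exact E.condition ⟨(i, j), hij, by omega⟩
    exact ⟨F, fun i => (hF i (by omega)).trans (hg i i.2)⟩
  choose lift hlift using key
  exact ⟨Limits.Multifork.IsLimit.mk _ lift hlift fun E F hF => quot_hom_ext fun i hi =>
    (hF ⟨i, by omega⟩).trans (hlift E ⟨i, by omega⟩).symm⟩

end Limit

/-! ### Composition of strict morphisms -/

/-- Strict pullbacks compose like transposed block matrices; only intermediate summands of the
common degree contribute, so the sum is finite. -/
theorem GrBundle.strictHom_comp {L M N : Mfd.{u}} {U : GrBundle L} {V : GrBundle M} {W : GrBundle N}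
    {φ : L.pt → M.pt} {ψ : M.pt → N.pt} {f : ∀ a b y, U.V a y →ₗ[ℝ] V.V b (φ y)}
    {g : ∀ a b y, V.V a y →ₗ[ℝ] W.V b (ψ y)} {h : ∀ a b y, U.V a y →ₗ[ℝ] W.V b (ψ (φ y))}
    (hf : IsBundleMap φ f) (hg : IsBundleMap ψ g) (hh : IsBundleMap (fun y => ψ (φ y)) h)
    (hfg : ∀ a c y, U.deg a = W.deg c → ∑ b ∈ (V.finite_deg (W.deg c)).toFinset,
      (g b c (φ y)).comp (f a b y) = h a c y) :
    strictHom hf ≫ strictHom hg = strictHom hh := by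
  refine hom_ext (fun q => raw_injective ?_) fun c s => raw_injective (funext fun y => ?_)
  · change U.raw (NMfd.pullback (strictHom hf) (NMfd.pullback (strictHom hg) (W.fn q))) = _
    ext y
    rw [raw_strictHom, raw_strictHom_fn, raw_strictHom_fn]
    exact AlgHom.commutes _ _
  · change U.raw (NMfd.pullback (strictHom hf) (NMfd.pullback (strictHom hg) (W.sec c s))) y = _
    rw [raw_strictHom, raw_strictHom_sec, raw_strictHom_sec, Finset.sum_apply, Finset.sum_apply,
      map_sum]
    have h1 : ∀ b ∈ (V.finite_deg (W.deg c)).toFinset,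
        fibHom φ (strictGen φ f) (strictGen_mem φ f) y
          (V.secRaw b (fun z => (s.toFun (ψ z)).comp (g b c z)) (φ y)) =
        ∑ a ∈ (U.finite_deg (W.deg c)).toFinset,
          U.gen a y ((s.toFun (ψ (φ y))).comp ((g b c (φ y)).comp (f a b y))) := by
      intro b hb
      have hb' : V.deg b = W.deg c := by simpa using hb
      refine (fibHom_gen _ _ _ _ _ _).trans ((strictGen_apply _ _ _ _ _).trans ?_)
      rw [hb']
      rfl
    rw [Finset.sum_congr rfl h1, Finset.sum_comm]
    refine Finset.sum_congr rfl fun a ha => ?_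
    have ha' : U.deg a = W.deg c := by simpa using ha
    rw [← map_sum]
    change _ = U.gen a y ((s.toFun (ψ (φ y))).comp (h a c y))
    rw [← hfg a c y ha']
    congr 1
    ext v
    simp [LinearMap.sum_apply, map_sum]

/-! ### The embedding into the product -/

section Embedding

/-- A trivialization of the pullback bundle has the fibre coordinate of the original one, so the
fibre component of this map is that of the identity. -/
theorem contMDiff_pullback_lift {M N : Mfd.{u}} (φ : C^∞⟮𝓘(ℝ, N.E), N.pt; 𝓘(ℝ, M.E), M.pt⟯) :
    ContMDiff (𝓘(ℝ, N.E).prod 𝓘(ℝ, M.E)) (𝓘(ℝ, M.E).prod 𝓘(ℝ, M.E)) ∞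
      (fun v : TotalSpace M.E ((φ : N.pt → M.pt) *ᵖ M.T) =>
        (⟨φ v.proj, v.snd⟩ : TotalSpace M.E M.T)) := by
  intro v
  rw [contMDiffAt_totalSpace]
  refine ⟨(φ.contMDiff.comp (contMDiff_proj ((φ : N.pt → M.pt) *ᵖ M.T))).contMDiffAt, ?_⟩
  exact (contMDiffAt_totalSpace.1
    (contMDiffAt_id (I := 𝓘(ℝ, N.E).prod 𝓘(ℝ, M.E)) (n := ∞) (x := v))).2

theorem contMDiff_to_pullback {L M N : Mfd.{u}} (φ : C^∞⟮𝓘(ℝ, N.E), N.pt; 𝓘(ℝ, M.E), M.pt⟯)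
    {g : TotalSpace L.E L.T → TotalSpace M.E ((φ : N.pt → M.pt) *ᵖ M.T)}
    (h1 : ContMDiff (𝓘(ℝ, L.E).prod 𝓘(ℝ, L.E)) 𝓘(ℝ, N.E) ∞ fun v => (g v).proj)
    (h2 : ContMDiff (𝓘(ℝ, L.E).prod 𝓘(ℝ, L.E)) (𝓘(ℝ, M.E).prod 𝓘(ℝ, M.E)) ∞
      fun v => (⟨φ (g v).proj, (g v).snd⟩ : TotalSpace M.E M.T)) :
    ContMDiff (𝓘(ℝ, L.E).prod 𝓘(ℝ, L.E)) (𝓘(ℝ, N.E).prod 𝓘(ℝ, M.E)) ∞ g := by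
  intro v
  rw [contMDiffAt_totalSpace]
  exact ⟨h1 v, (contMDiffAt_totalSpace.1 (h2 v)).2⟩

variable {M : Mfd.{u}} {k m : ℕ} {S : Finset (Finset ℕ)}

theorem powCopiesMap_pos (i : Fin k) (a : (copies M S).ι) (y : (M.pow k).pt) :
    powCopiesMap M k S i (i, a) a y =
      (LinearMap.id : M.T (M.powProj k i y) →ₗ[ℝ] M.T (M.powProj k i y)) :=
  dif_pos ⟨rfl, rfl⟩

theorem powCopiesMap_neg {i j : Fin k} {a b : (copies M S).ι} (h : ¬ (j = i ∧ a.1 = b.1))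
    (y : (M.pow k).pt) : powCopiesMap M k S i (j, a) b y = 0 :=
  dif_neg h

theorem powCopiesMap_isBundleMap (M : Mfd.{u}) (k : ℕ) (S : Finset (Finset ℕ)) (i : Fin k) :
    GrBundle.IsBundleMap (M.powProj k i) (powCopiesMap M k S i) := by
  refine ⟨(M.powProj k i).contMDiff, ?_⟩
  rintro ⟨j, a⟩ b -
  by_cases h : j = i ∧ a.1 = b.1
  · obtain ⟨rfl, h⟩ := h
    obtain rfl := Subtype.ext h
    simp only [powCopiesMap_pos]
    exact contMDiff_pullback_lift (M.powProj k j)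
  · simp only [powCopiesMap_neg h]
    have h0 : ContMDiff (𝓘(ℝ, (M.pow k).E).prod 𝓘(ℝ, M.E)) (𝓘(ℝ, M.E).prod 𝓘(ℝ, M.E)) ∞
        (fun v : TotalSpace M.E ((M.powProj k j : (M.pow k).pt → M.pt) *ᵖ M.T) =>
          (⟨M.powProj k i v.proj, 0⟩ : TotalSpace M.E M.T)) :=
      ((contMDiff_zeroSection ℝ M.T).comp (M.powProj k i).contMDiff).comp
        (contMDiff_proj ((M.powProj k j : (M.pow k).pt → M.pt) *ᵖ M.T))
    exact h0

/-- The diagonal `M → M^k`. -/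
def Mfd.diag (M : Mfd.{u}) (k : ℕ) : M.pt → (M.pow k).pt := fun x _ => x

/-- The splitting of the diagonal of a power of a vector space. -/
def diagEquiv (E : Type u) [NormedAddCommGroup E] [NormedSpace ℝ E] [FiniteDimensional ℝ E]
    (m : ℕ) : (E × (Fin m → E)) ≃L[ℝ] (Fin (m + 1) → E) :=
  LinearEquiv.toContinuousLinearEquiv
    { toFun := fun p => Fin.cases p.1 fun j => p.1 + p.2 j
      invFun := fun y => (y 0, fun j => y j.succ - y 0)
      map_add' := fun p q => by
        ext i
        refine Fin.cases rfl (fun j => ?_) i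
        exact add_add_add_comm _ _ _ _
      map_smul' := fun r p => by
        ext i
        refine Fin.cases rfl (fun j => ?_) i
        exact (smul_add _ _ _).symm
      left_inv := fun p => by
        ext
        · rfl
        · exact add_sub_cancel_left _ _
      right_inv := fun y => by
        ext i
        refine Fin.cases rfl (fun j => ?_) i
        exact add_sub_cancel _ _ }

theorem diagEquiv_zero {E : Type u} [NormedAddCommGroup E] [NormedSpace ℝ E]
    [FiniteDimensional ℝ E] (v : E) : diagEquiv E m (v, 0) = fun _ => v := by
  ext i
  refine Fin.cases rfl (fun j => ?_) i
  exact add_zero v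

/-- In product charts the diagonal is `v ↦ (v, …, v)`, the image of `(v, 0)` under `diagEquiv`; the
projection to one factor is a continuous left inverse. -/
theorem isSmoothEmbedding_diag (M : Mfd.{u}) (m : ℕ) :
    Manifold.IsSmoothEmbedding 𝓘(ℝ, M.E) 𝓘(ℝ, (M.pow (m + 1)).E) ∞ (M.diag (m + 1)) := by
  let _ := powCharts M (m + 1)
  have := powSmooth M (m + 1)
  have hcont : Continuous fun (x : M.pt) (_ : Fin (m + 1)) => x := by fun_prop
  refine (⟨Manifold.IsImmersionOfComplement.isImmersion (F := Fin m → M.E) fun x => ?_, ?_⟩ :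
    Manifold.IsSmoothEmbedding 𝓘(ℝ, M.E) 𝓘(ℝ, Fin (m + 1) → M.E) ∞
      (fun (x : M.pt) (_ : Fin (m + 1)) => x))
  · refine Manifold.IsImmersionAtOfComplement.mk_of_continuousAt hcont.continuousAt
      (diagEquiv M.E m) (chartAt M.E x) (chartAt (Fin (m + 1) → M.E) fun _ => x)
      (mem_chart_source _ _) (mem_chart_source _ _) (IsManifold.chart_mem_maximalAtlas x)
      (IsManifold.chart_mem_maximalAtlas _) fun v hv => ?_
    refine Eq.trans ?_ (diagEquiv_zero v).symm
    have hv' : v ∈ (chartAt M.E x).target := by simpa using hv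
    funext i
    exact (chartAt M.E x).right_inv hv'
  · exact Topology.IsEmbedding.of_leftInverse (f := fun y : Fin (m + 1) → M.pt => y 0) (fun _ => rfl)
      (continuous_apply (A := fun _ : Fin (m + 1) => M.pt) 0) hcont

/-- The components of the bundle map which induces the morphism with components the degeneracies. -/
def diagMap (M : Mfd.{u}) (m : ℕ) (a : (quotBundle M (m + 1)).ι)
    (b : (powCopies M (m + 1) (subsets m)).ι) (x : M.pt) :
    (quotBundle M (m + 1)).V a x →ₗ[ℝ] (powCopies M (m + 1) (subsets m)).V b (M.diag (m + 1) x) :=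
  let b' : Fin (m + 1) × (copies M (subsets m)).ι := b
  if a.1.image (degen b'.1) = b'.2.1 then (LinearMap.id : M.T x →ₗ[ℝ] M.T x) else 0

theorem diagMap_isBundleMap (M : Mfd.{u}) (m : ℕ) :
    GrBundle.IsBundleMap (M.diag (m + 1)) (diagMap M m) := by
  have h := (isSmoothEmbedding_diag M m).contMDiff
  refine ⟨h, ?_⟩
  rintro a ⟨i, b⟩ -
  exact contMDiff_to_pullback (M.powProj (m + 1) i) (h.comp (contMDiff_proj M.T))
    (contMDiff_id_or_zero (a.1.image (degen i) = b.1))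

/-- A vector in the kernel has zero sums over all fibres of the degeneracies, so fibrewise
injectivity follows from `eq_zero_of_sum_degFib`, like uniqueness of morphisms into the limit. -/
theorem diagMap_isBundleEmbedding (M : Mfd.{u}) (m : ℕ) :
    GrBundle.IsBundleEmbedding (M.diag (m + 1)) (diagMap M m) := by
  refine ⟨isSmoothEmbedding_diag M m, fun x v hv => ?_⟩
  -- Extended by zero to the empty set, whose fibre sums have to vanish too, and to the full set,
  -- which lies in none of the fibres used.
  let y : Finset ℕ → M.T x := fun J =>
    if h : J ∈ properSubsets (m + 1) ∧ J.Nonempty then v ⟨J, h⟩ else 0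
  have hy : ∀ a : (quotBundle M (m + 1)).ι, y a.1 = v a := fun a => dif_pos a.2
  have hdiag : ∀ (i : Fin (m + 1)) (b : (copies M (subsets m)).ι)
      (a : (quotBundle M (m + 1)).ι), diagMap M m a (i, b) x (v a) =
      if a.1.image (degen i) = b.1 then y a.1 else 0 := fun i b a => by
    rw [hy]
    have h1 : ∀ (P : Prop) [Decidable P] (w : M.T x),
        (if P then (LinearMap.id : M.T x →ₗ[ℝ] M.T x) else 0) w = if P then w else 0 :=
      fun P _ w => by split_ifs <;> rfl
    exact h1 _ (v a)
  funext a
  refine (hy a).symm.trans (eq_zero_of_sum_degFib (m := m) y (fun i hi I hI => ?_)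
    (Finset.mem_of_mem_erase a.2.1) (Finset.ne_of_mem_erase a.2.1))
  by_cases hI' : I.Nonempty
  · rw [degFib_eq_filter_properSubsets hI]
    refine (sum_copies_index (M := M) (fun J => J.image (degen i) = I) hI' y).symm.trans ?_
    refine (Finset.sum_congr rfl fun a _ => ?_).trans (hv (⟨i, by omega⟩, ⟨I, hI, hI'⟩))
    exact (hdiag ⟨i, by omega⟩ ⟨I, hI, hI'⟩ a).symm
  · rw [Finset.not_nonempty_iff_eq_empty] at hI'
    subst hI'
    rw [degFib_empty, Finset.sum_singleton]
    exact dif_neg fun h => Finset.not_nonempty_empty h.2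

/-- Projecting to the factor `i` keeps only the row `(i, c)` of `diagMap`, which is the matrix of
the `i`-th degeneracy. -/
theorem strictHom_diagMap_comp (i : Fin (m + 1)) :
    GrBundle.strictHom (diagMap_isBundleMap M m) ≫
      GrBundle.strictHom (powCopiesMap_isBundleMap M (m + 1) (subsets m) i) =
        degHom M (properSubsets (m + 1)) m i := by
  refine GrBundle.strictHom_comp (φ := M.diag (m + 1)) (ψ := M.powProj (m + 1) i)
    (f := diagMap M m) (g := powCopiesMap M (m + 1) (subsets m) i)
    (h := relMap M (properSubsets (m + 1)) (subsets m) fun J I => J.image (degen i) = I)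
    (diagMap_isBundleMap M m) (powCopiesMap_isBundleMap M (m + 1) (subsets m) i)
    (relMap_isBundleMap _) fun a c x _ => ?_
  let G : (powCopies M (m + 1) (subsets m)).ι →
      ((quotBundle M (m + 1)).V a x →ₗ[ℝ] (tanBundle M m).V c x) := fun b =>
    (powCopiesMap M (m + 1) (subsets m) i b c (M.diag (m + 1) x)).comp (diagMap M m a b x)
  have hcomp : ∀ (b : (powCopies M (m + 1) (subsets m)).ι) φ,
      powCopiesMap M (m + 1) (subsets m) i b c (M.diag (m + 1) x) = φ →
        G b = φ.comp (diagMap M m a b x) := fun b φ h => h ▸ rfl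
  have hG : ∑ b ∈ ((powCopies M (m + 1) (subsets m)).finite_deg
      ((tanBundle M m).deg c)).toFinset, G b = G (i, c) := by
    refine Finset.sum_eq_single_of_mem (f := G) (i, c) ((Set.Finite.mem_toFinset _).2 rfl) ?_
    rintro ⟨j, b⟩ - hb
    exact hcomp _ _ (powCopiesMap_neg (fun h => hb (Prod.ext h.1 (Subtype.ext h.2))) _)
  exact hG.trans (hcomp _ LinearMap.id (powCopiesMap_pos i c _))

end Embedding

end

end NGraded

/-! ### Assembly of the theorem -/

theorem lemma3p8 (M : Mfd.{u}) (k : ℕ) (hk : 1 ≤ k) (cov : Connection M)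
    [CovariantDerivative.ContMDiffCovariantDerivative cov ∞] :
    ∃ u : ∀ l, DPoint l M (tan M l),
      IsSplitting cov u ∧ (∀ l, (u l).Represents) ∧
      ∃ (σ : ∀ l, ℕ → (tan M l ⟶ tan M (l - 1))) (q : tan M k ⟶ quot M k)
        (τ : Fin k → (quot M k ⟶ tan M (k - 1))),
        (∀ l i, 1 ≤ l → i < l → IsDegeneracy i (u l) (u (l - 1)) (σ l i)) ∧
        GrBundle.IsInducedBy q id (copiesMap M _ _) ∧
        (∀ i, q ≫ τ i = σ k i) ∧
        (∃ h, Nonempty (Limits.IsLimit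
          (Limits.Multifork.ofι (squares k (σ (k - 1))) (quot M k) τ h))) ∧
        ∃ (pr : Fin k → (tanPow M k (k - 1) ⟶ tan M (k - 1)))
          (F : quot M k ⟶ tanPow M k (k - 1)),
          (∀ i, GrBundle.IsInducedBy (pr i) (M.powProj k i) (powCopiesMap M k _ i)) ∧
          (∀ i, F ≫ pr i = τ i) ∧ GrBundle.IsStrictEmbedding F := by
  obtain ⟨m, rfl⟩ : ∃ m, k = m + 1 := ⟨k - 1, by omega⟩
  exact ⟨splitPoint cov, isSplitting_splitPoint cov, represents_splitPoint cov,
    fun l i => degHom M (subsets l) (l - 1) i, quotHom M (m + 1),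
    fun i => degHom M (properSubsets (m + 1)) m i,
    fun l i _ hi => isDegeneracy_degHom cov l i hi, relHom_isInducedBy_copiesMap,
    fun i => quotHom_degHom, isLimit_quot M m,
    fun i => GrBundle.strictHom (powCopiesMap_isBundleMap M (m + 1) (subsets m) i),
    GrBundle.strictHom (diagMap_isBundleMap M m),
    fun i => GrBundle.strictHom_isInducedBy _, strictHom_diagMap_comp,
    M.diag (m + 1), diagMap M m, diagMap_isBundleMap M m, diagMap_isBundleEmbedding M m,
    GrBundle.strictHom_isInducedBy _⟩
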